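/- Let $G$ be a compact Lie group with Lie algebra $\mathfrak g$. All manifolds are smooth, Hausdorff and second countable. A Hamiltonian $G$-manifold $(N,\omega,\Phi)$ is an oriented manifold $N$, possibly with boundary, with a smooth $G$-action, a $G$-invariant closed $2$-form $\omega$ (possibly degenerate) and a smooth $G$-equivariant map $\Phi\colon N\to\mathfrak g^*$ with $d\langle\Phi,X\rangle=\iota(X^\sharp)\omega$ for all $X\in\mathfrak g$, where $X^\sharp|_x=\frac{d}{dt}\big|_{t=0}\exp(tX)\cdot x$. It is proper if $\Phi$ is proper. If $\dim N=2n$ and $\Phi$ is proper, then $\mathrm{DH}_{(N,\omega,\Phi)}(\varphi):=\int_N(\varphi\circ\Phi)\,\frac{\omega^n}{n!}$ for $\varphi\in C_c^\infty(\mathfrak g^*)$. 1. Let $(W,\omega,\Phi)$ be a proper Hamiltonian $G$-manifold with boundary, of dimension $2n+1$, and give $\partial W$ the boundary orientation. Then $\partial W$, with the restricted action and the pullbacks of $\omega$ and $\Phi$, is a proper Hamiltonian $G$-manifold, and its distribution $\mathrm{DH}$ is identically zero. 2. A proper Hamiltonian cobordism between Hamiltonian $G$-manifolds $(M_0,\omega_0,\Phi_0)$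 and $(M_1,\omega_1,\Phi_1)$ without boundary is a proper Hamiltonian $G$-manifold with boundary $(W,\tilde\omega,\tilde\Phi)$ together with an orientation preserving diffeomorphism $i\colon -M_0\sqcup M_1\to\partial W$ such that $i^*\tilde\omega=\omega_0\sqcup\omega_1$ and $i^*\tilde\Phi=\Phi_0\sqcup\Phi_1$. If $M_0$, $M_1$ are even-dimensional, of the same dimension, and such a cobordism exists, then $\Phi_0$ and $\Phi_1$ are proper and $\mathrm{DH}_{(M_0,\omega_0,\Phi_0)}=\mathrm{DH}_{(M_1,\omega_1,\Phi_1)}$. 3. Fix a basis $X_1,\dots,X_r$ of $\mathfrak g$ with dual basis $\beta_1,\dots,\beta_r$ of $\mathfrak g^*$. A closed equivariant form on a $G$-manifold $M$ is an element $\eta=\sum_{\mathbf a}\eta_{\mathbf a}\beta^{\mathbf a}$ of $(\Omega^*(M)\otimes S(\mathfrak g^*))^G$ with $d(\eta(X))-\iota(X^\sharp)\eta(X)=0$ for all $X\in\mathfrak g$. For $(M,\omega,\Phi)$ proper let $\mathrm{DH}_{(M,\omega,\Phi)}(\eta)(\varphi):=\int_M e^{\omega}\wedge\sum_{\mathbf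 a}\big((\partial_{\beta_1}^{a_1}\cdots\partial_{\beta_r}^{a_r}\varphi)\circ\Phi\big)\,\eta_{\mathbf a}$, where $\partial_{\beta_i}$ is the derivative on $\mathfrak g^*$ in the direction $\beta_i$ and the integral of a form of mixed degree is that of its top degree part. Let $(M_0,\omega_0,\Phi_0)$ and $(M_1,\omega_1,\Phi_1)$ be Hamiltonian $G$-manifolds without boundary, of the same (even or odd) dimension, with closed equivariant forms $\eta_0$, $\eta_1$. If there is a proper Hamiltonian cobordism $(W,\tilde\omega,\tilde\Phi,i)$ between them and a closed equivariant form $\tilde\eta$ on $W$ with $i^*\tilde\eta=\eta_0\sqcup\eta_1$, then $\Phi_0$ and $\Phi_1$ are proper and $\mathrm{DH}_{(M_0,\omega_0,\Phi_0)}(\eta_0)=\mathrm{DH}_{(M_1,\omega_1,\Phi_1)}(\eta_1)$. -/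

import Mathlib

open scoped Manifold ContDiff Distributions TensorProduct
open TopologicalSpace

noncomputable section

namespace DHCob

/-! ### The wedge product of alternating forms on a vector space -/

section Wedge

variable {V : Type*} [AddCommGroup V] [Module ℝ V] [TopologicalSpace V]

/-- The wedge product as an alternating map, i.e.
`(α ∧ β)(v₁, …, vₙ) = ∑ sign σ · α(v_σ(1), …, v_σ(k)) β(v_σ(k+1), …, v_σ(k+l))`,
the sum over all `(k, l)`-shuffles `σ`. -/
def wedgeAlt {k l n : ℕ} (h : k + l = n) (α : V [⋀^Fin k]→L[ℝ] ℝ) (β : V [⋀^Fin l]→L[ℝ] ℝ) :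
    V [⋀^Fin n]→ₗ[ℝ] ℝ :=
  ((LinearMap.mul' ℝ ℝ).compAlternatingMap
    (α.toAlternatingMap.domCoprod β.toAlternatingMap)).domDomCongr
      (finSumFinEquiv.trans (finCongr h))

theorem continuous_wedgeAlt {k l n : ℕ} (h : k + l = n) (α : V [⋀^Fin k]→L[ℝ] ℝ)
    (β : V [⋀^Fin l]→L[ℝ] ℝ) : Continuous (fun v : Fin n → V => wedgeAlt h α β v) := by
  simp only [wedgeAlt, AlternatingMap.domDomCongr_apply, LinearMap.compAlternatingMap_apply,
    AlternatingMap.domCoprod_apply, sum_apply, map_sum]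
  refine continuous_finsetSum _ fun σ _ => ?_
  induction σ using Quotient.inductionOn' with
  | h σ =>
    have key : ∀ v : Fin n → V, LinearMap.mul' ℝ ℝ (AlternatingMap.domCoprod.summand
        α.toAlternatingMap β.toAlternatingMap (Quotient.mk'' σ)
          (v ∘ (finSumFinEquiv.trans (finCongr h)))) =
        ((Equiv.Perm.sign σ : ℤ) : ℝ) *
          (α (fun i => v (finSumFinEquiv.trans (finCongr h) (σ (Sum.inl i)))) *
            β (fun i => v (finSumFinEquiv.trans (finCongr h) (σ (Sum.inr i))))) := by
      intro v
      rw [AlternatingMap.domCoprod.summand_mk'']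
      change LinearMap.mul' ℝ ℝ (((Equiv.Perm.sign σ : ℤ)) •
        ((α fun i => v (finSumFinEquiv.trans (finCongr h) (σ (Sum.inl i)))) ⊗ₜ[ℝ]
          (β fun i => v (finSumFinEquiv.trans (finCongr h) (σ (Sum.inr i)))))) = _
      rw [map_zsmul, zsmul_eq_mul, LinearMap.mul'_apply]
    refine Continuous.congr ?_ fun v => (key v).symm
    exact continuous_const.mul
      ((α.cont.comp (continuous_pi fun i => continuous_apply _)).mul
        (β.cont.comp (continuous_pi fun i => continuous_apply _)))

/-- The wedge product of a `k`-form and an `l`-form on a vector space, in degree `n = k + l`. -/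
def wedge {k l n : ℕ} (h : k + l = n) (α : V [⋀^Fin k]→L[ℝ] ℝ) (β : V [⋀^Fin l]→L[ℝ] ℝ) :
    V [⋀^Fin n]→L[ℝ] ℝ :=
  { toMultilinearMap := (wedgeAlt h α β).toMultilinearMap
    cont := continuous_wedgeAlt h α β
    map_eq_zero_of_eq' := (wedgeAlt h α β).map_eq_zero_of_eq' }

end Wedge

/-! ### Differential forms on manifolds, possibly with boundary -/

section Forms

variable {m : ℕ} {H : Type*} [TopologicalSpace H]
  (I : ModelWithCorners ℝ (EuclideanSpace ℝ (Fin m)) H)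
  (M : Type*) [TopologicalSpace M] [ChartedSpace H M]

/-- (Not necessarily smooth) differential `k`-forms on `M`. -/
abbrev DForm (k : ℕ) : Type _ := (x : M) → TangentSpace I x [⋀^Fin k]→L[ℝ] ℝ

/-- Forms of mixed degree: the component of degree `k` is a `k`-form (it vanishes
automatically when `k` exceeds the dimension). -/
abbrev MixedForm : Type _ := (k : ℕ) → DForm I M k

variable {I M}

/-- The coordinate expression of a form in the chart at `x₀`: its pullback by the inverse chart,
a form on the target of the chart. -/
def chartRep {k : ℕ} (α : DForm I M k) (x₀ : M) (y : EuclideanSpace ℝ (Fin m)) :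
    EuclideanSpace ℝ (Fin m) [⋀^Fin k]→L[ℝ] ℝ :=
  (α ((extChartAt I x₀).symm y)).compContinuousLinearMap
    (mfderivWithin 𝓘(ℝ, EuclideanSpace ℝ (Fin m)) I (extChartAt I x₀).symm (Set.range I) y)

/-- A form is smooth if all its coordinate expressions are smooth. -/
def IsSmoothForm {k : ℕ} (α : DForm I M k) : Prop :=
  ∀ x₀ : M, ContDiffOn ℝ ∞ (chartRep α x₀) (extChartAt I x₀).target

/-- The exterior derivative, computed at each point in the chart at that point. -/
def extD {k : ℕ} (α : DForm I M k) : DForm I M (k + 1) := fun x =>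
  (extDerivWithin (chartRep α x) (Set.range I) (extChartAt I x x)).compContinuousLinearMap
    (mfderiv I 𝓘(ℝ, EuclideanSpace ℝ (Fin m)) (extChartAt I x) x)

/-- The contraction `ι(Y) α` of a form with a vector field: `(ι(Y) α)(v) = α(Y, v)`. -/
def contract {k : ℕ} (Y : (x : M) → TangentSpace I x) (α : DForm I M (k + 1)) : DForm I M k :=
  fun x => ContinuousAlternatingMap.curryLeft (E := EuclideanSpace ℝ (Fin m)) (α x) (Y x)

/-- The pullback of a form by a map `f`. -/
def pullback {m' : ℕ} {H' : Type*} [TopologicalSpace H']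
    {I' : ModelWithCorners ℝ (EuclideanSpace ℝ (Fin m')) H'}
    {N : Type*} [TopologicalSpace N] [ChartedSpace H' N] {k : ℕ}
    (f : N → M) (α : DForm I M k) : DForm I' N k :=
  fun x => (α (f x)).compContinuousLinearMap (mfderiv I' I f x)

/-- The wedge product of mixed forms. -/
def mixedWedge (α β : MixedForm I M) : MixedForm I M := fun k x =>
  ∑ i : Fin (k + 1), wedge (Nat.add_sub_cancel' (Nat.le_of_lt_succ i.2)) (α i x) (β (k - i) x)

/-- The mixed form `1`. -/
def mixedOne : MixedForm I M
  | 0 => fun x => ContinuousAlternatingMap.constOfIsEmpty ℝ (TangentSpace I x) (Fin 0) (1 : ℝ)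
  | _ + 1 => 0

/-- A `2`-form seen as a mixed form. -/
def ofTwoForm (ωM : DForm I M 2) : MixedForm I M
  | 2 => ωM
  | _ => 0

/-- The wedge power `ωⁿ` of a `2`-form. -/
def powForm (ωM : DForm I M 2) : ℕ → MixedForm I M
  | 0 => mixedOne
  | n + 1 => mixedWedge (ofTwoForm ωM) (powForm ωM n)

/-- `e^ω = ∑ⱼ ωʲ / j!`. (As `ωʲ` has degree `2j`, the terms with `j > k` do not contribute
in degree `k`.) -/
def expForm (ωM : DForm I M 2) : MixedForm I M := fun k =>
  ∑ j ∈ Finset.range (k + 1), ((j.factorial : ℝ)⁻¹) • powForm ωM j k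

end Forms

/-! ### Orientations and integration -/

section Integration

variable {m : ℕ} {H : Type*} [TopologicalSpace H]
  {I : ModelWithCorners ℝ (EuclideanSpace ℝ (Fin m)) H}
  {M : Type*} [TopologicalSpace M] [ChartedSpace H M]

/-- An orientation of an `m`-dimensional manifold is given by a nowhere vanishing smooth `m`-form
`o`: a frame `v` is positive if `o(v) > 0`. (Only the sign of `o` is ever used, and the opposite
orientation is `-o`.) -/
structure IsOrientationForm (o : DForm I M m) : Prop where
  smooth : IsSmoothForm o
  ne_zero : ∀ x, o x ≠ 0

/-- A smooth partition of unity subordinate to the chart domains. -/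
def chartPartition (I : ModelWithCorners ℝ (EuclideanSpace ℝ (Fin m)) H)
    (M : Type*) [TopologicalSpace M] [ChartedSpace H M] [IsManifold I ∞ M]
    [T2Space M] [SecondCountableTopology M] : SmoothPartitionOfUnity M I M Set.univ :=
  haveI : LocallyCompactSpace M := Manifold.locallyCompact_of_finiteDimensional I
  (SmoothPartitionOfUnity.exists_isSubordinate_chartAt_source I M).choose

theorem chartPartition_isSubordinate (I : ModelWithCorners ℝ (EuclideanSpace ℝ (Fin m)) H)
    (M : Type*) [TopologicalSpace M] [ChartedSpace H M] [IsManifold I ∞ M]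
    [T2Space M] [SecondCountableTopology M] :
    (chartPartition I M).IsSubordinate (fun x => (chartAt H x).source) :=
  haveI : LocallyCompactSpace M := Manifold.locallyCompact_of_finiteDimensional I
  (SmoothPartitionOfUnity.exists_isSubordinate_chartAt_source I M).choose_spec

/-- The standard frame of `ℝᵐ`. -/
def stdFrame (m : ℕ) : Fin m → EuclideanSpace ℝ (Fin m) := fun i => EuclideanSpace.single i 1

/-- The integral over the oriented manifold `(M, o)` of a (compactly supported) `m`-form `μ`:
the sum over the partition of unity `ρ` of the Lebesgue integrals, in the chart at `i`, of the
coefficient of `ρᵢ μ` with respect to `dx₁ ∧ ⋯ ∧ dxₘ`, times the sign `±1` by which the chart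
preserves or reverses the orientation. -/
def integral [IsManifold I ∞ M] [T2Space M] [SecondCountableTopology M]
    (o μ : DForm I M m) : ℝ :=
  ∑ᶠ i : M, ∫ y in (extChartAt I i).target,
    Real.sign (chartRep o i y (stdFrame m)) *
      (chartPartition I M i ((extChartAt I i).symm y) * chartRep μ i y (stdFrame m))

end Integration

/-! ### Boundaries -/

section Boundary

variable {m : ℕ}
  {W : Type*} [TopologicalSpace W] [ChartedSpace (EuclideanHalfSpace (m + 1)) W]
  {B : Type*} [TopologicalSpace B] [ChartedSpace (EuclideanSpace ℝ (Fin m)) B]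

/-- A tangent vector `ν` at a boundary point `p` is outward pointing if, in the chart at `p` with
values in the half space `{x₀ ≥ 0}`, its coordinate `ν₀` is negative. -/
def IsOutward (p : W) (ν : TangentSpace (𝓡∂ (m + 1)) p) : Prop :=
  (show EuclideanSpace ℝ (Fin (m + 1)) from
    mfderiv (𝓡∂ (m + 1)) 𝓘(ℝ, EuclideanSpace ℝ (Fin (m + 1)))
      (extChartAt (𝓡∂ (m + 1)) p) p ν) 0 < 0

/-- The map `j` from `(B, oB)` into the boundary of `(W, oW)` is orientation preserving for the
boundary orientation (outward normal first). -/
def PreservesBoundaryOrientation (oB : DForm (𝓡 m) B m) (oW : DForm (𝓡∂ (m + 1)) W (m + 1))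
    (j : B → W) : Prop :=
  ∀ (b : B) (ν : TangentSpace (𝓡∂ (m + 1)) (j b)), IsOutward (j b) ν →
    ∀ v : Fin m → TangentSpace (𝓡 m) b,
      0 < oB b v ↔
        0 < oW (j b) (Fin.cons ν fun a => mfderiv (𝓡 m) (𝓡∂ (m + 1)) j b (v a))

/-- `j` is an orientation preserving diffeomorphism from `(B, oB)` onto the boundary of
`(W, oW)`. -/
structure IsOrientedBoundary (oB : DForm (𝓡 m) B m) (oW : DForm (𝓡∂ (m + 1)) W (m + 1))
    (j : B → W) : Prop where
  embedding : Manifold.IsSmoothEmbedding (𝓡 m) (𝓡∂ (m + 1)) ∞ j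
  range_eq : Set.range j = (𝓡∂ (m + 1)).boundary W
  orientation : PreservesBoundaryOrientation oB oW j

end Boundary

/-! ### Hamiltonian `G`-manifolds -/

/-- The Lie algebra `𝔤 = T₁G` of an `r`-dimensional Lie group `G` (tangent spaces of manifolds
modelled on `ℝʳ` are, by definition, `ℝʳ`). -/
abbrev LieAlg (r : ℕ) : Type := EuclideanSpace ℝ (Fin r)

/-- The dual `𝔤*`. -/
abbrev LieDual (r : ℕ) : Type := LieAlg r →L[ℝ] ℝ

section Action

variable {r : ℕ} {G : Type*} [TopologicalSpace G] [ChartedSpace (EuclideanSpace ℝ (Fin r)) G]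
  [Group G]
  {m : ℕ} {H : Type*} [TopologicalSpace H]
  {I : ModelWithCorners ℝ (EuclideanSpace ℝ (Fin m)) H}
  {M : Type*} [TopologicalSpace M] [ChartedSpace H M]

/-- The adjoint action of `g` on `𝔤`: the derivative at `1` of the conjugation by `g`. -/
def Ad (g : G) : LieAlg r →L[ℝ] LieAlg r :=
  mfderiv (𝓡 r) (𝓡 r) (fun h : G => g * h * g⁻¹) 1

/-- The vector field `X♯` generated by `X ∈ 𝔤`: its value at `x` is the derivative at `1` of the
orbit map `g ↦ g • x`, applied to `X`; by the chain rule it is the velocity at `t = 0` of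
`c(t) • x` for every curve `c` in `G` through `1` with velocity `X`, such as `exp(tX)`. -/
def fundVF (G : Type*) [TopologicalSpace G] [ChartedSpace (EuclideanSpace ℝ (Fin r)) G]
    [Group G] [MulAction G M] (X : LieAlg r) (x : M) : TangentSpace I x :=
  (show EuclideanSpace ℝ (Fin m) from
    mfderiv (𝓡 r) I (fun g : G => g • x) 1 (show TangentSpace (𝓡 r) (1 : G) from X))

variable [MulAction G M]

/-- `(M, ω, Φ)`, with the orientation given by `o`, is a Hamiltonian `G`-manifold. The form `ω`
may be degenerate. -/
structure IsHamiltonian (G : Type*) [TopologicalSpace G]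
    [ChartedSpace (EuclideanSpace ℝ (Fin r)) G] [Group G] [MulAction G M]
    (o : DForm I M m) (ωM : DForm I M 2) (Φ : M → LieDual r) : Prop where
  orientation : IsOrientationForm o
  smooth : IsSmoothForm ωM
  closed : extD ωM = 0
  invariant : ∀ g : G, pullback (fun x : M => g • x) ωM = ωM
  smooth_moment : ContMDiff I 𝓘(ℝ, LieDual r) ∞ Φ
  equivariant : ∀ (g : G) (x : M) (X : LieAlg r), Φ (g • x) X = Φ x (Ad g⁻¹ X)
  hamilton : ∀ (X : LieAlg r) (x : M) (v : TangentSpace I x),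
    mfderiv I 𝓘(ℝ, ℝ) (fun y => Φ y X) x v =
      contract (fundVF G X) ωM x (fun _ : Fin 1 => v)

end Action

/-! ### Equivariant forms -/

section Equivariant

variable {r : ℕ} {m : ℕ} {H : Type*} [TopologicalSpace H]
  (I : ModelWithCorners ℝ (EuclideanSpace ℝ (Fin m)) H)
  (M : Type*) [TopologicalSpace M] [ChartedSpace H M]

/-- Elements `η = ∑ₐ ηₐ βᵃ` of `Ω*(M) ⊗ S(𝔤*)`, for the basis `β` of `𝔤*` dual to a given basis
of `𝔤`, as finitely supported families of coefficients `ηₐ` indexed by multi-indices `a`. -/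
abbrev EquivForm (r : ℕ) : Type _ := (Fin r →₀ ℕ) →₀ MixedForm I M

variable {I M}

/-- The value `η(X) = ∑ₐ β(X)ᵃ ηₐ` at `X ∈ 𝔤`. -/
def EquivForm.eval (b : Module.Basis (Fin r) ℝ (LieAlg r)) (η : EquivForm I M r)
    (X : LieAlg r) : MixedForm I M :=
  η.sum fun a α => (∏ i, (b.coord i X) ^ a i) • α

/-- The pullback of `η` by a map `f` (coefficientwise). -/
def EquivForm.PullsBackTo {m' : ℕ} {H' : Type*} [TopologicalSpace H']
    {I' : ModelWithCorners ℝ (EuclideanSpace ℝ (Fin m')) H'}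
    {N : Type*} [TopologicalSpace N] [ChartedSpace H' N]
    (η : EquivForm I M r) (f : N → M) (η' : EquivForm I' N r) : Prop :=
  ∀ a k, pullback f (η a k) = η' a k

/-- `η` is an equivariantly closed equivariant form: its coefficients are smooth, it is
`G`-invariant (`g^*(η(Ad_g X)) = η(X)`), and `d(η(X)) - ι(X♯) η(X) = 0` for all `X ∈ 𝔤`, where the
component of degree `k + 1` reads `d(η(X)ₖ) = ι(X♯) η(X)ₖ₊₂` and that of degree `0` reads
`ι(X♯) η(X)₁ = 0`. -/
structure IsClosedEquivForm (G : Type*) [TopologicalSpace G]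
    [ChartedSpace (EuclideanSpace ℝ (Fin r)) G] [Group G] [MulAction G M]
    (b : Module.Basis (Fin r) ℝ (LieAlg r)) (η : EquivForm I M r) : Prop where
  smooth : ∀ a k, IsSmoothForm (η a k)
  invariant : ∀ (g : G) (X : LieAlg r) (k : ℕ),
    pullback (fun x : M => g • x) (η.eval b (Ad g X) k) = η.eval b X k
  closed : ∀ (X : LieAlg r) (k : ℕ),
    extD (η.eval b X k) = contract (fundVF G X) (η.eval b X (k + 2))
  closed_zero : ∀ X : LieAlg r, contract (fundVF G X) (η.eval b X 1) = 0

/-- The constant coefficient differential operator `D_{βᵃ} = ∂_{β₁}^{a₁} ⋯ ∂_{β_r}^{a_r}` on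
functions on `𝔤*`, where `∂_{βᵢ}` is the derivative in the direction `βᵢ ∈ 𝔤*`. -/
def monomialDeriv (b : Module.Basis (Fin r) ℝ (LieAlg r)) (a : Fin r →₀ ℕ)
    (φ : LieDual r → ℝ) : LieDual r → ℝ :=
  (List.finRange r).foldr
    (fun i ψ => (fun (χ : LieDual r → ℝ) ξ =>
      fderiv ℝ χ ξ (LinearMap.toContinuousLinearMap (b.coord i)))^[a i] ψ) φ

/-- `D_{η,Φ}(φ) = ∑ₐ ((D_{βᵃ} φ) ∘ Φ) ηₐ`. -/
def twistedPairing (b : Module.Basis (Fin r) ℝ (LieAlg r)) (η : EquivForm I M r)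
    (Φ : M → LieDual r) (φ : LieDual r → ℝ) : MixedForm I M :=
  η.sum fun a α => fun k x => monomialDeriv b a φ (Φ x) • α k x

end Equivariant

/-! ### Duistermaat–Heckman distributions -/

section DH

variable {r : ℕ} {m : ℕ} {H : Type*} [TopologicalSpace H]
  {I : ModelWithCorners ℝ (EuclideanSpace ℝ (Fin m)) H}
  {M : Type*} [TopologicalSpace M] [ChartedSpace H M] [IsManifold I ∞ M]
  [T2Space M] [SecondCountableTopology M]

/-- The Duistermaat–Heckman distribution of a `2n`-dimensional proper Hamiltonian manifold
(`m = 2n`, so `n = m / 2`): `φ ↦ ∫_M (φ ∘ Φ) ωⁿ / n!`. -/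
def DH (o : DForm I M m) (ωM : DForm I M 2) (Φ : M → LieDual r) :
    𝓓((⊤ : Opens (LieDual r)), ℝ) → ℝ := fun φ =>
  integral o fun x => (φ (Φ x) * (((m / 2).factorial : ℝ)⁻¹)) • powForm ωM (m / 2) m x

/-- The twisted Duistermaat–Heckman distribution `φ ↦ ∫_M e^ω ∧ D_{η,Φ}(φ)`; the integral of a
mixed form is the integral of its component of top degree. -/
def twistedDH (b : Module.Basis (Fin r) ℝ (LieAlg r)) (o : DForm I M m) (ωM : DForm I M 2)
    (Φ : M → LieDual r) (η : EquivForm I M r) : 𝓓((⊤ : Opens (LieDual r)), ℝ) → ℝ := fun φ =>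
  integral o (mixedWedge (expForm ωM) (twistedPairing b η Φ φ) m)

end DH

/-! ### Proper Hamiltonian cobordisms -/

section Cobordism

variable {r m : ℕ}
  {W : Type*} [TopologicalSpace W] [ChartedSpace (EuclideanHalfSpace (m + 1)) W]
  {M₀ : Type*} [TopologicalSpace M₀] [ChartedSpace (EuclideanSpace ℝ (Fin m)) M₀]
  {M₁ : Type*} [TopologicalSpace M₁] [ChartedSpace (EuclideanSpace ℝ (Fin m)) M₁]

/-- `(W, ω, Φ)`, oriented by `o`, together with the diffeomorphism `i = i₀ ⊔ i₁` from
`-M₀ ⊔ M₁` onto `∂W`, is a proper Hamiltonian cobordism between `(M₀, ω₀, Φ₀)` and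
`(M₁, ω₁, Φ₁)`. The diffeomorphism is encoded by smooth embeddings `i₀`, `i₁` whose images are
disjoint and cover the boundary; it preserves orientations, where `-M₀` is oriented by `-o₀`.
(Equivariance of `i` is not required, which only makes the class of cobordisms larger.) -/
structure IsProperHamiltonianCobordism (G : Type*) [TopologicalSpace G]
    [ChartedSpace (EuclideanSpace ℝ (Fin r)) G] [Group G] [MulAction G W]
    (o₀ : DForm (𝓡 m) M₀ m) (ω₀ : DForm (𝓡 m) M₀ 2) (Φ₀ : M₀ → LieDual r)
    (o₁ : DForm (𝓡 m) M₁ m) (ω₁ : DForm (𝓡 m) M₁ 2) (Φ₁ : M₁ → LieDual r)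
    (o : DForm (𝓡∂ (m + 1)) W (m + 1)) (ωW : DForm (𝓡∂ (m + 1)) W 2) (Φ : W → LieDual r)
    (i₀ : M₀ → W) (i₁ : M₁ → W) : Prop where
  hamiltonian : IsHamiltonian G o ωW Φ
  proper : IsProperMap Φ
  embedding₀ : Manifold.IsSmoothEmbedding (𝓡 m) (𝓡∂ (m + 1)) ∞ i₀
  embedding₁ : Manifold.IsSmoothEmbedding (𝓡 m) (𝓡∂ (m + 1)) ∞ i₁
  disjoint : Disjoint (Set.range i₀) (Set.range i₁)
  range_eq : Set.range i₀ ∪ Set.range i₁ = (𝓡∂ (m + 1)).boundary W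
  orientation₀ : PreservesBoundaryOrientation (-o₀) o i₀
  orientation₁ : PreservesBoundaryOrientation o₁ o i₁
  form₀ : pullback i₀ ωW = ω₀
  form₁ : pullback i₁ ωW = ω₁
  moment₀ : Φ ∘ i₀ = Φ₀
  moment₁ : Φ ∘ i₁ = Φ₁

end Cobordism

end DHCob

end

open DHCob

/-! The twisted statement contains the other two. For the constant equivariant form `1` the twisted
integrand is the degree `m` part of `(φ ∘ Φ) e^ω`, which for even `m` is `(φ ∘ Φ) ωⁿ / n!`
(`DH_eq_twistedDH`). So everything concerns the `m`-form `μ`, the degree `m` part of `e^ω ∧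
D_{η,Φ}(φ)`, on the `(m + 1)`-dimensional manifold `W`. It is smooth, it pulls back to the
corresponding integrand on each boundary piece, it is supported in the preimage under `Φ` of the
support of `φ`, which is compact because `Φ` is proper, and it is closed. Stokes' theorem then makes
its boundary integral vanish, and the reversed orientation of `M₀` turns this into an equality.

Closedness (`extD_twisted_eq_zero`) is the heart. Put `c_a = (D_{βᵃ} φ) ∘ Φ` and let `Xᵢ` be the
chosen basis of `𝔤`. The moment map equation gives `d c_a = ∑ᵢ c_{a+eᵢ} ι(Xᵢ♯) ω`. The equation
`d(η(X)) = ι(X♯) η(X)` is polynomial in `X`; applying the linear functional `xᵃ ↦ c_a` pointwise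
gives `∑ₐ c_a dηₐ = ∑ₐᵢ c_{a+eᵢ} ι(Xᵢ♯) ηₐ`. Since `e^ω` is closed and even, the two combine to `dμ
= ∑ₐᵢ c_{a+eᵢ} ι(Xᵢ♯)(e^ω ∧ ηₐ)` in degree `m + 1`. These are contractions of forms of degree `m +
2` in dimension `m + 1`, hence zero.

Stokes' theorem is reduced by a partition of unity to the divergence theorem on a half space
(`setIntegral_divergence_halfSpace`, `bdryIntegral_boundary`). The change of variables
`integral_eq_setIntegral_image` identifies the resulting integrals over boundary hyperplanes with
integrals over the manifolds embedded as boundary pieces (`integral_pullback_eq_neg_bdryIntegral`).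
Such a piece has the dimension of the boundary, so it is open in it; the other piece is therefore
closed in `W`, which is also why `Φ₀` and `Φ₁` are proper. -/

noncomputable section

namespace DHCob

/-! ### Wedge products on a vector space: permutation formula, continuity, contraction. -/

section Wedge

variable {E : Type*} [NormedAddCommGroup E] [NormedSpace ℝ E]

/-- Each shuffle is a class of `k! l!` permutations, all with the same signed summand. Clearing this
factor replaces the sum over a quotient by a sum over all permutations; the identities below are
obtained by cancelling the factor again. -/
theorem factorial_mul_wedge_apply {k l n : ℕ} (h : k + l = n) (α : E [⋀^Fin k]→L[ℝ] ℝ)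
    (β : E [⋀^Fin l]→L[ℝ] ℝ) (v : Fin n → E) :
    ((k.factorial * l.factorial : ℕ) : ℝ) * wedge h α β v =
      ∑ σ : Equiv.Perm (Fin n), ((Equiv.Perm.sign σ : ℤ) : ℝ) *
        (α (fun i => v (σ (finCongr h (Fin.castAdd l i)))) *
          β (fun i => v (σ (finCongr h (Fin.natAdd k i))))) := by
  subst h
  have key := congrArg (fun T => LinearMap.mul' ℝ ℝ (T (v ∘ finSumFinEquiv)))
    (MultilinearMap.domCoprod_alternization_eq α.toAlternatingMap β.toAlternatingMap)
  simp only [MultilinearMap.alternatization_apply, AlternatingMap.smul_apply, map_sum,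
    Fintype.card_fin, map_nsmul] at key
  have hw : wedge rfl α β v = LinearMap.mul' ℝ ℝ
      ((α.toAlternatingMap.domCoprod β.toAlternatingMap) (v ∘ finSumFinEquiv)) := by
    rfl
  rw [hw, ← nsmul_eq_mul, ← key]
  refine Fintype.sum_equiv (finSumFinEquiv.permCongr) _ _ fun σ => ?_
  simp only [MultilinearMap.domDomCongr_apply, MultilinearMap.domCoprod_apply,
    Equiv.Perm.sign_permCongr, Units.smul_def, map_zsmul]
  rw [zsmul_eq_mul, LinearMap.mul'_apply]
  simp [Equiv.permCongr_apply]

/-- Each of the `n!` permutations contributes at most `‖α‖ ‖β‖ ∏ ‖v i‖`, and dividing by `k! l! ≥ 1`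
only helps. The crude bound serves to make the wedge a continuous bilinear map, which can then be
differentiated. -/
theorem norm_wedge_le {k l n : ℕ} (h : k + l = n) (α : E [⋀^Fin k]→L[ℝ] ℝ)
    (β : E [⋀^Fin l]→L[ℝ] ℝ) : ‖wedge h α β‖ ≤ n.factorial * ‖α‖ * ‖β‖ := by
  refine ContinuousAlternatingMap.opNorm_le_bound _ (by positivity) fun v => ?_
  have h1 : (1 : ℝ) ≤ ((k.factorial * l.factorial : ℕ) : ℝ) := by
    exact_mod_cast Nat.mul_pos k.factorial_pos l.factorial_pos
  calc ‖wedge h α β v‖ ≤ ‖((k.factorial * l.factorial : ℕ) : ℝ) * wedge h α β v‖ := by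
        rw [norm_mul]
        exact le_mul_of_one_le_left (norm_nonneg _) (h1.trans (le_abs_self _))
    _ ≤ ∑ σ : Equiv.Perm (Fin n), ‖α‖ * ‖β‖ * ∏ i, ‖v i‖ := by
        rw [factorial_mul_wedge_apply]
        refine norm_sum_le_of_le _ fun σ _ => ?_
        have hs : ‖((Equiv.Perm.sign σ : ℤ) : ℝ)‖ = 1 := by
          rcases Int.units_eq_one_or (Equiv.Perm.sign σ) with h | h <;> simp [h]
        rw [norm_mul, hs, one_mul, norm_mul]
        have hp : ∏ i, ‖v i‖ = (∏ i, ‖v (σ (finCongr h (Fin.castAdd l i)))‖) *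
            ∏ i, ‖v (σ (finCongr h (Fin.natAdd k i)))‖ := by
          rw [← Equiv.prod_comp σ, ← Equiv.prod_comp (finCongr h), Fin.prod_univ_add]
        rw [hp, mul_mul_mul_comm]
        exact mul_le_mul (α.le_opNorm _) (β.le_opNorm _) (norm_nonneg _) (by positivity)
    _ = n.factorial * ‖α‖ * ‖β‖ * ∏ i, ‖v i‖ := by
        rw [Finset.sum_const, Finset.card_univ, Fintype.card_perm, Fintype.card_fin,
          nsmul_eq_mul]
        ring

/-- The wedge product as a continuous bilinear map. -/
def wedgeL {k l n : ℕ} (h : k + l = n) :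
    (E [⋀^Fin k]→L[ℝ] ℝ) →L[ℝ] (E [⋀^Fin l]→L[ℝ] ℝ) →L[ℝ] (E [⋀^Fin n]→L[ℝ] ℝ) :=
  LinearMap.mkContinuous₂ (LinearMap.mk₂ ℝ (fun α β => wedge h α β)
    (fun α α' β => by
      ext v
      have h0 : ((k.factorial * l.factorial : ℕ) : ℝ) ≠ 0 := by positivity
      apply mul_left_cancel₀ h0
      simp only [ContinuousAlternatingMap.add_apply, mul_add, factorial_mul_wedge_apply, add_mul,
        Finset.sum_add_distrib])
    (fun c α β => by
      ext v
      have h0 : ((k.factorial * l.factorial : ℕ) : ℝ) ≠ 0 := by positivity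
      apply mul_left_cancel₀ h0
      simp only [ContinuousAlternatingMap.smul_apply, smul_eq_mul, mul_left_comm _ c,
        factorial_mul_wedge_apply, Finset.mul_sum]
      refine Finset.sum_congr rfl fun σ _ => by ring)
    (fun α β β' => by
      ext v
      have h0 : ((k.factorial * l.factorial : ℕ) : ℝ) ≠ 0 := by positivity
      apply mul_left_cancel₀ h0
      simp only [ContinuousAlternatingMap.add_apply, mul_add, factorial_mul_wedge_apply,
        Finset.sum_add_distrib])
    (fun c α β => by
      ext v
      have h0 : ((k.factorial * l.factorial : ℕ) : ℝ) ≠ 0 := by positivity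
      apply mul_left_cancel₀ h0
      simp only [ContinuousAlternatingMap.smul_apply, smul_eq_mul, mul_left_comm _ c,
        factorial_mul_wedge_apply, Finset.mul_sum]))
    n.factorial (fun α β => norm_wedge_le h α β)

@[simp]
theorem wedgeL_apply {k l n : ℕ} (h : k + l = n) (α : E [⋀^Fin k]→L[ℝ] ℝ)
    (β : E [⋀^Fin l]→L[ℝ] ℝ) : wedgeL h α β = wedge h α β := rfl

/-- A permutation is determined by the image `p` of `0` and a permutation of the rest: the factor
from `decomposeFin` fixes `0`, and `p.cycleRange.symm` moves `0` to `p` keeping the order of the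
other points. -/
theorem sum_perm_fin_succ {n : ℕ} (F : Equiv.Perm (Fin (n + 1)) → ℝ) :
    ∑ σ, F σ = ∑ p : Fin (n + 1), ∑ τ : Equiv.Perm (Fin n),
      F (p.cycleRange.symm * Equiv.Perm.decomposeFin.symm (0, τ)) := by
  rw [← Fintype.sum_prod_type']
  symm
  refine Function.Bijective.sum_comp (g := F) (e := fun x : Fin (n + 1) × Equiv.Perm (Fin n) =>
    x.1.cycleRange.symm * Equiv.Perm.decomposeFin.symm (0, x.2)) ?_
  rw [Fintype.bijective_iff_injective_and_card]
  constructor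
  · rintro ⟨p, τ⟩ ⟨q, ρ⟩ h
    have hp : p = q := by
      have := Equiv.congr_fun h 0
      simpa using this
    subst hp
    have := mul_left_cancel h
    simpa using this
  · simp [Fintype.card_perm, Nat.factorial_succ]

/-- The recursion that determines the wedge product on the left. -/
theorem succ_smul_wedge {k l n : ℕ} (h : k + l = n) (h' : k + 1 + l = n + 1)
    (α : E [⋀^Fin (k + 1)]→L[ℝ] ℝ) (β : E [⋀^Fin l]→L[ℝ] ℝ) :
    ((k + 1 : ℕ) : ℝ) • wedge h' α β =
      ContinuousAlternatingMap.alternatizeUncurryFin ((wedgeL h).flip β ∘L α.curryLeft) := by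
  ext v
  have h0 : ((k.factorial * l.factorial : ℕ) : ℝ) ≠ 0 := by positivity
  apply mul_left_cancel₀ h0
  have h1 : ((k.factorial * l.factorial : ℕ) : ℝ) * (((k + 1 : ℕ) : ℝ) • wedge h' α β) v =
      (((k + 1).factorial * l.factorial : ℕ) : ℝ) * wedge h' α β v := by
    simp only [ContinuousAlternatingMap.smul_apply, smul_eq_mul, Nat.factorial_succ]
    push_cast
    ring
  -- Permutations with `σ 0 = p` put `v p` into the first slot of `α`. They form the `p`-th term of
  -- the alternatization, the cycle contributing the sign `(-1) ^ p`.
  rw [h1, factorial_mul_wedge_apply, sum_perm_fin_succ,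
    ContinuousAlternatingMap.alternatizeUncurryFin_apply, Finset.mul_sum]
  refine Finset.sum_congr rfl fun p _ => ?_
  rw [mul_smul_comm]
  change _ = _ • (_ * wedge h (α.curryLeft (v p)) β (p.removeNth v))
  rw [factorial_mul_wedge_apply, Finset.smul_sum]
  refine Finset.sum_congr rfl fun τ _ => ?_
  have e1 : (fun i => v ((p.cycleRange.symm * Equiv.Perm.decomposeFin.symm (0, τ))
      (finCongr h' (Fin.castAdd l i)))) = Matrix.vecCons (v p)
        (fun i => p.removeNth v (τ (finCongr h (Fin.castAdd l i)))) := by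
    funext i
    refine Fin.cases ?_ (fun i => ?_) i
    · have : finCongr h' (Fin.castAdd l 0) = 0 := by ext; simp
      rw [this]
      simp
    · have : finCongr h' (Fin.castAdd l i.succ) = (finCongr h (Fin.castAdd l i)).succ := by
        ext; simp
      rw [this]
      simp [Fin.removeNth]
  have e2 : (fun i => v ((p.cycleRange.symm * Equiv.Perm.decomposeFin.symm (0, τ))
      (finCongr h' (Fin.natAdd (k + 1) i)))) =
        (fun i => p.removeNth v (τ (finCongr h (Fin.natAdd k i)))) := by
    funext i
    have : finCongr h' (Fin.natAdd (k + 1) i) = (finCongr h (Fin.natAdd k i)).succ := by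
      ext; simp; omega
    rw [this]
    simp [Fin.removeNth]
  rw [e1, e2]
  have e3 : ((Equiv.Perm.sign (p.cycleRange.symm * Equiv.Perm.decomposeFin.symm (0, τ)) : ℤ) : ℝ) =
      (-1) ^ (p : ℕ) * ((Equiv.Perm.sign τ : ℤ) : ℝ) := by
    simp [Equiv.Perm.sign_mul, Fin.sign_cycleRange, Equiv.Perm.decomposeFin.symm_sign]
  rw [e3, zsmul_eq_mul]
  push_cast
  rw [mul_assoc]
  rfl

theorem wedge_zero_left {l n : ℕ} (h : 0 + l = n) (h' : l = n) (α : E [⋀^Fin 0]→L[ℝ] ℝ)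
    (β : E [⋀^Fin l]→L[ℝ] ℝ) (v : Fin n → E) :
    wedge h α β v = α 0 * β (fun i => v (Fin.cast h' i)) := by
  subst h'
  have h0 : ((Nat.factorial 0 * l.factorial : ℕ) : ℝ) ≠ 0 := by positivity
  apply mul_left_cancel₀ h0
  rw [factorial_mul_wedge_apply]
  have key : ∀ σ : Equiv.Perm (Fin l), ((Equiv.Perm.sign σ : ℤ) : ℝ) *
        (α (fun i => v (σ (finCongr h (Fin.castAdd l i)))) *
          β (fun i => v (σ (finCongr h (Fin.natAdd 0 i))))) = α 0 * β v := by
    intro σ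
    have e1 : (fun i => v (σ (finCongr h (Fin.castAdd l i)))) = 0 := Subsingleton.elim _ _
    have e2 : (fun i => v (σ (finCongr h (Fin.natAdd 0 i)))) = v ∘ σ := by
      funext i
      have : finCongr h (Fin.natAdd 0 i) = i := by ext; simp
      rw [this]; rfl
    have e3 : β (v ∘ σ) = Equiv.Perm.sign σ • β v := β.toAlternatingMap.map_perm v σ
    rw [e1, e2, e3]
    rcases Int.units_eq_one_or (Equiv.Perm.sign σ) with h | h <;> simp [h]
  simp only [key, Finset.sum_const, Finset.card_univ, Fintype.card_perm, Fintype.card_fin]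
  simp

/-- In the alternating sum over the entries of `(w, v)`, singling out the entry `w` gives `A w`;
singling out an entry of `v` gives a term of the alternatization in `v` with its index raised by
one, hence the minus sign. -/
theorem curryLeft_alternatizeUncurryFin {n : ℕ} (A : E →L[ℝ] E [⋀^Fin (n + 1)]→L[ℝ] ℝ) (w : E) :
    (ContinuousAlternatingMap.alternatizeUncurryFin A).curryLeft w = A w -
      ContinuousAlternatingMap.alternatizeUncurryFin
        ((ContinuousAlternatingMap.curryLeftLI.toContinuousLinearMap.flip w) ∘L A) := by
  ext v
  simp only [ContinuousAlternatingMap.curryLeft_apply_apply,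
    ContinuousAlternatingMap.alternatizeUncurryFin_apply, ContinuousAlternatingMap.sub_apply]
  rw [Fin.sum_univ_succ, sub_eq_add_neg, ← Finset.sum_neg_distrib]
  congr 1
  · simp
  · refine Finset.sum_congr rfl fun i _ => ?_
    have : Fin.removeNth i.succ (Matrix.vecCons w v) = Matrix.vecCons w (i.removeNth v) := by
      
      funext j
      refine Fin.cases ?_ (fun j => ?_) j
      · simp [Fin.removeNth]
      · simp [Fin.removeNth]
    rw [this]
    simp [pow_succ]

/-- Polarization of the vanishing of a double contraction, at `v + w`. -/
theorem curryLeft_curryLeft_comm {n : ℕ} (α : E [⋀^Fin (n + 2)]→L[ℝ] ℝ) (v w : E) :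
    (α.curryLeft v).curryLeft w = -(α.curryLeft w).curryLeft v := by
  have h := ContinuousAlternatingMap.curryLeft_same α (v + w)
  simp only [map_add, ContinuousAlternatingMap.curryLeft_add, add_apply,
    ContinuousAlternatingMap.curryLeft_same, zero_add, add_zero] at h
  rw [eq_neg_iff_add_eq_zero, add_comm]
  exact h

theorem wedge_zero_right {k n : ℕ} (h : k + 0 = n) (h' : k = n) (α : E [⋀^Fin k]→L[ℝ] ℝ)
    (β : E [⋀^Fin 0]→L[ℝ] ℝ) (v : Fin n → E) :
    wedge h α β v = α (fun i => v (Fin.cast h' i)) * β 0 := by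
  subst h'
  have h0 : ((k.factorial * Nat.factorial 0 : ℕ) : ℝ) ≠ 0 := by positivity
  apply mul_left_cancel₀ h0
  rw [factorial_mul_wedge_apply]
  have key : ∀ σ : Equiv.Perm (Fin k), ((Equiv.Perm.sign σ : ℤ) : ℝ) *
        (α (fun i => v (σ (finCongr h (Fin.castAdd 0 i)))) *
          β (fun i => v (σ (finCongr h (Fin.natAdd k i))))) = α v * β 0 := by
    intro σ
    have e1 : (fun i => v (σ (finCongr h (Fin.natAdd k i)))) = 0 := Subsingleton.elim _ _
    have e2 : (fun i => v (σ (finCongr h (Fin.castAdd 0 i)))) = v ∘ σ := rfl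
    have e3 : α (v ∘ σ) = Equiv.Perm.sign σ • α v := α.toAlternatingMap.map_perm v σ
    rw [e1, e2, e3]
    rcases Int.units_eq_one_or (Equiv.Perm.sign σ) with h | h <;> simp [h]
  simp only [key, Finset.sum_const, Finset.card_univ, Fintype.card_perm, Fintype.card_fin]
  simp

theorem curryLeft_wedge_zero_left {l n : ℕ} (h : 0 + (l + 1) = n + 1) (h' : 0 + l = n)
    (α : E [⋀^Fin 0]→L[ℝ] ℝ) (β : E [⋀^Fin (l + 1)]→L[ℝ] ℝ) (w : E) :
    (wedge h α β).curryLeft w = wedge h' α (β.curryLeft w) := by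
  obtain rfl : l = n := by omega
  ext v
  rw [wedge_zero_left h' rfl, ContinuousAlternatingMap.curryLeft_apply_apply,
    wedge_zero_left h rfl]
  rfl

theorem curryLeft_wedge_zero_right {k n : ℕ} (h : (k + 1) + 0 = n + 1) (h' : k + 0 = n)
    (α : E [⋀^Fin (k + 1)]→L[ℝ] ℝ) (β : E [⋀^Fin 0]→L[ℝ] ℝ) (w : E) :
    (wedge h α β).curryLeft w = wedge h' (α.curryLeft w) β := by
  obtain rfl : k = n := by omega
  ext v
  rw [wedge_zero_right h' rfl, ContinuousAlternatingMap.curryLeft_apply_apply,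
    wedge_zero_right h rfl]
  rfl

/-- Induction on the degree of `α` through `succ_smul_wedge`, which expresses `α ∧ β` by the
products `ι(v)α ∧ β` with a factor of lower degree. -/
theorem curryLeft_wedge {k l n : ℕ} (h : (k + 1) + (l + 1) = n + 1) (h₁ : k + (l + 1) = n)
    (h₂ : (k + 1) + l = n) (α : E [⋀^Fin (k + 1)]→L[ℝ] ℝ) (β : E [⋀^Fin (l + 1)]→L[ℝ] ℝ) (w : E) :
    (wedge h α β).curryLeft w =
      wedge h₁ (α.curryLeft w) β + (-1 : ℝ) ^ (k + 1) • wedge h₂ α (β.curryLeft w) := by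
  induction k generalizing n with
  | zero =>
    obtain ⟨n, rfl⟩ : ∃ n', n = n' + 1 := ⟨l, by omega⟩
    have e := succ_smul_wedge h₁ h α β
    have e' := succ_smul_wedge (by omega : 0 + l = n) h₂ α (β.curryLeft w)
    simp only [zero_add, Nat.cast_one, one_smul] at e e'
    rw [e, curryLeft_alternatizeUncurryFin, e', sub_eq_add_neg]
    congr 1
    have e3 : ∀ X : E [⋀^Fin (n + 1)]→L[ℝ] ℝ, (-1 : ℝ) • X = -X := fun X => by ext; simp
    have e2 : ((ContinuousAlternatingMap.curryLeftLI.toContinuousLinearMap.flip w) ∘L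
        ((wedgeL h₁).flip β ∘L α.curryLeft)) =
        ((wedgeL (by omega : 0 + l = n)).flip (β.curryLeft w) ∘L α.curryLeft) := by
      ext v : 1
      exact curryLeft_wedge_zero_left h₁ (by omega) (α.curryLeft v) β w
    rw [zero_add, pow_one, e3, e2]
  | succ k ih =>
    obtain ⟨n, rfl⟩ : ∃ n', n = n' + 1 := ⟨k + l + 1, by omega⟩
    have h0 : ((k + 1 + 1 : ℕ) : ℝ) ≠ 0 := by positivity
    apply smul_right_injective _ h0
    change _ • (wedge h α β).curryLeft w = _ • (_ + _)
    rw [← smul_apply, ← ContinuousAlternatingMap.curryLeft_smul,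
      succ_smul_wedge h₁ h α β, curryLeft_alternatizeUncurryFin, smul_add, smul_comm _ ((-1 : ℝ) ^ _),
      succ_smul_wedge (by omega) h₂ α (β.curryLeft w)]
    have e := succ_smul_wedge (by omega) h₁ (α.curryLeft w) β
    -- The inductive hypothesis applies to `ι(v)α`, and the two contractions anticommute. Hence
    -- `ι(w)α ∧ β` occurs `1 + (k + 1)` times in total, which is the factor cancelled by `h0`.
    have e2 : ((ContinuousAlternatingMap.curryLeftLI.toContinuousLinearMap.flip w) ∘L
        ((wedgeL h₁).flip β ∘L α.curryLeft)) =
        -((wedgeL (by omega)).flip β ∘L (α.curryLeft w).curryLeft) + (-1 : ℝ) ^ (k + 1) •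
        ((wedgeL (by omega : k + 1 + l = n)).flip (β.curryLeft w) ∘L α.curryLeft) := by
      ext v : 1
      have := ih h₁ (by omega) (by omega) (α.curryLeft v)
      refine this.trans ?_
      rw [curryLeft_curryLeft_comm]
      simp only [add_apply, neg_apply,
        ContinuousLinearMap.comp_apply, ContinuousLinearMap.flip_apply,
        smul_apply, ← wedgeL_apply, map_neg]
    rw [e2, ContinuousAlternatingMap.alternatizeUncurryFin_add, 
      ← neg_one_smul ℝ (_ ∘L (α.curryLeft w).curryLeft),
      ContinuousAlternatingMap.alternatizeUncurryFin_smul,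
      ContinuousAlternatingMap.alternatizeUncurryFin_smul, ← e]
    simp only [ContinuousLinearMap.comp_apply, ContinuousLinearMap.flip_apply, wedgeL_apply]
    rw [pow_succ (-1 : ℝ) (k + 1), mul_neg_one, neg_smul]
    push_cast
    module

end Wedge

end DHCob
end

noncomputable section

namespace DHCob

/-! ### The graded algebra of mixed forms and its contractions. -/

section MixedAlgebra

variable {E : Type*} [NormedAddCommGroup E] [NormedSpace ℝ E]

/-- Mixed alternating forms on a vector space. -/
abbrev MAlt (E : Type*) [NormedAddCommGroup E] [NormedSpace ℝ E] : Type _ :=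
  ∀ k : ℕ, E [⋀^Fin k]→L[ℝ] ℝ

/-- The wedge product of mixed alternating forms. -/
def mw (α β : MAlt E) : MAlt E := fun k =>
  ∑ i : Fin (k + 1), wedge (Nat.add_sub_cancel' (Nat.le_of_lt_succ i.2)) (α i) (β (k - i))

/-- Contraction of mixed forms with a vector. -/
def iota (w : E) (α : MAlt E) : MAlt E := fun k => (α (k + 1)).curryLeft w

/-- The grading involution of mixed forms. -/
def eps (α : MAlt E) : MAlt E := fun k => (-1 : ℝ) ^ k • α k

theorem wedge_congr (α β : MAlt E) {k l k' l' n : ℕ} (h : k + l = n) (h' : k' + l' = n)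
    (hk : k = k') (hl : l = l') : wedge h (α k) (β l) = wedge h' (α k') (β l') := by
  subst hk hl; rfl

theorem mw_zero_apply (α β : MAlt E) (v : Fin 0 → E) : mw α β 0 v = α 0 0 * β 0 0 := by
  have : mw α β 0 = wedge (Nat.add_sub_cancel' (Nat.zero_le 0)) (α 0) (β 0) := by
    simp [mw]
  rw [this, wedge_zero_left _ rfl]
  congr 2
  funext i
  exact i.elim0

theorem neg_one_smul_mixed (α : MAlt E) : (-1 : ℝ) • α = -α := by
  funext k; ext; simp

theorem mw_neg_left (α β : MAlt E) : mw (-α) β = -mw α β := by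
  have h : mw ((-1 : ℝ) • α) β = (-1 : ℝ) • mw α β := by
    funext k
    simp only [mw, Pi.smul_apply, ← wedgeL_apply, map_smul, smul_apply, Finset.smul_sum]
  rwa [neg_one_smul_mixed, neg_one_smul_mixed] at h

theorem mw_neg_right (α β : MAlt E) : mw α (-β) = -mw α β := by
  have h : mw α ((-1 : ℝ) • β) = (-1 : ℝ) • mw α β := by
    funext k
    simp only [mw, Pi.smul_apply, ← wedgeL_apply, map_smul, Finset.smul_sum]
  rwa [neg_one_smul_mixed, neg_one_smul_mixed] at h

theorem mw_add_left (α α' β : MAlt E) : mw (α + α') β = mw α β + mw α' β := by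
  funext k
  simp only [mw, Pi.add_apply, ← wedgeL_apply, map_add, add_apply, Finset.sum_add_distrib]

theorem mw_add_right (α β β' : MAlt E) : mw α (β + β') = mw α β + mw α β' := by
  funext k
  simp only [mw, Pi.add_apply, ← wedgeL_apply, map_add, Finset.sum_add_distrib]

theorem mw_smul_left (c : ℝ) (α β : MAlt E) : mw (c • α) β = c • mw α β := by
  funext k
  simp only [mw, Pi.smul_apply, ← wedgeL_apply, map_smul, smul_apply, Finset.smul_sum]

theorem mw_smul_right (c : ℝ) (α β : MAlt E) : mw α (c • β) = c • mw α β := by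
  funext k
  simp only [mw, Pi.smul_apply, ← wedgeL_apply, map_smul, Finset.smul_sum]

theorem mw_zero_right (α : MAlt E) : mw α 0 = 0 := by
  simpa using mw_smul_right 0 α 0

theorem mw_zero_left (α : MAlt E) : mw 0 α = 0 := by
  simpa using mw_smul_left 0 0 α

theorem mw_sum_right {ι : Type*} (s : Finset ι) (α : MAlt E) (β : ι → MAlt E) :
    mw α (∑ i ∈ s, β i) = ∑ i ∈ s, mw α (β i) := by
  classical
  induction s using Finset.induction_on with
  | empty => simp [mw_zero_right]
  | insert a s ha ih => rw [Finset.sum_insert ha, Finset.sum_insert ha, mw_add_right, ih]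

theorem mw_sum_left {ι : Type*} (s : Finset ι) (α : ι → MAlt E) (β : MAlt E) :
    mw (∑ i ∈ s, α i) β = ∑ i ∈ s, mw (α i) β := by
  classical
  induction s using Finset.induction_on with
  | empty => simp [mw_zero_left]
  | insert a s ha ih => rw [Finset.sum_insert ha, Finset.sum_insert ha, mw_add_left, ih]

theorem iota_add (w : E) (α β : MAlt E) : iota w (α + β) = iota w α + iota w β := rfl

theorem iota_smul (w : E) (c : ℝ) (α : MAlt E) : iota w (c • α) = c • iota w α := rfl

theorem iota_sum {ι : Type*} (s : Finset ι) (w : E) (α : ι → MAlt E) :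
    iota w (∑ i ∈ s, α i) = ∑ i ∈ s, iota w (α i) := by
  classical
  induction s using Finset.induction_on with
  | empty => rfl
  | insert a s ha ih => rw [Finset.sum_insert ha, Finset.sum_insert ha, iota_add, ih]

theorem eps_eps (α : MAlt E) : eps (eps α) = α := by
  funext k
  simp [eps, smul_smul, ← mul_pow]

theorem iota_eps (w : E) (α : MAlt E) : iota w (eps α) = -eps (iota w α) := by
  funext k
  simp [iota, eps, pow_succ]

/-- Mixed forms agreeing in degree `0` and having the same contractions agree. -/
theorem apply_succ_eq_of_iota {α β : MAlt E} {k : ℕ} (h : ∀ w, iota w α k = iota w β k) :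
    α (k + 1) = β (k + 1) := by
  ext v
  have := congrArg (fun f => f (Fin.tail v)) (h (v 0))
  simpa [iota, Matrix.vecCons] using this

theorem iota_mw (w : E) (α β : MAlt E) :
    iota w (mw α β) = mw (iota w α) β + mw (eps α) (iota w β) := by
  funext k
  -- When one factor has degree `0` the corresponding Leibniz term is absent and its index would be
  -- a truncated subtraction. `L` and `R` are set to `0` there, so the zero summands at the two ends
  -- can be dropped before reindexing.
  let L : Fin (k + 2) → E [⋀^Fin k]→L[ℝ] ℝ := fun i =>
    if h : 1 ≤ (i : ℕ) then wedge (show (i - 1) + (k + 1 - i) = k by omega)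
      (iota w α (i - 1)) (β (k + 1 - i)) else 0
  let R : Fin (k + 2) → E [⋀^Fin k]→L[ℝ] ℝ := fun i =>
    if h : 1 ≤ k + 1 - (i : ℕ) then wedge (show (i : ℕ) + (k - i) = k by omega)
      (eps α i) (iota w β (k - i)) else 0
  have key : ∀ i : Fin (k + 2), (wedge (Nat.add_sub_cancel' (Nat.le_of_lt_succ i.2)) (α i)
      (β (k + 1 - i))).curryLeft w = L i + R i := by
    intro ⟨i, hi⟩
    have aux : ∀ (j : ℕ) (h : i + j = k + 1), (wedge h (α i) (β j)).curryLeft w =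
      (if h : 1 ≤ i then wedge (show (i - 1) + j = k by omega) (iota w α (i - 1)) (β j) else 0) +
      (if h : 1 ≤ j then wedge (show i + (j - 1) = k by omega)
        (eps α i) (iota w β (j - 1)) else 0) := by
      intro j h
      rcases i with _ | i <;> rcases j with _ | j
      · omega
      · rw [dif_neg (by omega), dif_pos (by omega), zero_add]
        rw [curryLeft_wedge_zero_left h (by omega : 0 + j = k)]
        simp [eps, iota]
      · rw [dif_pos (by omega), dif_neg (by omega), add_zero]
        exact curryLeft_wedge_zero_right h (by omega) _ _ _
      · simp only [Nat.le_add_left, dite_true]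
        rw [curryLeft_wedge h (by omega) (by omega)]
        congr 1
        simp only [eps, ← wedgeL_apply, map_smul, smul_apply]
        rfl
    have := aux (k + 1 - i) (by omega)
    rw [this]
    simp only [L, R]
    congr 1
    by_cases h1 : 1 ≤ k + 1 - i
    · rw [dif_pos h1, dif_pos h1]
      exact wedge_congr _ _ _ _ rfl (by omega)
    · rw [dif_neg h1, dif_neg h1]
  have h0 : iota w (mw α β) k = ∑ i : Fin (k + 2), (L i + R i) := by
    simp only [← key]
    change ContinuousAlternatingMap.curryLeftLI.toContinuousLinearMap.flip w (mw α β (k + 1)) = _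
    simp only [mw, map_sum]
    rfl
  rw [h0, Finset.sum_add_distrib, Fin.sum_univ_succ, Fin.sum_univ_castSucc R]
  have hL0 : L 0 = 0 := by simp [L]
  have hR : R (Fin.last (k + 1)) = 0 := by simp [R]
  rw [hL0, hR, zero_add, add_zero, Pi.add_apply]
  congr 1
  · refine Finset.sum_congr rfl fun i _ => ?_
    simp only [L, Fin.val_succ, Nat.le_add_left, dite_true]
    exact wedge_congr _ _ _ _ (by omega) (by omega)
  · refine Finset.sum_congr rfl fun i _ => ?_
    have : 1 ≤ k + 1 - ((i.castSucc : Fin (k + 2)) : ℕ) := by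
      have := i.2
      simp only [Fin.val_castSucc]
      omega
    simp only [R, dif_pos this, Fin.val_castSucc]

/-- Both sides have the same contractions by the antiderivation rule and the inductive hypothesis,
and degree `0` is associativity in `ℝ`. This induction, through `apply_succ_eq_of_iota`, also gives
commutativity, the unit law, naturality and the product rules for `altM`. -/
theorem mw_assoc (α β γ : MAlt E) : mw (mw α β) γ = mw α (mw β γ) := by
  have heps : ∀ k, ∀ α β : MAlt E, eps (mw α β) k = mw (eps α) (eps β) k := by
    intro k α β
    simp only [eps, mw, Finset.smul_sum]
    refine Finset.sum_congr rfl fun i _ => ?_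
    simp only [← wedgeL_apply, map_smul, smul_apply, smul_smul, ← pow_add]
    congr 2
    have := i.2
    omega
  have heps' : ∀ α β : MAlt E, eps (mw α β) = mw (eps α) (eps β) :=
    fun α β => funext fun k => heps k α β
  funext k
  induction k generalizing α β γ with
  | zero => ext v; simp [mw_zero_apply, mul_assoc]
  | succ k ih =>
    refine apply_succ_eq_of_iota fun w => ?_
    simp only [iota_mw, mw_add_left, mw_add_right, Pi.add_apply, heps', ih]
    abel

theorem eps_mw (α β : MAlt E) : eps (mw α β) = mw (eps α) (eps β) := by
  funext k
  simp only [eps, mw, Finset.smul_sum]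
  refine Finset.sum_congr rfl fun i _ => ?_
  simp only [← wedgeL_apply, map_smul, smul_apply, smul_smul, ← pow_add]
  congr 2
  have := i.2
  omega

/-- Contraction exchanges even and odd forms, so the two cases have to be proved together. -/
theorem mw_comm_aux (k : ℕ) : ∀ α β : MAlt E, (eps α = α → mw α β k = mw β α k) ∧
    (eps α = -α → mw α β k = mw (eps β) α k) := by
  induction k with
  | zero =>
    intro α β
    constructor
    · intro _; ext v; simp [mw_zero_apply, mul_comm]
    · intro _; ext v; simp [mw_zero_apply, mul_comm, eps]
  | succ k ih =>
    intro α β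
    constructor
    · intro h
      refine apply_succ_eq_of_iota fun w => ?_
      have h1 : eps (iota w α) = -iota w α := by rw [← neg_eq_iff_eq_neg, ← iota_eps, h]
      rw [iota_mw, iota_mw, h, Pi.add_apply, Pi.add_apply, (ih α _).1 h, (ih _ β).2 h1, add_comm]
    · intro h
      refine apply_succ_eq_of_iota fun w => ?_
      have h1 : eps (iota w α) = iota w α := by rw [← neg_inj, ← iota_eps, h]; rfl
      rw [iota_mw, iota_mw, h, Pi.add_apply, Pi.add_apply, eps_eps, (ih _ β).1 h1, iota_eps, mw_neg_left,
        mw_neg_left, add_comm, Pi.neg_apply, (ih α _).2 h, Pi.neg_apply]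

theorem mw_comm_of_even {α : MAlt E} (h : eps α = α) (β : MAlt E) : mw α β = mw β α :=
  funext fun k => (mw_comm_aux k α β).1 h

/-- The unit mixed form. -/
def mone : MAlt E
  | 0 => ContinuousAlternatingMap.constOfIsEmpty ℝ E (Fin 0) (1 : ℝ)
  | _ + 1 => 0

theorem iota_mone (w : E) : iota w (mone : MAlt E) = 0 := by
  funext k; rfl

theorem eps_mone : eps (mone : MAlt E) = mone := by
  funext k
  cases k <;> simp [eps, mone]

theorem mone_mw (α : MAlt E) : mw mone α = α := by
  funext k
  induction k generalizing α with
  | zero =>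
    ext v
    rw [mw_zero_apply]
    simp [mone, Subsingleton.elim v 0]
  | succ k ih =>
    refine apply_succ_eq_of_iota fun w => ?_
    rw [iota_mw, iota_mone, eps_mone, mw_zero_left, zero_add, ih]

theorem mw_mone (α : MAlt E) : mw α mone = α := by
  rw [← mw_comm_of_even eps_mone, mone_mw]

/-- Pullback of mixed forms by a linear map. -/
def mcomp {F : Type*} [NormedAddCommGroup F] [NormedSpace ℝ F] (α : MAlt F) (L : E →L[ℝ] F) :
    MAlt E := fun k => (α k).compContinuousLinearMap L

theorem iota_mcomp {F : Type*} [NormedAddCommGroup F] [NormedSpace ℝ F] (α : MAlt F)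
    (L : E →L[ℝ] F) (w : E) : iota w (mcomp α L) = mcomp (iota (L w) α) L := by
  funext k
  simp [iota, mcomp]

/-- Contracting a pullback with `w` is pulling back the contraction with `L w`, so the induction on
the degree closes up. -/
theorem mcomp_mw {F : Type*} [NormedAddCommGroup F] [NormedSpace ℝ F] (α β : MAlt F)
    (L : E →L[ℝ] F) : mcomp (mw α β) L = mw (mcomp α L) (mcomp β L) := by
  have he : ∀ α : MAlt F, mcomp (eps α) L = eps (mcomp α L) := by
    intro α; funext k; ext v; simp [mcomp, eps]
  funext k
  induction k generalizing α β with
  | zero =>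
    ext v
    rw [mw_zero_apply]
    simp only [mcomp, ContinuousAlternatingMap.compContinuousLinearMap_apply]
    rw [mw_zero_apply]
    congr 2 <;> exact Subsingleton.elim _ _
  | succ k ih =>
    refine apply_succ_eq_of_iota fun w => ?_
    have hadd : ∀ α β : MAlt F, mcomp (α + β) L = mcomp α L + mcomp β L := by
      intro α β; funext k; ext v; simp [mcomp]
    rw [iota_mcomp, iota_mw, iota_mw, iota_mcomp, iota_mcomp, hadd, Pi.add_apply, Pi.add_apply,
      ih, ih, he]

/-! Families of mixed forms depending linearly on a vector -/

/-- The alternatization of a linear family of mixed forms, raising the degree by one. -/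
def altM (A : ∀ k : ℕ, E →L[ℝ] E [⋀^Fin k]→L[ℝ] ℝ) : MAlt E
  | 0 => 0
  | k + 1 => ContinuousAlternatingMap.alternatizeUncurryFin (A k)

theorem altM_add (A B : ∀ k : ℕ, E →L[ℝ] E [⋀^Fin k]→L[ℝ] ℝ) :
    altM (A + B) = altM A + altM B := by
  funext k
  cases k with
  | zero => simp [altM]
  | succ k => exact ContinuousAlternatingMap.alternatizeUncurryFin_add _ _

/-- Contraction of a linear family. -/
def iotaF (w : E) (A : ∀ k : ℕ, E →L[ℝ] E [⋀^Fin k]→L[ℝ] ℝ) :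
    ∀ k : ℕ, E →L[ℝ] E [⋀^Fin k]→L[ℝ] ℝ := fun k =>
  (ContinuousAlternatingMap.curryLeftLI.toContinuousLinearMap.flip w) ∘L A (k + 1)

/-- Grading involution of a linear family. -/
def epsF (A : ∀ k : ℕ, E →L[ℝ] E [⋀^Fin k]→L[ℝ] ℝ) :
    ∀ k : ℕ, E →L[ℝ] E [⋀^Fin k]→L[ℝ] ℝ := fun k => (-1 : ℝ) ^ k • A k

/-- Wedge of a linear family with a mixed form. -/
def mwFL (A : ∀ k : ℕ, E →L[ℝ] E [⋀^Fin k]→L[ℝ] ℝ) (β : MAlt E) :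
    ∀ k : ℕ, E →L[ℝ] E [⋀^Fin k]→L[ℝ] ℝ := fun k =>
  ∑ i : Fin (k + 1), (wedgeL (Nat.add_sub_cancel' (Nat.le_of_lt_succ i.2))).flip (β (k - i)) ∘L A i

/-- Wedge of a mixed form with a linear family. -/
def mwFR (α : MAlt E) (B : ∀ k : ℕ, E →L[ℝ] E [⋀^Fin k]→L[ℝ] ℝ) :
    ∀ k : ℕ, E →L[ℝ] E [⋀^Fin k]→L[ℝ] ℝ := fun k =>
  ∑ i : Fin (k + 1), (wedgeL (Nat.add_sub_cancel' (Nat.le_of_lt_succ i.2))) (α i) ∘L B (k - i)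

theorem mwFL_apply (A : ∀ k : ℕ, E →L[ℝ] E [⋀^Fin k]→L[ℝ] ℝ) (β : MAlt E) (v : E) (k : ℕ) :
    mwFL A β k v = mw (fun j => A j v) β k := by
  simp [mwFL, mw, sum_apply]

theorem mwFR_apply (α : MAlt E) (B : ∀ k : ℕ, E →L[ℝ] E [⋀^Fin k]→L[ℝ] ℝ) (v : E) (k : ℕ) :
    mwFR α B k v = mw α (fun j => B j v) k := by
  simp [mwFR, mw, sum_apply]

theorem iota_altM (w : E) (A : ∀ k : ℕ, E →L[ℝ] E [⋀^Fin k]→L[ℝ] ℝ) :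
    iota w (altM A) = (fun k => A k w) - altM (iotaF w A) := by
  funext k
  cases k with
  | zero =>
    ext v
    simp [iota, altM, ContinuousAlternatingMap.alternatizeUncurryFin_apply]
  | succ k => exact curryLeft_alternatizeUncurryFin (A (k + 1)) w

theorem iotaF_mwFL (w : E) (A : ∀ k : ℕ, E →L[ℝ] E [⋀^Fin k]→L[ℝ] ℝ) (β : MAlt E) :
    iotaF w (mwFL A β) = mwFL (iotaF w A) β + mwFL (epsF A) (iota w β) := by
  funext k
  ext v : 1
  rw [Pi.add_apply, add_apply, mwFL_apply, mwFL_apply]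
  have := congrFun (iota_mw w (fun j => A j v) β) k
  refine Eq.trans ?_ this
  change (mwFL A β (k + 1) v).curryLeft w = _
  rw [mwFL_apply]
  rfl

theorem iotaF_mwFR (w : E) (α : MAlt E) (B : ∀ k : ℕ, E →L[ℝ] E [⋀^Fin k]→L[ℝ] ℝ) :
    iotaF w (mwFR α B) = mwFR (iota w α) B + mwFR (eps α) (iotaF w B) := by
  funext k
  ext v : 1
  rw [Pi.add_apply, add_apply, mwFR_apply, mwFR_apply]
  have := congrFun (iota_mw w α (fun j => B j v)) k
  refine Eq.trans ?_ this
  change (mwFR α B (k + 1) v).curryLeft w = _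
  rw [mwFR_apply]
  rfl

theorem altM_epsF (A : ∀ k : ℕ, E →L[ℝ] E [⋀^Fin k]→L[ℝ] ℝ) :
    altM (epsF A) = -eps (altM A) := by
  funext k
  cases k with
  | zero => simp [altM, eps]
  | succ k =>
    change ContinuousAlternatingMap.alternatizeUncurryFin ((-1 : ℝ) ^ k • A k) =
      -((-1 : ℝ) ^ (k + 1) • ContinuousAlternatingMap.alternatizeUncurryFin (A k))
    rw [ContinuousAlternatingMap.alternatizeUncurryFin_smul, pow_succ]
    simp

theorem mw_sub_left (α α' β : MAlt E) : mw (α - α') β = mw α β - mw α' β := by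
  rw [sub_eq_add_neg, mw_add_left, mw_neg_left, sub_eq_add_neg]

theorem mw_sub_right (α β β' : MAlt E) : mw α (β - β') = mw α β - mw α β' := by
  rw [sub_eq_add_neg, mw_add_right, mw_neg_right, sub_eq_add_neg]

/-- For `A` the derivative of a field of forms `α` this is the term `dα ∧ β` of the product rule. -/
theorem altM_mwFL (A : ∀ k : ℕ, E →L[ℝ] E [⋀^Fin k]→L[ℝ] ℝ) (β : MAlt E) :
    altM (mwFL A β) = mw (altM A) β := by
  funext k
  induction k generalizing A β with
  | zero => ext v; simp [mw_zero_apply, altM]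
  | succ k ih =>
    refine apply_succ_eq_of_iota fun w => ?_
    rw [iota_altM, iota_mw, iota_altM, iotaF_mwFL, altM_add, mw_sub_left]
    simp only [Pi.add_apply, Pi.sub_apply, ih, mwFL_apply, altM_epsF, mw_neg_left, Pi.neg_apply]
    abel

/-- The companion term of the product rule: the direction of differentiation has to move past `α`,
which produces the grading sign. -/
theorem altM_mwFR (α : MAlt E) (B : ∀ k : ℕ, E →L[ℝ] E [⋀^Fin k]→L[ℝ] ℝ) :
    altM (mwFR α B) = mw (eps α) (altM B) := by
  funext k
  induction k generalizing α B with
  | zero => ext v; simp [mw_zero_apply, altM]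
  | succ k ih =>
    refine apply_succ_eq_of_iota fun w => ?_
    rw [iota_altM, iota_mw, iota_altM, iotaF_mwFR, altM_add, mw_sub_right, iota_eps]
    simp only [Pi.add_apply, Pi.sub_apply, ih, mwFR_apply, mw_neg_left, Pi.neg_apply, eps_eps]
    abel

end MixedAlgebra

end DHCob
end

noncomputable section

namespace DHCob

/-! ### Exponentials of two-forms and exterior derivatives of fields of mixed forms. -/

section FieldCalculus

variable {E : Type*} [NormedAddCommGroup E] [NormedSpace ℝ E]

theorem mw_congr_left {α α' : MAlt E} (β : MAlt E) {k : ℕ} (h : ∀ j ≤ k, α j = α' j) :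
    mw α β k = mw α' β k := by
  simp only [mw]
  refine Finset.sum_congr rfl fun i _ => ?_
  rw [h i (Nat.le_of_lt_succ i.2)]

theorem mw_congr_right (α : MAlt E) {β β' : MAlt E} {k : ℕ} (h : ∀ j ≤ k, β j = β' j) :
    mw α β k = mw α β' k := by
  simp only [mw]
  refine Finset.sum_congr rfl fun i _ => ?_
  rw [h (k - i) (Nat.sub_le _ _)]

/-- The powers of a mixed form. -/
def mpow (Ω : MAlt E) : ℕ → MAlt E
  | 0 => mone
  | n + 1 => mw Ω (mpow Ω n)

/-- The truncated exponential of a mixed form. -/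
def mexp (Ω : MAlt E) (N : ℕ) : MAlt E :=
  ∑ j ∈ Finset.range N, ((j.factorial : ℝ)⁻¹) • mpow Ω j

theorem eps_mpow {Ω : MAlt E} (h : eps Ω = Ω) (n : ℕ) : eps (mpow Ω n) = mpow Ω n := by
  induction n with
  | zero => exact eps_mone
  | succ n ih => rw [mpow, eps_mw, h, ih]

theorem eps_add (α β : MAlt E) : eps (α + β) = eps α + eps β := by
  funext k; simp [eps]

theorem eps_smul (c : ℝ) (α : MAlt E) : eps (c • α) = c • eps α := by
  funext k; exact smul_comm ((-1 : ℝ) ^ k) c (α k)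

theorem eps_mexp {Ω : MAlt E} (h : eps Ω = Ω) (N : ℕ) : eps (mexp Ω N) = mexp Ω N := by
  induction N with
  | zero => funext k; simp [mexp, eps]
  | succ n ih =>
    have : mexp Ω (n + 1) = mexp Ω n + ((n.factorial : ℝ)⁻¹) • mpow Ω n :=
      Finset.sum_range_succ _ _
    rw [this, eps_add, eps_smul, ih, eps_mpow h]

/-- The powers of a form concentrated in degree two. -/
theorem mpow_eq_zero {Ω : MAlt E} (h : ∀ k, k ≠ 2 → Ω k = 0) (n k : ℕ) (hk : k ≠ 2 * n) :
    mpow Ω n k = 0 := by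
  induction n generalizing k with
  | zero =>
    obtain ⟨k, rfl⟩ := Nat.exists_eq_succ_of_ne_zero hk
    rfl
  | succ n ih =>
    change ∑ i : Fin (k + 1), _ = _
    refine Finset.sum_eq_zero fun i _ => ?_
    rw [← wedgeL_apply]
    by_cases hi : (i : ℕ) = 2
    · rw [ih (k - i) (by have := i.2; omega), map_zero]
    · rw [h _ hi, map_zero]
      rfl

theorem eps_of_two {Ω : MAlt E} (h : ∀ k, k ≠ 2 → Ω k = 0) : eps Ω = Ω := by
  funext k
  by_cases hk : k = 2
  · subst hk; simp [eps]
  · simp [eps, h k hk]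

/-- An even form commutes with everything, so contraction acts on its powers as a derivation acts on
`xⁿ⁺¹`. -/
theorem iota_mpow_succ {Ω : MAlt E} (h : eps Ω = Ω) (w : E) (n : ℕ) :
    iota w (mpow Ω (n + 1)) = ((n + 1 : ℕ) : ℝ) • mw (iota w Ω) (mpow Ω n) := by
  induction n with
  | zero => simp [mpow, mw_mone]
  | succ n ih =>
    rw [mpow, iota_mw, ih, h, mw_smul_right, ← mw_assoc, mw_comm_of_even h, mw_assoc]
    change mw (iota w Ω) (mpow Ω (n + 1)) + _ • mw (iota w Ω) (mpow Ω (n + 1)) = _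
    push_cast
    module

/-- Contraction kills the constant term and shifts the series, hence the loss of one term in the
truncation. -/
theorem iota_mexp {Ω : MAlt E} (h : eps Ω = Ω) (w : E) (N : ℕ) :
    iota w (mexp Ω (N + 1)) = mw (iota w Ω) (mexp Ω N) := by
  rw [mexp, Finset.sum_range_succ', iota_add, iota_sum, mexp, mw_sum_right]
  have : iota w (((Nat.factorial 0 : ℝ)⁻¹) • mpow Ω 0) = 0 := by
    rw [iota_smul, mpow, iota_mone, smul_zero]
  rw [this, add_zero]
  refine Finset.sum_congr rfl fun j _ => ?_
  rw [iota_smul, iota_mpow_succ h, mw_smul_right, smul_smul, Nat.factorial_succ]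
  congr 1
  push_cast
  have : ((j : ℝ) + 1) ≠ 0 := by positivity
  field_simp

/-- The `j`-th power lives in degree `2 * j`, so terms with `j > k` do not reach degree `k` and the
truncation is immaterial. -/
theorem mexp_apply_eq {Ω : MAlt E} (h : ∀ k, k ≠ 2 → Ω k = 0) {k N N' : ℕ} (hN : k < N)
    (hN' : k < N') : mexp Ω N k = mexp Ω N' k := by
  have aux : ∀ N, k < N → mexp Ω N k = mexp Ω (k + 1) k := by
    intro N hN
    simp only [mexp, Finset.sum_apply, Pi.smul_apply]
    symm
    refine Finset.sum_subset (fun j hj => ?_) fun j _ hj => ?_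
    · simp only [Finset.mem_range] at hj ⊢; omega
    · rw [mpow_eq_zero h j k (by simp only [Finset.mem_range] at hj; omega), smul_zero]
  rw [aux N hN, aux N' hN']

/-- The contraction of `e^Ω ∧ η`. -/
theorem iota_mexp_mw {Ω : MAlt E} (h : ∀ k, k ≠ 2 → Ω k = 0) (w : E) (η : MAlt E) {k N : ℕ}
    (hN : k + 1 < N) : mw (mexp Ω N) (mw (iota w Ω) η + iota w η) k =
      iota w (mw (mexp Ω N) η) k := by
  have he := eps_of_two h
  obtain ⟨N, rfl⟩ : ∃ N', N = N' + 1 := ⟨N - 1, by omega⟩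
  -- The truncations `N + 1` and `N` differ only above the degrees that matter, since `k < N`.
  have key : mw (mw (iota w Ω) (mexp Ω (N + 1))) η k = mw (mw (iota w Ω) (mexp Ω N)) η k := by
    refine mw_congr_left _ fun j hj => mw_congr_right _ fun i hi => ?_
    exact mexp_apply_eq h (by omega) (by omega)
  have h1 : mw (mexp Ω (N + 1)) (mw (iota w Ω) η) = mw (mw (iota w Ω) (mexp Ω (N + 1))) η := by
    rw [← mw_assoc, mw_comm_of_even (eps_mexp he _)]
  have h2 : iota w (mw (mexp Ω (N + 1)) η) =
      mw (mw (iota w Ω) (mexp Ω N)) η + mw (mexp Ω (N + 1)) (iota w η) := by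
    rw [iota_mw, eps_mexp he, iota_mexp he]
  rw [mw_add_right, h1, h2, Pi.add_apply, Pi.add_apply, key]

/-! ### The exterior derivative of fields of mixed forms -/

variable {s : Set E} {y : E}

/-- A field of mixed forms is differentiable if all its components are. -/
def DiffM (α : E → MAlt E) (s : Set E) (y : E) : Prop :=
  ∀ k, DifferentiableWithinAt ℝ (fun z => α z k) s y

/-- The derivative of a field of mixed forms. -/
def derivM (α : E → MAlt E) (s : Set E) (y : E) : ∀ k : ℕ, E →L[ℝ] E [⋀^Fin k]→L[ℝ] ℝ :=
  fun k => fderivWithin ℝ (fun z => α z k) s y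

/-- The exterior derivative of a field of mixed forms. -/
def dM (α : E → MAlt E) (s : Set E) (y : E) : MAlt E := altM (derivM α s y)

theorem hasFDerivWithinAt_mw {α β : E → MAlt E} (hα : DiffM α s y) (hβ : DiffM β s y) (k : ℕ) :
    HasFDerivWithinAt (fun z => mw (α z) (β z) k)
      ((mwFL (derivM α s y) (β y) + mwFR (α y) (derivM β s y)) k) s y := by
  have : HasFDerivWithinAt (fun z => ∑ i : Fin (k + 1),
      wedgeL (Nat.add_sub_cancel' (Nat.le_of_lt_succ i.2)) (α z i) (β z (k - i)))
      (∑ i : Fin (k + 1), ((wedgeL (Nat.add_sub_cancel' (Nat.le_of_lt_succ i.2))).precompR E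
        (α y i) (derivM β s y (k - i)) +
        (wedgeL (Nat.add_sub_cancel' (Nat.le_of_lt_succ i.2))).precompL E
        (derivM α s y i) (β y (k - i)))) s y := by
    refine HasFDerivWithinAt.fun_sum fun i _ => ?_
    exact ContinuousLinearMap.hasFDerivWithinAt_of_bilinear _ (hα i).hasFDerivWithinAt
      (hβ (k - i)).hasFDerivWithinAt
  refine this.congr_fderiv ?_
  ext v : 1
  rw [Pi.add_apply, add_apply, mwFL_apply, mwFR_apply]
  simp only [sum_apply, add_apply, Finset.sum_add_distrib, mw]
  rw [add_comm]
  rfl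

theorem DiffM.mw {α β : E → MAlt E} (hα : DiffM α s y) (hβ : DiffM β s y) :
    DiffM (fun z => mw (α z) (β z)) s y :=
  fun k => (hasFDerivWithinAt_mw hα hβ k).differentiableWithinAt

/-- The bilinear product rule gives the full derivative of the wedge; alternatizing its two summands
produces the graded Leibniz rule. -/
theorem dM_mw (hs : UniqueDiffWithinAt ℝ s y) {α β : E → MAlt E} (hα : DiffM α s y)
    (hβ : DiffM β s y) :
    dM (fun z => mw (α z) (β z)) s y =
      mw (dM α s y) (β y) + mw (eps (α y)) (dM β s y) := by
  have : derivM (fun z => mw (α z) (β z)) s y =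
      mwFL (derivM α s y) (β y) + mwFR (α y) (derivM β s y) :=
    funext fun k => (hasFDerivWithinAt_mw hα hβ k).fderivWithin hs
  rw [dM, this, altM_add, altM_mwFL, altM_mwFR]
  rfl

theorem dM_add (hs : UniqueDiffWithinAt ℝ s y) {α β : E → MAlt E} (hα : DiffM α s y)
    (hβ : DiffM β s y) : dM (fun z => α z + β z) s y = dM α s y + dM β s y := by
  rw [dM, dM, dM, ← altM_add]
  congr 1
  funext k
  exact fderivWithin_add hs (hα k) (hβ k)

theorem DiffM.const (α : MAlt E) : DiffM (fun _ => α) s y :=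
  fun _ => differentiableWithinAt_const _

theorem altM_zero : altM (0 : ∀ k : ℕ, E →L[ℝ] E [⋀^Fin k]→L[ℝ] ℝ) = 0 := by
  funext k
  cases k with
  | zero => rfl
  | succ k => exact map_zero (ContinuousAlternatingMap.alternatizeUncurryFinCLM ℝ E ℝ)

theorem dM_const (α : MAlt E) : dM (fun _ => α) s y = 0 := by
  rw [dM, ← altM_zero]
  congr 1
  funext k
  exact fderivWithin_const_apply _

theorem DiffM.sum {ι : Type*} (t : Finset ι) {α : ι → E → MAlt E} (h : ∀ i ∈ t, DiffM (α i) s y) :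
    DiffM (fun z => ∑ i ∈ t, α i z) s y := fun k => by
  simp only [Finset.sum_apply]
  exact DifferentiableWithinAt.fun_sum fun i hi => h i hi k

theorem dM_sum {ι : Type*} (hs : UniqueDiffWithinAt ℝ s y) (t : Finset ι) {α : ι → E → MAlt E}
    (h : ∀ i ∈ t, DiffM (α i) s y) :
    dM (fun z => ∑ i ∈ t, α i z) s y = ∑ i ∈ t, dM (α i) s y := by
  classical
  induction t using Finset.induction_on with
  | empty => simpa using dM_const (0 : MAlt E)
  | insert a t ha ih =>
    simp only [Finset.sum_insert ha]
    rw [dM_add hs (h a (Finset.mem_insert_self _ _))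
      (DiffM.sum t fun i hi => h i (Finset.mem_insert_of_mem hi)),
      ih fun i hi => h i (Finset.mem_insert_of_mem hi)]

theorem DiffM.fun_smul {f : E → ℝ} {α : E → MAlt E} (hf : DifferentiableWithinAt ℝ f s y)
    (hα : DiffM α s y) : DiffM (fun z => f z • α z) s y := fun k => hf.smul (hα k)

/-- The `1`-form given by a linear functional, as a mixed form. -/
def oneM (θ : E →L[ℝ] ℝ) : MAlt E := altM fun k => θ.smulRight (mone k)

theorem dM_fun_smul (hs : UniqueDiffWithinAt ℝ s y) {f : E → ℝ} {f' : E →L[ℝ] ℝ} {α : E → MAlt E}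
    (hf : HasFDerivWithinAt f f' s y) (hα : DiffM α s y) :
    dM (fun z => f z • α z) s y = mw (oneM f') (α y) + f y • dM α s y := by
  -- Multiplication by a function is the wedge with the `0`-form `f`, so the Leibniz rule applies.
  have h1 : (fun z => f z • α z) = fun z => mw (f z • mone) (α z) := by
    funext z; rw [mw_smul_left, mone_mw]
  have h2 : DiffM (fun z => f z • (mone : MAlt E)) s y :=
    DiffM.fun_smul hf.differentiableWithinAt (DiffM.const _)
  have h3 : dM (fun z => f z • (mone : MAlt E)) s y = oneM f' := by
    rw [dM, oneM]
    congr 1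
    funext k
    exact (hf.smul_const ((mone : MAlt E) k)).fderivWithin hs
  rw [h1, dM_mw hs h2 hα, h3, eps_smul, eps_mone, mw_smul_left, mone_mw]

theorem dM_mpow (hs : UniqueDiffWithinAt ℝ s y) {Ω : E → MAlt E} (hΩ : DiffM Ω s y)
    (hd : dM Ω s y = 0) (n : ℕ) :
    DiffM (fun z => mpow (Ω z) n) s y ∧ dM (fun z => mpow (Ω z) n) s y = 0 := by
  induction n with
  | zero => exact ⟨DiffM.const _, dM_const _⟩
  | succ n ih =>
    refine ⟨hΩ.mw ih.1, ?_⟩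
    refine (dM_mw hs hΩ ih.1).trans ?_
    rw [hd, ih.2, mw_zero_left, mw_zero_right, add_zero]

theorem dM_mexp (hs : UniqueDiffWithinAt ℝ s y) {Ω : E → MAlt E} (hΩ : DiffM Ω s y)
    (hd : dM Ω s y = 0) (N : ℕ) :
    DiffM (fun z => mexp (Ω z) N) s y ∧ dM (fun z => mexp (Ω z) N) s y = 0 := by
  have h1 : ∀ j : ℕ, DiffM (fun z => ((j.factorial : ℝ)⁻¹) • mpow (Ω z) j) s y := fun j =>
    DiffM.fun_smul (differentiableWithinAt_const _) (dM_mpow hs hΩ hd j).1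
  refine ⟨DiffM.sum _ fun j _ => h1 j, ?_⟩
  refine (dM_sum hs _ fun j _ => h1 j).trans (Finset.sum_eq_zero fun j _ => ?_)
  rw [dM_fun_smul hs (hasFDerivWithinAt_const _ _ _) (dM_mpow hs hΩ hd j).1,
    (dM_mpow hs hΩ hd j).2, smul_zero, add_zero]
  have : oneM (0 : E →L[ℝ] ℝ) = 0 := by
    rw [oneM, ← altM_zero]
    congr 1
    funext k
    ext
    simp
  rw [this, mw_zero_left]

/-- A form whose degree exceeds the dimension vanishes. -/
theorem form_eq_zero_of_finrank_lt [FiniteDimensional ℝ E] {k : ℕ}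
    (h : Module.finrank ℝ E < k) (α : E [⋀^Fin k]→L[ℝ] ℝ) : α = 0 := by
  ext v
  refine α.toAlternatingMap.map_linearDependent v fun hv => ?_
  have := hv.fintype_card_le_finrank
  simp at this
  omega

end FieldCalculus

end DHCob
end

noncomputable section

namespace DHCob

/-! ### Constant coefficient operators on the dual of the Lie algebra, and polynomial identities. -/

section MonomialDeriv

variable {r : ℕ} (b : Module.Basis (Fin r) ℝ (LieAlg r))

/-- The derivative in the direction of a dual basis vector. -/
def coordDeriv (i : Fin r) (χ : LieDual r → ℝ) : LieDual r → ℝ := fun ξ =>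
  fderiv ℝ χ ξ (LinearMap.toContinuousLinearMap (b.coord i))

theorem contDiff_coordDeriv (i : Fin r) {χ : LieDual r → ℝ} (h : ContDiff ℝ ∞ χ) :
    ContDiff ℝ ∞ (coordDeriv b i χ) :=
  (h.fderiv_right (m := ∞) (by norm_cast)).clm_apply contDiff_const

theorem contDiff_iterate_coordDeriv (i : Fin r) (n : ℕ) {χ : LieDual r → ℝ}
    (h : ContDiff ℝ ∞ χ) : ContDiff ℝ ∞ ((coordDeriv b i)^[n] χ) := by
  induction n generalizing χ with
  | zero => exact h
  | succ n ih => exact ih (contDiff_coordDeriv b i h)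

theorem coordDeriv_comm (i j : Fin r) {χ : LieDual r → ℝ} (h : ContDiff ℝ ∞ χ) :
    coordDeriv b i (coordDeriv b j χ) = coordDeriv b j (coordDeriv b i χ) := by
  have h1 : Differentiable ℝ (fderiv ℝ χ) :=
    (h.fderiv_right (m := ∞) (by norm_cast)).differentiable (by simp)
  funext ξ
  have key : ∀ v w : LieDual r, fderiv ℝ (fun ξ => fderiv ℝ χ ξ v) ξ w =
      fderiv ℝ (fderiv ℝ χ) ξ w v := by
    intro v w
    rw [fderiv_clm_apply (h1 ξ) (differentiableAt_const v)]
    simp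
  change fderiv ℝ (fun ξ => fderiv ℝ χ ξ _) ξ _ = fderiv ℝ (fun ξ => fderiv ℝ χ ξ _) ξ _
  rw [key, key]
  have hs : IsSymmSndFDerivAt ℝ χ ξ :=
    h.contDiffAt.isSymmSndFDerivAt (by simp only [minSmoothness_of_isRCLikeNormedField]; exact WithTop.coe_le_coe.2 (le_top : (2 : ℕ∞) ≤ ⊤))
  exact hs _ _

theorem coordDeriv_iterate_comm (i j : Fin r) (n : ℕ) {χ : LieDual r → ℝ} (h : ContDiff ℝ ∞ χ) :
    coordDeriv b i ((coordDeriv b j)^[n] χ) = (coordDeriv b j)^[n] (coordDeriv b i χ) := by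
  induction n generalizing χ with
  | zero => rfl
  | succ n ih =>
    rw [Function.iterate_succ_apply, ih (contDiff_coordDeriv b j h), coordDeriv_comm b i j h]
    rfl

theorem monomialDeriv_eq (a : Fin r →₀ ℕ) (φ : LieDual r → ℝ) :
    monomialDeriv b a φ =
      (List.finRange r).foldr (fun i ψ => (coordDeriv b i)^[a i] ψ) φ := rfl

theorem contDiff_foldr (a : Fin r →₀ ℕ) {φ : LieDual r → ℝ} (h : ContDiff ℝ ∞ φ)
    (l : List (Fin r)) : ContDiff ℝ ∞ (l.foldr (fun i ψ => (coordDeriv b i)^[a i] ψ) φ) := by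
  induction l with
  | nil => exact h
  | cons i l ih => exact contDiff_iterate_coordDeriv b i _ ih

theorem contDiff_monomialDeriv (a : Fin r →₀ ℕ) {φ : LieDual r → ℝ} (h : ContDiff ℝ ∞ φ) :
    ContDiff ℝ ∞ (monomialDeriv b a φ) := contDiff_foldr b a h _

/-- The derivatives are applied in a fixed order of the indices. The additional one is moved to the
front by the symmetry of second derivatives, which is where smoothness of `φ` enters. -/
theorem monomialDeriv_add_single (a : Fin r →₀ ℕ) (j : Fin r) {φ : LieDual r → ℝ}
    (h : ContDiff ℝ ∞ φ) :
    monomialDeriv b (a + Finsupp.single j 1) φ = coordDeriv b j (monomialDeriv b a φ) := by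
  have aux : ∀ l : List (Fin r), l.Nodup →
      l.foldr (fun i ψ => (coordDeriv b i)^[(a + Finsupp.single j 1 : Fin r →₀ ℕ) i] ψ) φ =
        if j ∈ l then coordDeriv b j (l.foldr (fun i ψ => (coordDeriv b i)^[a i] ψ) φ)
        else l.foldr (fun i ψ => (coordDeriv b i)^[a i] ψ) φ := by
    intro l hl
    induction l with
    | nil => simp
    | cons i l ih =>
      rw [List.nodup_cons] at hl
      rw [List.foldr_cons, ih hl.2, List.foldr_cons]
      by_cases hij : i = j
      · subst hij
        rw [if_neg hl.1, if_pos List.mem_cons_self]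
        simp [Function.iterate_succ_apply']
      · have h1 : (a + Finsupp.single j 1 : Fin r →₀ ℕ) i = a i := by simp [Ne.symm hij]
        rw [h1]
        by_cases hj : j ∈ l
        · rw [if_pos hj, if_pos (List.mem_cons_of_mem _ hj),
            coordDeriv_iterate_comm b j i _ (contDiff_foldr b a h l)]
        · rw [if_neg hj, if_neg (by simp [hj, Ne.symm hij])]
  rw [monomialDeriv_eq, monomialDeriv_eq, aux _ (List.nodup_finRange r),
    if_pos (List.mem_finRange j)]

/-- The coordinates of `v` in the dual basis are its values `v (b i)`. With `v` a derivative of the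
moment map, these are contractions of the two-form. -/
theorem fderiv_eq_sum_coordDeriv (χ : LieDual r → ℝ) (ξ v : LieDual r) :
    fderiv ℝ χ ξ v = ∑ i, v (b i) * coordDeriv b i χ ξ := by
  have hv : v = ∑ i, v (b i) • LinearMap.toContinuousLinearMap (b.coord i) := by
    apply ContinuousLinearMap.coe_injective
    refine b.ext fun j => ?_
    simp [Finsupp.single_apply]
  conv_lhs => rw [hv]
  simp [coordDeriv]

end MonomialDeriv

section PolynomialIdentity

variable {r : ℕ} (b : Module.Basis (Fin r) ℝ (LieAlg r))

/-- Applying a linear functional `xᵃ ↦ cₐ` to a polynomial identity. -/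
theorem sum_eq_of_forall_eval_eq (s : Finset (Fin r →₀ ℕ)) (p : (Fin r →₀ ℕ) → ℝ)
    (q : (Fin r →₀ ℕ) → Fin r → ℝ) (c : (Fin r →₀ ℕ) → ℝ)
    (h : ∀ X : LieAlg r, ∑ a ∈ s, (∏ i, (b.coord i X) ^ a i) * p a =
      ∑ a ∈ s, (∏ i, (b.coord i X) ^ a i) * ∑ i, b.coord i X * q a i) :
    ∑ a ∈ s, c a * p a = ∑ a ∈ s, ∑ i, c (a + Finsupp.single i 1) * q a i := by
  -- The coordinates of `X` run through all of `ℝʳ`, so the identity of values is an identity of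
  -- polynomials; multiplying by the `i`-th variable shifts the exponent by `Finsupp.single i 1`.
  have key : (∑ a ∈ s, MvPolynomial.monomial a (p a) : MvPolynomial (Fin r) ℝ) =
      ∑ a ∈ s, ∑ i, MvPolynomial.monomial (a + Finsupp.single i 1) (q a i) := by
    refine MvPolynomial.funext fun x => ?_
    have := h (b.equivFun.symm x)
    have hx : ∀ i, b.coord i (b.equivFun.symm x) = x i := fun i => by
      simp [← Module.Basis.equivFun_apply, -Module.Basis.equivFun_symm_apply]
    simp only [hx] at this
    simp only [map_sum, MvPolynomial.eval_monomial]
    convert this using 2 with a _ a _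
    · rw [mul_comm, Finsupp.prod_fintype _ _ (by simp)]
    · rw [Finset.mul_sum]
      refine Finset.sum_congr rfl fun i _ => ?_
      rw [Finsupp.prod_fintype _ _ (by simp)]
      simp only [Finsupp.add_apply, pow_add, Finset.prod_mul_distrib]
      have : ∏ j, x j ^ (Finsupp.single i 1 : Fin r →₀ ℕ) j = x i := by
        rw [Finset.prod_eq_single i] <;> simp +contextual [eq_comm]
      rw [this]
      ring
  -- Monomials are a basis, so their images `c a` may be prescribed arbitrarily; later they are
  -- values of derivatives of a test function.
  let L : MvPolynomial (Fin r) ℝ →ₗ[ℝ] ℝ := (MvPolynomial.basisMonomials (Fin r) ℝ).constr ℝ c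
  have hL : ∀ a (t : ℝ), L (MvPolynomial.monomial a t) = c a * t := by
    intro a t
    have : MvPolynomial.monomial a t = t • MvPolynomial.basisMonomials (Fin r) ℝ a := by
      simp [MvPolynomial.smul_monomial]
    rw [this, map_smul, Module.Basis.constr_basis, smul_eq_mul, mul_comm]
  have := congrArg L key
  simpa only [map_sum, hL] using this

end PolynomialIdentity

end DHCob
end

noncomputable section

namespace DHCob

/-! ### Forms on manifolds in charts. -/

section Pointwise

variable {m : ℕ} {H : Type*} [TopologicalSpace H]
  {I : ModelWithCorners ℝ (EuclideanSpace ℝ (Fin m)) H}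
  {M : Type*} [TopologicalSpace M] [ChartedSpace H M]

/-- The coordinate expression at a point depends linearly on the form. -/
def chartRepL {k : ℕ} (x : M) (y : EuclideanSpace ℝ (Fin m)) :
    DForm I M k →ₗ[ℝ] EuclideanSpace ℝ (Fin m) [⋀^Fin k]→L[ℝ] ℝ where
  toFun α := chartRep α x y
  map_add' _ _ := rfl
  map_smul' _ _ := rfl

section

variable [IsManifold I ∞ M]

/-- The tangent space at `x` is identified with the model space through the preferred chart at `x`,
whose derivative at `x` is therefore the identity. -/
theorem chartRep_self {k : ℕ} (α : DForm I M k) (x : M) :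
    chartRep α x (extChartAt I x x) = α x := by
  have : IsManifold I 1 M := IsManifold.of_le (n := ∞) (by norm_cast)
  have aux : ∀ (x' : M) (L : EuclideanSpace ℝ (Fin m) →L[ℝ] EuclideanSpace ℝ (Fin m)), x' = x →
      L = ContinuousLinearMap.id ℝ _ →
      ContinuousAlternatingMap.compContinuousLinearMap
        (show EuclideanSpace ℝ (Fin m) [⋀^Fin k]→L[ℝ] ℝ from α x') L = α x := by
    rintro _ _ rfl rfl
    rfl
  exact aux _ _ (extChartAt_to_inv x) mfderivWithin_range_extChartAt_symm

theorem extD_eq {k : ℕ} (α : DForm I M k) (x : M) :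
    extD α x = extDerivWithin (chartRep α x) (Set.range I) (extChartAt I x x) := by
  have : IsManifold I 1 M := IsManifold.of_le (n := ∞) (by norm_cast)
  have aux : ∀ (L : EuclideanSpace ℝ (Fin m) →L[ℝ] EuclideanSpace ℝ (Fin m)),
      L = ContinuousLinearMap.id ℝ _ → ∀ β : EuclideanSpace ℝ (Fin m) [⋀^Fin (k + 1)]→L[ℝ] ℝ,
      ContinuousAlternatingMap.compContinuousLinearMap β L = β := by
    rintro _ rfl β
    rfl
  exact aux _ mfderiv_extChartAt_self _

end

theorem uniqueDiff_extChartAt (x : M) :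
    UniqueDiffWithinAt ℝ (Set.range I) (extChartAt I x x) :=
  I.uniqueDiffOn _ (extChartAt_target_subset_range x (mem_extChartAt_target x))

theorem IsSmoothForm.contDiffWithinAt {k : ℕ} {α : DForm I M k} (h : IsSmoothForm α) (x : M)
    {y : EuclideanSpace ℝ (Fin m)} (hy : y ∈ (extChartAt I x).target) :
    ContDiffWithinAt ℝ ∞ (chartRep α x) (Set.range I) y :=
  ((h x) y hy).mono_of_mem_nhdsWithin (extChartAt_target_mem_nhdsWithin_of_mem hy)

theorem IsSmoothForm.differentiableWithinAt {k : ℕ} {α : DForm I M k} (h : IsSmoothForm α) (x : M)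
    {y : EuclideanSpace ℝ (Fin m)} (hy : y ∈ (extChartAt I x).target) :
    DifferentiableWithinAt ℝ (chartRep α x) (Set.range I) y :=
  (h.contDiffWithinAt x hy).differentiableWithinAt (by simp)

theorem isSmoothForm_zero {k : ℕ} : IsSmoothForm (0 : DForm I M k) :=
  fun x => (contDiffOn_const (c := 0)).congr fun y _ => map_zero (chartRepL x y)

theorem IsSmoothForm.add {k : ℕ} {α β : DForm I M k} (hα : IsSmoothForm α)
    (hβ : IsSmoothForm β) : IsSmoothForm (α + β) :=
  fun x => (hα x).add (hβ x)

theorem IsSmoothForm.const_smul {k : ℕ} {α : DForm I M k} (c : ℝ) (hα : IsSmoothForm α) :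
    IsSmoothForm (c • α) := fun x => (hα x).const_smul c

theorem IsSmoothForm.sum {k : ℕ} {ι : Type*} (s : Finset ι) {α : ι → DForm I M k}
    (h : ∀ i ∈ s, IsSmoothForm (α i)) : IsSmoothForm (∑ i ∈ s, α i) := by
  classical
  induction s using Finset.induction_on with
  | empty => simpa using isSmoothForm_zero
  | insert a s ha ih =>
    rw [Finset.sum_insert ha]
    exact (h a (Finset.mem_insert_self _ _)).add (ih fun i hi => h i (Finset.mem_insert_of_mem hi))

section

variable [IsManifold I ∞ M]

theorem extD_smul {k : ℕ} (c : ℝ) (α : DForm I M k) : extD (c • α) = c • extD α := by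
  funext x
  have := extDerivWithin_smul c (chartRep α x) (uniqueDiff_extChartAt (I := I) x)
  rw [Pi.smul_apply, extD_eq, extD_eq]
  exact this

theorem extD_add {k : ℕ} {α β : DForm I M k} (hα : IsSmoothForm α) (hβ : IsSmoothForm β) :
    extD (α + β) = extD α + extD β := by
  funext x
  have := extDerivWithin_add (uniqueDiff_extChartAt (I := I) x)
    (hα.differentiableWithinAt x (mem_extChartAt_target x))
    (hβ.differentiableWithinAt x (mem_extChartAt_target x))
  rw [Pi.add_apply, extD_eq, extD_eq, extD_eq]
  exact this

theorem extD_zero {k : ℕ} : extD (0 : DForm I M k) = 0 := by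
  have := extD_smul (I := I) (M := M) (0 : ℝ) (0 : DForm I M k)
  rwa [zero_smul, zero_smul] at this

theorem extD_sum {k : ℕ} {ι : Type*} (s : Finset ι) {α : ι → DForm I M k}
    (h : ∀ i ∈ s, IsSmoothForm (α i)) : extD (∑ i ∈ s, α i) = ∑ i ∈ s, extD (α i) := by
  classical
  induction s using Finset.induction_on with
  | empty => simpa using extD_zero
  | insert a s ha ih =>
    rw [Finset.sum_insert ha, Finset.sum_insert ha, extD_add (h a (Finset.mem_insert_self _ _))
      (IsSmoothForm.sum s fun i hi => h i (Finset.mem_insert_of_mem hi)),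
      ih fun i hi => h i (Finset.mem_insert_of_mem hi)]

end

/-- The coordinate expression of a mixed form. -/
def chartRepM (α : MixedForm I M) (x₀ : M) (y : EuclideanSpace ℝ (Fin m)) :
    MAlt (EuclideanSpace ℝ (Fin m)) := fun k => chartRep (α k) x₀ y

/-- A mixed form is smooth if its components are. -/
def IsSmoothMixed (α : MixedForm I M) : Prop := ∀ k, IsSmoothForm (α k)

theorem chartRepM_self [IsManifold I ∞ M] (α : MixedForm I M) (x : M) :
    chartRepM α x (extChartAt I x x) = fun k => α k x :=
  funext fun k => chartRep_self (α k) x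

theorem chartRepM_mixedWedge (α β : MixedForm I M) (x : M) (y : EuclideanSpace ℝ (Fin m)) :
    chartRepM (mixedWedge α β) x y = mw (chartRepM α x y) (chartRepM β x y) :=
  mcomp_mw (E := EuclideanSpace ℝ (Fin m)) (F := EuclideanSpace ℝ (Fin m))
    (fun k => α k ((extChartAt I x).symm y)) (fun k => β k ((extChartAt I x).symm y)) _

theorem chartRepM_mixedOne (x : M) (y : EuclideanSpace ℝ (Fin m)) :
    chartRepM (mixedOne : MixedForm I M) x y = mone := by
  funext k
  cases k <;> rfl

theorem chartRepM_powForm (ωM : DForm I M 2) (n : ℕ) (x : M) (y : EuclideanSpace ℝ (Fin m)) :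
    chartRepM (powForm ωM n) x y = mpow (chartRepM (ofTwoForm ωM) x y) n := by
  induction n with
  | zero => exact chartRepM_mixedOne x y
  | succ n ih => rw [powForm, chartRepM_mixedWedge, ih, mpow]

theorem chartRepM_ofTwoForm_eq_zero (ωM : DForm I M 2) (x : M) (y : EuclideanSpace ℝ (Fin m))
    (k : ℕ) (hk : k ≠ 2) : chartRepM (ofTwoForm ωM) x y k = 0 := by
  match k, hk with
  | 0, _ => rfl
  | 1, _ => rfl
  | k + 3, _ => rfl

/-- `expForm` truncates its series according to the degree, `mexp` uniformly. A single `N` valid for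
all relevant degrees is what allows differentiating the exponential as one field. -/
theorem chartRepM_expForm (ωM : DForm I M 2) {k N : ℕ} (hk : k < N) (x : M)
    (y : EuclideanSpace ℝ (Fin m)) :
    chartRepM (expForm ωM) x y k = mexp (chartRepM (ofTwoForm ωM) x y) N k := by
  rw [mexp_apply_eq (chartRepM_ofTwoForm_eq_zero ωM x y) hk (Nat.lt_succ_self k)]
  simp only [mexp, Finset.sum_apply, Pi.smul_apply, ← chartRepM_powForm]
  change chartRepL x y (∑ j ∈ Finset.range (k + 1), ((j.factorial : ℝ)⁻¹) • powForm ωM j k) = _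
  simp only [map_sum, map_smul]
  rfl

theorem IsSmoothMixed.diffM {α : MixedForm I M} (h : IsSmoothMixed α) (x : M) :
    DiffM (chartRepM α x) (Set.range I) (extChartAt I x x) :=
  fun k => (h k).differentiableWithinAt x (mem_extChartAt_target x)

theorem dM_chartRepM_succ [IsManifold I ∞ M] (α : MixedForm I M) (x : M) (k : ℕ) :
    dM (chartRepM α x) (Set.range I) (extChartAt I x x) (k + 1) = extD (α k) x :=
  (extD_eq (α k) x).symm

theorem isSmoothMixed_ofTwoForm {ωM : DForm I M 2} (h : IsSmoothForm ωM) :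
    IsSmoothMixed (ofTwoForm ωM)
  | 0 => isSmoothForm_zero
  | 1 => isSmoothForm_zero
  | 2 => h
  | _ + 3 => isSmoothForm_zero

theorem dM_ofTwoForm [IsManifold I ∞ M] {ωM : DForm I M 2} (h : extD ωM = 0) (x : M) :
    dM (chartRepM (ofTwoForm ωM) x) (Set.range I) (extChartAt I x x) = 0 := by
  funext k
  match k with
  | 0 => rfl
  | 1 => exact (dM_chartRepM_succ _ x 0).trans (congrFun extD_zero x)
  | 2 => exact (dM_chartRepM_succ _ x 1).trans (congrFun extD_zero x)
  | 3 => exact (dM_chartRepM_succ _ x 2).trans (congrFun h x)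
  | k + 4 => exact (dM_chartRepM_succ _ x (k + 3)).trans (congrFun extD_zero x)

end Pointwise

end DHCob
end

noncomputable section

namespace DHCob

/-! ### Closedness of the twisted integrand. -/

section Twisted

variable {r : ℕ} {G : Type*} [TopologicalSpace G] [ChartedSpace (EuclideanSpace ℝ (Fin r)) G]
  [Group G]
  {m : ℕ} {H : Type*} [TopologicalSpace H]
  {I : ModelWithCorners ℝ (EuclideanSpace ℝ (Fin m)) H}
  {M : Type*} [TopologicalSpace M] [ChartedSpace H M] [MulAction G M]

theorem oneM_eq {E : Type*} [NormedAddCommGroup E] [NormedSpace ℝ E] {θ : E →L[ℝ] ℝ} {α : MAlt E}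
    (h0 : ∀ k, k ≠ 1 → α k = 0) (h : ∀ v, α 1 v = θ (v 0)) : oneM θ = α := by
  funext k
  match k with
  | 0 => exact (h0 0 (by simp)).symm
  | 1 =>
    ext v
    rw [h]
    simp [oneM, altM, ContinuousAlternatingMap.alternatizeUncurryFin_apply, mone]
  | k + 2 =>
    rw [h0 (k + 2) (by simp)]
    change ContinuousAlternatingMap.alternatizeUncurryFinCLM ℝ E ℝ
      (θ.smulRight ((mone : MAlt E) (k + 1))) = 0
    have : θ.smulRight ((mone : MAlt E) (k + 1)) = 0 := by
      ext v : 1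
      exact smul_zero (θ v)
    rw [this, map_zero]

/-- The generating vector field at `x` is the derivative of the orbit map at `1` applied to `X`,
hence linear in `X`. Thus `ι(X♯) η(X)` is polynomial in the coordinates of `X`. -/
theorem fundVF_eq_sum (b : Module.Basis (Fin r) ℝ (LieAlg r)) (X : LieAlg r) (x : M) :
    (fundVF (I := I) G X x : TangentSpace I x) = ∑ i, b.coord i X • fundVF (I := I) G (b i) x := by
  let L : LieAlg r →L[ℝ] EuclideanSpace ℝ (Fin m) := mfderiv (𝓡 r) I (fun g : G => g • x) 1
  have : L X = ∑ i, b.coord i X • L (b i) := by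
    conv_lhs => rw [← b.sum_repr X]
    rw [map_sum]
    simp
  exact this

theorem eval_apply (b : Module.Basis (Fin r) ℝ (LieAlg r)) (η : EquivForm I M r) (X : LieAlg r)
    (k : ℕ) : η.eval b X k = ∑ a ∈ η.support, (∏ i, (b.coord i X) ^ a i) • η a k := by
  rw [EquivForm.eval, Finsupp.sum, Finset.sum_apply]
  rfl

/-- The coordinate derivatives of the coefficients of a closed equivariant form, paired with a
family of numbers. -/
theorem sum_smul_dM_eq [IsManifold I ∞ M] {b : Module.Basis (Fin r) ℝ (LieAlg r)}
    {η : EquivForm I M r}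
    (hη : IsClosedEquivForm G b η) (c : (Fin r →₀ ℕ) → ℝ) (x : M) :
    ∑ a ∈ η.support, c a • dM (chartRepM (η a) x) (Set.range I) (extChartAt I x x) =
      ∑ a ∈ η.support, ∑ i, c (a + Finsupp.single i 1) •
        iota (E := EuclideanSpace ℝ (Fin m)) (fundVF (I := I) G (b i) x)
          (chartRepM (η a) x (extChartAt I x x)) := by
  have hcon : ∀ (X : LieAlg r) (k : ℕ) (v : Fin k → EuclideanSpace ℝ (Fin m)),
      contract (fundVF (I := I) G X) (η.eval b X (k + 1)) x v = ∑ a ∈ η.support, (∏ i, (b.coord i X) ^ a i) *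
        ∑ i, b.coord i X * iota (E := EuclideanSpace ℝ (Fin m)) (fundVF (I := I) G (b i) x)
          (chartRepM (η a) x (extChartAt I x x)) k v := by
    intro X k v
    let Lc : DForm I M (k + 1) →ₗ[ℝ] EuclideanSpace ℝ (Fin m) →ₗ[ℝ] ℝ :=
      LinearMap.mk₂ ℝ (fun α Y =>
        (ContinuousAlternatingMap.curryLeft (E := EuclideanSpace ℝ (Fin m)) (α x) Y) v)
        (fun _ _ _ => rfl) (fun _ _ _ => rfl)
        (fun _ _ _ => by simp only [map_add]; rfl) (fun _ _ _ => by simp only [map_smul]; rfl)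
    let Y : Fin r → EuclideanSpace ℝ (Fin m) := fun i => fundVF (I := I) G (b i) x
    have hY : (fundVF (I := I) G X x : EuclideanSpace ℝ (Fin m)) = ∑ i, b.coord i X • Y i :=
      fundVF_eq_sum b X x
    have h2 : Lc (∑ a ∈ η.support, (∏ i, (b.coord i X) ^ a i) • η a (k + 1))
        (∑ i, b.coord i X • Y i) =
        ∑ a ∈ η.support, (∏ i, (b.coord i X) ^ a i) * ∑ i, b.coord i X *
          Lc (η a (k + 1)) (Y i) := by
      rw [map_sum Lc, LinearMap.sum_apply]
      refine Finset.sum_congr rfl fun a _ => ?_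
      rw [map_smul, LinearMap.smul_apply, smul_eq_mul, map_sum]
      congr 1
      exact Finset.sum_congr rfl fun i _ => map_smul (Lc (η a (k + 1))) _ _
    rw [← hY, ← eval_apply] at h2
    refine h2.trans ?_
    simp only [chartRepM_self]
    rfl
  funext k
  ext v
  simp only [Finset.sum_apply, Pi.smul_apply, ContinuousAlternatingMap.sum_apply,
    ContinuousAlternatingMap.smul_apply, smul_eq_mul]
  -- For a fixed degree and fixed arguments `v`, equivariant closedness is an identity of real
  -- polynomials in the coordinates of `X`.
  refine sum_eq_of_forall_eval_eq b η.support (fun a => dM (chartRepM (η a) x) (Set.range I)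
    (extChartAt I x x) k v) (fun a i => iota (E := EuclideanSpace ℝ (Fin m)) (fundVF (I := I) G (b i) x)
          (chartRepM (η a) x (extChartAt I x x)) k v) c fun X => ?_
  refine Eq.trans ?_ (hcon X k v)
  cases k with
  | zero =>
    -- In degree `0` an exterior derivative is `0` by the definition of `altM`, and the contraction
    -- vanishes by the separate axiom for this degree.
    rw [hη.closed_zero X]
    refine Finset.sum_eq_zero fun a _ => ?_
    exact mul_zero _
  | succ k =>
    rw [← hη.closed X k, eval_apply, extD_sum _ fun a _ => (hη.smooth a k).const_smul _]
    simp only [extD_smul, dM_chartRepM_succ, Finset.sum_apply, Pi.smul_apply]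
    let ev : (EuclideanSpace ℝ (Fin m) [⋀^Fin (k + 1)]→L[ℝ] ℝ) →ₗ[ℝ] ℝ :=
      ⟨⟨fun α => α v, fun _ _ => rfl⟩, fun _ _ => rfl⟩
    exact (map_sum ev (fun a => (∏ i, (b.coord i X) ^ a i) •
      (show EuclideanSpace ℝ (Fin m) [⋀^Fin (k + 1)]→L[ℝ] ℝ from extD (η a k) x)) η.support).symm

/-- The axiom `hamilton` treats each component of `Φ` separately. Here one derivative with values in
`𝔤*` encodes all components, as the chain rule for `φ ∘ Φ` requires. -/
theorem hasFDerivWithinAt_moment [IsManifold I ∞ M] {o : DForm I M m} {ωM : DForm I M 2}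
    {Φ : M → LieDual r} (hM : IsHamiltonian G o ωM Φ) (x : M) :
    ∃ Φ' : EuclideanSpace ℝ (Fin m) →L[ℝ] LieDual r,
      HasFDerivWithinAt (Φ ∘ (extChartAt I x).symm) Φ' (Set.range I) (extChartAt I x x) ∧
      ∀ (X : LieAlg r) (v : EuclideanSpace ℝ (Fin m)), Φ' v X =
        ContinuousAlternatingMap.curryLeft (E := EuclideanSpace ℝ (Fin m)) (ωM x)
          (fundVF (I := I) G X x) (fun _ => v) := by
  have h1 : MDifferentiableAt I 𝓘(ℝ, LieDual r) Φ x :=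
    hM.smooth_moment.mdifferentiableAt (by simp)
  have h2 : HasFDerivWithinAt (Φ ∘ (extChartAt I x).symm)
    (show EuclideanSpace ℝ (Fin m) →L[ℝ] LieDual r from mfderiv I 𝓘(ℝ, LieDual r) Φ x)
    (Set.range I) (extChartAt I x x) := h1.hasMFDerivAt.2
  refine ⟨_, h2, fun X v => ?_⟩
  have h3 : HasFDerivWithinAt ((fun y => Φ y X) ∘ (extChartAt I x).symm)
      ((ContinuousLinearMap.apply ℝ ℝ X) ∘L (show EuclideanSpace ℝ (Fin m) →L[ℝ] LieDual r from
        mfderiv I 𝓘(ℝ, LieDual r) Φ x)) (Set.range I) (extChartAt I x x) :=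
    (ContinuousLinearMap.apply ℝ ℝ X).hasFDerivAt.comp_hasFDerivWithinAt _ h2
  have h4 : HasMFDerivAt I 𝓘(ℝ, ℝ) (fun y => Φ y X) x
      (show TangentSpace I x →L[ℝ] ℝ from
      ((ContinuousLinearMap.apply ℝ ℝ X) ∘L (show EuclideanSpace ℝ (Fin m) →L[ℝ] LieDual r from
        mfderiv I 𝓘(ℝ, LieDual r) Φ x))) := by
    refine ⟨?_, h3⟩
    exact ((ContinuousLinearMap.apply ℝ ℝ X).continuous.comp
      hM.smooth_moment.continuous).continuousAt
  have h5 := hM.hamilton X x v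
  rw [h4.mfderiv] at h5
  exact h5

end Twisted

section Closed

variable {r : ℕ} {G : Type*} [TopologicalSpace G] [ChartedSpace (EuclideanSpace ℝ (Fin r)) G]
  [Group G]
  {m : ℕ} {H : Type*} [TopologicalSpace H]
  {I : ModelWithCorners ℝ (EuclideanSpace ℝ (Fin (m + 1))) H}
  {M : Type*} [TopologicalSpace M] [ChartedSpace H M] [MulAction G M]

/-- The integrand of the twisted Duistermaat–Heckman distribution is closed in codegree one. -/
theorem extD_twisted_eq_zero [IsManifold I ∞ M] {b : Module.Basis (Fin r) ℝ (LieAlg r)}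
    {o : DForm I M (m + 1)} {ωM : DForm I M 2} {Φ : M → LieDual r} (hM : IsHamiltonian G o ωM Φ)
    {η : EquivForm I M r} (hη : IsClosedEquivForm G b η) {φ : LieDual r → ℝ}
    (hφ : ContDiff ℝ ∞ φ) :
    extD (mixedWedge (expForm ωM) (twistedPairing b η Φ φ) m) = 0 := by
  funext x
  set s := Set.range I
  set y₀ := extChartAt I x x
  have hs : UniqueDiffWithinAt ℝ s y₀ := uniqueDiff_extChartAt x
  set Ω := chartRepM (ofTwoForm ωM) x
  have hΩ : ∀ z k, k ≠ 2 → Ω z k = 0 := chartRepM_ofTwoForm_eq_zero ωM x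
  let f : (Fin r →₀ ℕ) → EuclideanSpace ℝ (Fin (m + 1)) → ℝ := fun a z =>
    monomialDeriv b a φ (Φ ((extChartAt I x).symm z))
  let c : (Fin r →₀ ℕ) → ℝ := fun a => monomialDeriv b a φ (Φ x)
  let T : EuclideanSpace ℝ (Fin (m + 1)) → MAlt (EuclideanSpace ℝ (Fin (m + 1))) := fun z =>
    ∑ a ∈ η.support, f a z • chartRepM (η a) x z
  let X : Fin r → EuclideanSpace ℝ (Fin (m + 1)) := fun i => fundVF (I := I) G (b i) x
  have hT : ∀ z, chartRepM (twistedPairing b η Φ φ) x z = T z := by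
    intro z
    funext k
    simp only [T, Finset.sum_apply, Pi.smul_apply]
    have h1 : twistedPairing b η Φ φ k = ∑ a ∈ η.support,
        (fun x => monomialDeriv b a φ (Φ x) • η a k x : DForm I M k) := by
      rw [twistedPairing, Finsupp.sum, Finset.sum_apply]
    change chartRepL x z (twistedPairing b η Φ φ k) = _
    rw [h1, map_sum]
    rfl
  -- The truncation `m + 3` is large enough for `iota_mexp_mw` in degree `m + 1`.
  have hrep : chartRep (mixedWedge (expForm ωM) (twistedPairing b η Φ φ) m) x =
      fun z => mw (mexp (Ω z) (m + 3)) (T z) m := by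
    funext z
    refine (congrFun (chartRepM_mixedWedge (expForm ωM) (twistedPairing b η Φ φ) x z) m).trans ?_
    rw [hT]
    exact mw_congr_left _ fun j hj => chartRepM_expForm ωM (by omega) x z
  have hder : extD (mixedWedge (expForm ωM) (twistedPairing b η Φ φ) m) x =
      dM (fun z => mw (mexp (Ω z) (m + 3)) (T z)) s y₀ (m + 1) := by
    rw [extD_eq, hrep]
    rfl
  obtain ⟨Φ', hΦ', hham⟩ := hasFDerivWithinAt_moment hM x
  have hf : ∀ a, HasFDerivWithinAt (f a) ((fderiv ℝ (monomialDeriv b a φ) (Φ x)) ∘L Φ') s y₀ := by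
    intro a
    have h1 : HasFDerivAt (monomialDeriv b a φ) (fderiv ℝ (monomialDeriv b a φ) (Φ x))
        ((Φ ∘ (extChartAt I x).symm) y₀) := by
      have : (Φ ∘ (extChartAt I x).symm) y₀ = Φ x := by simp [y₀]
      rw [this]
      exact ((contDiff_monomialDeriv b a hφ).differentiable (by simp) _).hasFDerivAt
    exact h1.comp_hasFDerivWithinAt y₀ hΦ'
  have hηd : ∀ a, DiffM (chartRepM (η a) x) s y₀ := fun a =>
    IsSmoothMixed.diffM (fun k => hη.smooth a k) x
  have hTd : ∀ a ∈ η.support, DiffM (fun z => f a z • chartRepM (η a) x z) s y₀ := fun a _ =>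
    DiffM.fun_smul (hf a).differentiableWithinAt (hηd a)
  obtain ⟨hE1, hE2⟩ := dM_mexp hs ((isSmoothMixed_ofTwoForm hM.smooth).diffM x)
    (dM_ofTwoForm hM.closed x) (m + 3)
  -- Chain rule and moment map equation: `d c_a = ∑ᵢ c_{a+eᵢ} ι(Xᵢ♯) ω`, one further derivative of
  -- `φ` for each contraction of the two-form.
  have hone : ∀ a, oneM ((fderiv ℝ (monomialDeriv b a φ) (Φ x)) ∘L Φ') =
      ∑ i, c (a + Finsupp.single i 1) • iota (X i) (Ω y₀) := by
    intro a
    refine oneM_eq (fun k hk => ?_) fun v => ?_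
    · simp only [Finset.sum_apply, Pi.smul_apply]
      refine Finset.sum_eq_zero fun i _ => ?_
      rw [iota, hΩ y₀ (k + 1) (by omega)]
      exact smul_zero _
    · simp only [Finset.sum_apply, Pi.smul_apply, ContinuousAlternatingMap.sum_apply,
        ContinuousAlternatingMap.smul_apply, smul_eq_mul]
      rw [ContinuousLinearMap.comp_apply, fderiv_eq_sum_coordDeriv b]
      refine Finset.sum_congr rfl fun i _ => ?_
      rw [mul_comm, hham, ← monomialDeriv_add_single b a i hφ]
      congr 1
      have hv : v = fun _ => v 0 := by
        funext j; rw [Subsingleton.elim j 0]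
      have h2 : Ω y₀ = fun k => ofTwoForm ωM k x := chartRepM_self _ x
      rw [iota, h2, hv]
      rfl
  -- The differentials of the coefficients `c_a` supply the terms with `ω`, and equivariant
  -- closedness supplies the terms `ι(Xᵢ♯) ηₐ` with the same factors `c_{a+eᵢ}`.
  have hTsum : dM T s y₀ = ∑ a ∈ η.support, ∑ i, c (a + Finsupp.single i 1) •
      (mw (iota (X i) (Ω y₀)) (chartRepM (η a) x y₀) + iota (X i) (chartRepM (η a) x y₀)) := by
    have h1 : dM T s y₀ = ∑ a ∈ η.support,
        (mw (oneM ((fderiv ℝ (monomialDeriv b a φ) (Φ x)) ∘L Φ')) (chartRepM (η a) x y₀) +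
          c a • dM (chartRepM (η a) x) s y₀) := by
      refine (dM_sum hs _ hTd).trans (Finset.sum_congr rfl fun a _ => ?_)
      rw [dM_fun_smul hs (hf a) (hηd a)]
      simp [f, c, y₀]
    rw [h1, Finset.sum_add_distrib, sum_smul_dM_eq hη c x, ← Finset.sum_add_distrib]
    refine Finset.sum_congr rfl fun a _ => ?_
    rw [hone, mw_sum_left, ← Finset.sum_add_distrib]
    refine Finset.sum_congr rfl fun i _ => ?_
    rw [mw_smul_left, smul_add]
  have hmain : dM (fun z => mw (mexp (Ω z) (m + 3)) (T z)) s y₀ (m + 1) =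
      mw (mexp (Ω y₀) (m + 3)) (dM T s y₀) (m + 1) := by
    rw [dM_mw hs hE1 (DiffM.sum _ hTd), hE2, mw_zero_left, zero_add,
      eps_mexp (eps_of_two (hΩ y₀))]
  rw [hder, hmain, hTsum, mw_sum_right, Finset.sum_apply]
  refine Finset.sum_eq_zero fun a _ => ?_
  rw [mw_sum_right, Finset.sum_apply]
  refine Finset.sum_eq_zero fun i _ => ?_
  -- Each summand is now a contraction of a form of degree `m + 2` on a space of dimension `m + 1`.
  rw [mw_smul_right, Pi.smul_apply, iota_mexp_mw (hΩ y₀) _ _ (by omega), iota,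
    form_eq_zero_of_finrank_lt (by simp) (mw _ _ (m + 1 + 1))]
  exact smul_zero _

end Closed

end DHCob
end

noncomputable section

namespace DHCob

/-! ### Smoothness of evaluations, products and pullbacks of forms. -/

section SmoothFamilies

variable {X : Type*} [NormedAddCommGroup X] [NormedSpace ℝ X]

/-- Currying off one argument at a time reduces to the evaluation of a smooth family of continuous
linear maps. -/
theorem contDiffWithinAt_form_apply {E : Type*} [NormedAddCommGroup E] [NormedSpace ℝ E]
    {n : ℕ∞ω} {s : Set X} {y : X} : ∀ {k : ℕ} {F : X → E [⋀^Fin k]→L[ℝ] ℝ} {w : X → Fin k → E},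
    ContDiffWithinAt ℝ n F s y → (∀ a, ContDiffWithinAt ℝ n (fun z => w z a) s y) →
      ContDiffWithinAt ℝ n (fun z => F z (w z)) s y := by
  intro k
  induction k with
  | zero =>
    intro F w hF _
    have h : (fun z => F z (w z)) = fun z =>
        (ContinuousAlternatingMap.constOfIsEmptyLIE ℝ E ℝ (Fin 0)).symm (F z) := by
      funext z
      have : w z = 0 := Subsingleton.elim _ _
      rw [this]
      rfl
    rw [h]
    exact (LinearIsometryEquiv.contDiff _).comp_contDiffWithinAt hF
  | succ k ih =>
    intro F w hF hw
    have h : (fun z => F z (w z)) = fun z =>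
        ((ContinuousAlternatingMap.curryLeftLI (𝕜 := ℝ) (E := E) (F := ℝ) (n := k)) (F z) (w z 0)) (fun a => w z a.succ) := by
      funext z
      change _ = F z (Fin.cons (w z 0) fun a => w z a.succ)
      congr 1
      funext a
      exact Fin.cases rfl (fun _ => rfl) a
    rw [h]
    refine ih ?_ fun a => hw a.succ
    exact (((LinearIsometry.contDiff _).comp_contDiffWithinAt hF).clm_apply (hw 0))

/-- A family of alternating forms on `ℝᵐ` is smooth if its evaluations are. -/
theorem contDiffWithinAt_form_of_apply {m k : ℕ} {n : ℕ∞ω} {s : Set X} {y : X}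
    {F : X → EuclideanSpace ℝ (Fin m) [⋀^Fin k]→L[ℝ] ℝ}
    (h : ∀ v, ContDiffWithinAt ℝ n (fun z => F z v) s y) : ContDiffWithinAt ℝ n F s y := by
  -- A form is determined by its values on basis vectors. A linear left inverse of this injection is
  -- automatically continuous, its source being finite dimensional.
  let e : EuclideanSpace ℝ (Fin m) [⋀^Fin k]→L[ℝ] ℝ →ₗ[ℝ] ((Fin k → Fin m) → ℝ) :=
    { toFun := fun α s => α fun a => EuclideanSpace.basisFun (Fin m) ℝ (s a)
      map_add' := fun _ _ => rfl
      map_smul' := fun _ _ => rfl }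
  have he : LinearMap.ker e = ⊥ := by
    refine LinearMap.ker_eq_bot.2 fun α β hαβ => ?_
    have : α.toAlternatingMap = β.toAlternatingMap :=
      Module.Basis.ext_alternating (EuclideanSpace.basisFun (Fin m) ℝ).toBasis fun s _ => by
        have h1 : α (fun a => EuclideanSpace.basisFun (Fin m) ℝ (s a)) =
            β (fun a => EuclideanSpace.basisFun (Fin m) ℝ (s a)) := congrFun hαβ s
        simpa using h1
    ext v
    exact congrArg (fun f => f v) this
  obtain ⟨g, hg⟩ := e.exists_leftInverse_of_injective he
  have hF : F = fun z => LinearMap.toContinuousLinearMap g (e (F z)) := by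
    funext z
    exact (LinearMap.congr_fun hg (F z)).symm
  rw [hF]
  exact (ContinuousLinearMap.contDiff _).comp_contDiffWithinAt
    (contDiffWithinAt_pi.2 fun t => h _)

theorem contDiffWithinAt_form_comp {E : Type*} [NormedAddCommGroup E] [NormedSpace ℝ E]
    {m k : ℕ} {n : ℕ∞ω} {s : Set X} {y : X} {F : X → E [⋀^Fin k]→L[ℝ] ℝ}
    {T : X → EuclideanSpace ℝ (Fin m) →L[ℝ] E}
    (hF : ContDiffWithinAt ℝ n F s y) (hT : ContDiffWithinAt ℝ n T s y) :
    ContDiffWithinAt ℝ n (fun z => (F z).compContinuousLinearMap (T z)) s y :=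
  contDiffWithinAt_form_of_apply fun v =>
    contDiffWithinAt_form_apply (w := fun z a => T z (v a)) hF
      fun _ => hT.clm_apply contDiffWithinAt_const

end SmoothFamilies

section SmoothAlgebra

variable {m : ℕ} {H : Type*} [TopologicalSpace H]
  {I : ModelWithCorners ℝ (EuclideanSpace ℝ (Fin m)) H}
  {M : Type*} [TopologicalSpace M] [ChartedSpace H M]

theorem IsSmoothMixed.mixedWedge {α β : MixedForm I M} (hα : IsSmoothMixed α)
    (hβ : IsSmoothMixed β) : IsSmoothMixed (mixedWedge α β) := by
  intro k x y hy
  have h : chartRep (DHCob.mixedWedge α β k) x = fun z => ∑ i : Fin (k + 1),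
      wedgeL (Nat.add_sub_cancel' (Nat.le_of_lt_succ i.2)) (chartRep (α i) x z)
        (chartRep (β (k - i)) x z) :=
    funext fun z => congrFun (chartRepM_mixedWedge α β x z) k
  rw [h]
  refine ContDiffWithinAt.sum fun i _ => ?_
  exact ((ContinuousLinearMap.contDiff _).comp_contDiffWithinAt (hα i x y hy)).clm_apply
    (hβ (k - i) x y hy)

theorem isSmoothMixed_mixedOne : IsSmoothMixed (mixedOne : MixedForm I M) := by
  intro k x y _
  have h : chartRep ((mixedOne : MixedForm I M) k) x = fun _ => mone k :=
    funext fun z => congrFun (chartRepM_mixedOne x z) k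
  rw [h]
  exact contDiffWithinAt_const

theorem isSmoothMixed_powForm {ωM : DForm I M 2} (h : IsSmoothForm ωM) :
    ∀ n, IsSmoothMixed (powForm ωM n)
  | 0 => isSmoothMixed_mixedOne
  | n + 1 => (isSmoothMixed_ofTwoForm h).mixedWedge (isSmoothMixed_powForm h n)

theorem isSmoothMixed_expForm {ωM : DForm I M 2} (h : IsSmoothForm ωM) :
    IsSmoothMixed (expForm ωM) := fun k =>
  IsSmoothForm.sum _ fun j _ => (isSmoothMixed_powForm h j k).const_smul _

theorem contDiffOn_comp_extChartAt_symm [IsManifold I ∞ M] {E : Type*} [NormedAddCommGroup E]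
    [NormedSpace ℝ E] {f : M → E} (hf : ContMDiff I 𝓘(ℝ, E) ∞ f) (x : M) :
    ContDiffOn ℝ ∞ (fun y => f ((extChartAt I x).symm y)) (extChartAt I x).target := by
  have h := (contMDiff_iff.1 hf).2 x (f x)
  rw [extChartAt_model_space_eq_id] at h
  exact h.mono fun y hy => ⟨hy, Set.mem_univ _⟩

theorem IsSmoothForm.fun_smul [IsManifold I ∞ M] {k : ℕ} {f : M → ℝ} (hf : ContMDiff I 𝓘(ℝ, ℝ) ∞ f)
    {α : DForm I M k} (hα : IsSmoothForm α) : IsSmoothForm (fun x => f x • α x : DForm I M k) :=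
  fun x => (contDiffOn_comp_extChartAt_symm hf x).smul (hα x)

theorem isSmoothMixed_twistedPairing [IsManifold I ∞ M] {r : ℕ}
    (b : Module.Basis (Fin r) ℝ (LieAlg r)) {η : EquivForm I M r}
    (hη : ∀ a k, IsSmoothForm (η a k)) {Φ : M → LieDual r}
    (hΦ : ContMDiff I 𝓘(ℝ, LieDual r) ∞ Φ) {φ : LieDual r → ℝ} (hφ : ContDiff ℝ ∞ φ) :
    IsSmoothMixed (twistedPairing b η Φ φ) := by
  intro k
  have h : twistedPairing b η Φ φ k =
      ∑ a ∈ η.support, (fun x => monomialDeriv b a φ (Φ x) • η a k x : DForm I M k) := by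
    rw [twistedPairing, Finsupp.sum, Finset.sum_apply]
  rw [h]
  exact IsSmoothForm.sum _ fun a _ =>
    IsSmoothForm.fun_smul ((contDiff_monomialDeriv b a hφ).contMDiff.comp hΦ) (hη a k)

end SmoothAlgebra

/-! ### Naturality of the exterior derivative. -/

section Naturality

variable {m : ℕ} {H : Type*} [TopologicalSpace H]
  {I : ModelWithCorners ℝ (EuclideanSpace ℝ (Fin m)) H}
  {M : Type*} [TopologicalSpace M] [ChartedSpace H M] [IsManifold I ∞ M]

/-- The derivatives of a chart and of its inverse cancel, so a form is recovered from its expression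
in any chart around the point. -/
theorem eq_chartRep_comp_mfderiv {k : ℕ} (α : DForm I M k) {x₀ p : M}
    (hp : p ∈ (extChartAt I x₀).source) :
    α p = (chartRep α x₀ (extChartAt I x₀ p)).compContinuousLinearMap
      (mfderiv I 𝓘(ℝ, EuclideanSpace ℝ (Fin m)) (extChartAt I x₀) p) := by
  have : IsManifold I 1 M := IsManifold.of_le (n := ∞) (by norm_cast)
  have h1 := mfderivWithin_extChartAt_symm_comp_mfderiv_extChartAt' (I := I) hp
  have aux : ∀ (q : M) (L L' : EuclideanSpace ℝ (Fin m) →L[ℝ] EuclideanSpace ℝ (Fin m)), q = p →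
      L ∘L L' = ContinuousLinearMap.id ℝ _ →
      (show EuclideanSpace ℝ (Fin m) [⋀^Fin k]→L[ℝ] ℝ from α p) =
      ContinuousAlternatingMap.compContinuousLinearMap
        (ContinuousAlternatingMap.compContinuousLinearMap
        (show EuclideanSpace ℝ (Fin m) [⋀^Fin k]→L[ℝ] ℝ from α q) L) L' := by
    rintro _ L L' rfl h
    ext v
    have h2 : ∀ w, L (L' w) = w := fun w => DFunLike.congr_fun h w
    change α _ v = α _ fun a => L (L' (v a))
    simp only [h2]
  exact aux _ _ _ ((extChartAt I x₀).left_inv hp) h1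

variable {m' : ℕ} {H' : Type*} [TopologicalSpace H']
    {I' : ModelWithCorners ℝ (EuclideanSpace ℝ (Fin m')) H'}
    {N : Type*} [TopologicalSpace N] [ChartedSpace H' N] [IsManifold I' ∞ N]

theorem hasFDerivWithinAt_comp_extChartAt_symm {E : Type*} [NormedAddCommGroup E] [NormedSpace ℝ E]
    {f : N → E} {x₀ : N} {y : EuclideanSpace ℝ (Fin m')} (hy : y ∈ (extChartAt I' x₀).target)
    (hf : MDifferentiableAt I' 𝓘(ℝ, E) f ((extChartAt I' x₀).symm y)) :
    HasFDerivWithinAt (fun z => f ((extChartAt I' x₀).symm z))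
      (show EuclideanSpace ℝ (Fin m') →L[ℝ] E from
        (mfderiv I' 𝓘(ℝ, E) f ((extChartAt I' x₀).symm y)).comp
        (mfderivWithin 𝓘(ℝ, EuclideanSpace ℝ (Fin m')) I' (extChartAt I' x₀).symm
          (Set.range I') y)) (Set.range I') y := by
  have : IsManifold I' 1 N := IsManifold.of_le (n := ∞) (by norm_cast)
  exact (hf.hasMFDerivAt.comp_hasMFDerivWithinAt y
    (mdifferentiableWithinAt_extChartAt_symm hy).hasMFDerivWithinAt).hasFDerivWithinAt

theorem chartRep_pullback {k : ℕ} (α : DForm I M k) {f : N → M} {x₀ : N} {y₀ : M}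
    {y : EuclideanSpace ℝ (Fin m')} (hy : y ∈ (extChartAt I' x₀).target)
    (hf : MDifferentiableAt I' I f ((extChartAt I' x₀).symm y))
    (hfy : f ((extChartAt I' x₀).symm y) ∈ (extChartAt I y₀).source) :
    chartRep (pullback f α : DForm I' N k) x₀ y =
      (chartRep α y₀ (extChartAt I y₀ (f ((extChartAt I' x₀).symm y)))).compContinuousLinearMap
        (fderivWithin ℝ (fun z => extChartAt I y₀ (f ((extChartAt I' x₀).symm z)))
          (Set.range I') y) := by
  have : IsManifold I 1 M := IsManifold.of_le (n := ∞) (by norm_cast)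
  have hφ : MDifferentiableAt I 𝓘(ℝ, EuclideanSpace ℝ (Fin m)) (extChartAt I y₀)
      (f ((extChartAt I' x₀).symm y)) :=
    mdifferentiableAt_extChartAt (by rwa [extChartAt_source] at hfy)
  have h := (hasFDerivWithinAt_comp_extChartAt_symm (f := fun p => extChartAt I y₀ (f p)) hy
    (hφ.comp _ hf)).fderivWithin (I'.uniqueDiffOn _ (extChartAt_target_subset_range x₀ hy))
  rw [h]
  have h2 : mfderiv I' 𝓘(ℝ, EuclideanSpace ℝ (Fin m)) (fun p => extChartAt I y₀ (f p))
      ((extChartAt I' x₀).symm y) = _ := mfderiv_comp _ hφ hf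
  rw [h2]
  change ContinuousAlternatingMap.compContinuousLinearMap
    (ContinuousAlternatingMap.compContinuousLinearMap (α (f ((extChartAt I' x₀).symm y))) _) _ = _
  rw [eq_chartRep_comp_mfderiv α hfy]
  rfl

theorem contDiffWithinAt_chart_comp {f : N → M} (hf : ContMDiff I' I ∞ f) {x₀ : N} {y₀ : M}
    {y : EuclideanSpace ℝ (Fin m')} (hy : y ∈ (extChartAt I' x₀).target)
    (hfy : f ((extChartAt I' x₀).symm y) ∈ (extChartAt I y₀).source) :
    ContDiffWithinAt ℝ ∞ (fun z => extChartAt I y₀ (f ((extChartAt I' x₀).symm z)))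
      (Set.range I') y := by
  refine ((contMDiff_iff.1 hf).2 x₀ y₀ y ⟨hy, hfy⟩).mono_of_mem_nhdsWithin ?_
  refine Filter.inter_mem (extChartAt_target_mem_nhdsWithin_of_mem hy) ?_
  have : ContinuousWithinAt (fun z => f ((extChartAt I' x₀).symm z)) (Set.range I') y := by
    refine hf.continuous.continuousAt.comp_continuousWithinAt ?_
    exact ((continuousOn_extChartAt_symm x₀) y hy).mono_of_mem_nhdsWithin
      (extChartAt_target_mem_nhdsWithin_of_mem hy)
  exact this (extChartAt_source_mem_nhds' hfy)

theorem chartRep_pullback_eventuallyEq {k : ℕ} (α : DForm I M k) {f : N → M}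
    (hf : ContMDiff I' I ∞ f) {x₀ : N} {y₀ : M}
    {y : EuclideanSpace ℝ (Fin m')} (hy : y ∈ (extChartAt I' x₀).target)
    (hfy : f ((extChartAt I' x₀).symm y) ∈ (extChartAt I y₀).source) :
    chartRep (pullback f α : DForm I' N k) x₀ =ᶠ[nhdsWithin y (Set.range I')] fun w =>
      (chartRep α y₀ (extChartAt I y₀ (f ((extChartAt I' x₀).symm w)))).compContinuousLinearMap
        (fderivWithin ℝ (fun z => extChartAt I y₀ (f ((extChartAt I' x₀).symm z)))
          (Set.range I') w) := by
  have hc : ContinuousWithinAt (fun z => f ((extChartAt I' x₀).symm z)) (Set.range I') y := by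
    refine hf.continuous.continuousAt.comp_continuousWithinAt ?_
    exact ((continuousOn_extChartAt_symm x₀) y hy).mono_of_mem_nhdsWithin
      (extChartAt_target_mem_nhdsWithin_of_mem hy)
  filter_upwards [extChartAt_target_mem_nhdsWithin_of_mem hy,
    hc (extChartAt_source_mem_nhds' hfy)] with w hw hfw
  exact chartRep_pullback α hw ((hf _).mdifferentiableAt (by simp)) hfw

theorem IsSmoothForm.pullback {k : ℕ} {α : DForm I M k} (hα : IsSmoothForm α) {f : N → M}
    (hf : ContMDiff I' I ∞ f) : IsSmoothForm (pullback f α : DForm I' N k) := by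
  intro x₀ y hy
  set y₀ := f ((extChartAt I' x₀).symm y) with hy₀
  have hfy : f ((extChartAt I' x₀).symm y) ∈ (extChartAt I y₀).source := mem_extChartAt_source _
  have hh := contDiffWithinAt_chart_comp hf hy hfy
  have hrange := extChartAt_target_subset_range x₀ hy
  refine ContDiffWithinAt.mono (s := Set.range I') ?_ (extChartAt_target_subset_range x₀)
  refine ContDiffWithinAt.congr_of_eventuallyEq_of_mem ?_
    (chartRep_pullback_eventuallyEq α hf hy hfy) hrange
  refine contDiffWithinAt_form_comp ?_
    (hh.fderivWithin_right (m := ∞) I'.uniqueDiffOn (by simp) hrange)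
  refine ContDiffWithinAt.comp y (t := Set.range I)
    (hα.contDiffWithinAt y₀ ((extChartAt I y₀).map_source hfy)) hh ?_
  intro z _
  exact Set.mem_range_self _

/-- Naturality of the exterior derivative on the model space, applied to the coordinate expression
of `f`. With `f` the identity it gives independence of the chart, and with matching charts it gives
naturality on manifolds. -/
theorem chartRep_extD_pullback_aux {k : ℕ} {α : DForm I M k} (hα : IsSmoothForm α) {f : N → M}
    (hf : ContMDiff I' I ∞ f) {x₀ : N} {y₀ : M}
    {y : EuclideanSpace ℝ (Fin m')} (hy : y ∈ (extChartAt I' x₀).target)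
    (hfy : f ((extChartAt I' x₀).symm y) ∈ (extChartAt I y₀).source) :
    extDerivWithin (chartRep (pullback f α : DForm I' N k) x₀) (Set.range I') y =
      (extDerivWithin (chartRep α y₀) (Set.range I)
        (extChartAt I y₀ (f ((extChartAt I' x₀).symm y)))).compContinuousLinearMap
        (fderivWithin ℝ (fun z => extChartAt I y₀ (f ((extChartAt I' x₀).symm z)))
          (Set.range I') y) := by
  have hrange := extChartAt_target_subset_range x₀ hy
  rw [(chartRep_pullback_eventuallyEq α hf hy hfy).extDerivWithin_eq_of_mem hrange]
  refine extDerivWithin_pullback (r := ∞)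
    (hα.differentiableWithinAt y₀ ((extChartAt I y₀).map_source hfy))
    (contDiffWithinAt_chart_comp hf hy hfy) ?_ I'.uniqueDiffOn
    (I'.range_subset_closure_interior hrange) hrange fun z _ => Set.mem_range_self _
  rw [minSmoothness_of_isRCLikeNormedField]
  exact WithTop.coe_le_coe.2 (le_top : (2 : ℕ∞) ≤ ⊤)

/-- The exterior derivative may be computed in any chart. -/
theorem chartRep_extD {k : ℕ} {α : DForm I M k} (hα : IsSmoothForm α) {x₀ : M}
    {y : EuclideanSpace ℝ (Fin m)} (hy : y ∈ (extChartAt I x₀).target) :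
    chartRep (extD α) x₀ y = extDerivWithin (chartRep α x₀) (Set.range I) y := by
  have : IsManifold I 1 M := IsManifold.of_le (n := ∞) (by norm_cast)
  set p := (extChartAt I x₀).symm y with hp
  -- The derivative at `p` is defined in the chart at `p`; the identity map is therefore read from
  -- the chart at `x₀` to that chart.
  have h := chartRep_extD_pullback_aux hα (contMDiff_id (M := M)) (y₀ := p) hy
    (mem_extChartAt_source p)
  have hid : (pullback id α : DForm I M k) = α := by
    funext x
    have : mfderiv I I (id : M → M) x = ContinuousLinearMap.id ℝ _ := mfderiv_id
    rw [DHCob.pullback, this]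
    rfl
  rw [hid] at h
  rw [h]
  have hφ : MDifferentiableAt I 𝓘(ℝ, EuclideanSpace ℝ (Fin m)) (extChartAt I p) p :=
    mdifferentiableAt_extChartAt (mem_chart_source H p)
  have h2 := (hasFDerivWithinAt_comp_extChartAt_symm (f := extChartAt I p) hy
    hφ).fderivWithin (I.uniqueDiffOn _ (extChartAt_target_subset_range x₀ hy))
  simp only [id] at h2 ⊢
  rw [h2]
  rfl

/-- The exterior derivative is natural. -/
theorem extD_pullback {k : ℕ} {α : DForm I M k} (hα : IsSmoothForm α) {f : N → M}
    (hf : ContMDiff I' I ∞ f) :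
    extD (pullback f α : DForm I' N k) = pullback f (extD α) := by
  funext x
  have hx : (extChartAt I' x).symm (extChartAt I' x x) = x := extChartAt_to_inv x
  have hy := mem_extChartAt_target (I := I') x
  have hfy : f ((extChartAt I' x).symm (extChartAt I' x x)) ∈ (extChartAt I (f x)).source := by
    rw [hx]; exact mem_extChartAt_source _
  rw [extD_eq, chartRep_extD_pullback_aux hα hf hy hfy, ← chartRep_self (pullback f (extD α)) x,
    chartRep_pullback (extD α) hy ((hf _).mdifferentiableAt (by simp)) hfy,
    chartRep_extD hα ((extChartAt I (f x)).map_source hfy)]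

end Naturality

end DHCob
end

noncomputable section

namespace DHCob

/-! ### Top-degree forms, orientation signs and change of variables. -/

section Determinants

variable {m : ℕ}

theorem form_comp_stdFrame (f : EuclideanSpace ℝ (Fin m) [⋀^Fin m]→L[ℝ] ℝ)
    (T : EuclideanSpace ℝ (Fin m) →L[ℝ] EuclideanSpace ℝ (Fin m)) :
    f (fun a => T (stdFrame m a)) = T.det * f (stdFrame m) := by
  have he : ∀ a, (EuclideanSpace.basisFun (Fin m) ℝ).toBasis a = stdFrame m a := fun a => by
    simp [stdFrame]
  have h := DFunLike.congr_fun (AlternatingMap.eq_smul_basis_det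
    (EuclideanSpace.basisFun (Fin m) ℝ).toBasis f.toAlternatingMap) (fun a => T (stdFrame m a))
  have h2 := (EuclideanSpace.basisFun (Fin m) ℝ).toBasis.det_comp
    (T : EuclideanSpace ℝ (Fin m) →ₗ[ℝ] EuclideanSpace ℝ (Fin m))
    (EuclideanSpace.basisFun (Fin m) ℝ).toBasis
  rw [Module.Basis.det_self, mul_one] at h2
  have h3 : ((T : EuclideanSpace ℝ (Fin m) →ₗ[ℝ] EuclideanSpace ℝ (Fin m)) ∘
      (EuclideanSpace.basisFun (Fin m) ℝ).toBasis) = fun a => T (stdFrame m a) :=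
    funext fun a => congrArg T (he a)
  have h4 : ((EuclideanSpace.basisFun (Fin m) ℝ).toBasis : Fin m → _) = stdFrame m := funext he
  rw [h3] at h2
  rw [AlternatingMap.smul_apply, h2, smul_eq_mul, h4, mul_comm] at h
  exact h

theorem form_eq_zero_of_stdFrame (f : EuclideanSpace ℝ (Fin m) [⋀^Fin m]→L[ℝ] ℝ)
    (h : f (stdFrame m) = 0) : f = 0 := by
  have he : ((EuclideanSpace.basisFun (Fin m) ℝ).toBasis : Fin m → _) = stdFrame m :=
    funext fun a => by simp [stdFrame]
  have h1 := (AlternatingMap.map_basis_eq_zero_iff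
    (EuclideanSpace.basisFun (Fin m) ℝ).toBasis f.toAlternatingMap).1 (by rw [he]; exact h)
  ext v
  exact DFunLike.congr_fun h1 v

theorem real_sign_mul (a b : ℝ) : Real.sign (a * b) = Real.sign a * Real.sign b := by
  rcases lt_trichotomy a 0 with ha | rfl | ha <;> rcases lt_trichotomy b 0 with hb | rfl | hb <;>
    simp [Real.sign_of_neg, Real.sign_of_pos, mul_pos_of_neg_of_neg, mul_neg_of_neg_of_pos,
      mul_neg_of_pos_of_neg, *]

theorem measurable_real_sign : Measurable Real.sign :=
  Measurable.ite measurableSet_Iio measurable_const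
    (Measurable.ite measurableSet_Ioi measurable_const measurable_const)

theorem abs_real_sign_le (a : ℝ) : |Real.sign a| ≤ 1 := by
  rcases Real.sign_apply_eq a with h | h | h <;> simp [h]

theorem sign_mul_self (a : ℝ) : Real.sign a * a = |a| := by
  rcases lt_trichotomy a 0 with ha | rfl | ha
  · rw [Real.sign_of_neg ha, abs_of_neg ha]; ring
  · simp
  · rw [Real.sign_of_pos ha, abs_of_pos ha]; ring

end Determinants

section Integral

open MeasureTheory

variable {m : ℕ} {H : Type*} [TopologicalSpace H]
  {I : ModelWithCorners ℝ (EuclideanSpace ℝ (Fin m)) H}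
  {M : Type*} [TopologicalSpace M] [ChartedSpace H M]

theorem measurableSet_extChartAt_target (x : M) : MeasurableSet (extChartAt I x).target := by
  rw [extChartAt_target]
  exact ((chartAt H x).open_target.preimage I.continuous_symm).measurableSet.inter
    I.isClosed_range.measurableSet

theorem measurableSet_preimage_extChartAt_symm (x : M) {U : Set M} (hU : IsOpen U) :
    MeasurableSet ((extChartAt I x).target ∩ (extChartAt I x).symm ⁻¹' U) := by
  obtain ⟨V, hV, h⟩ := (continuousOn_iff'.1 (continuousOn_extChartAt_symm (I := I) x)) U hU
  rw [Set.inter_comm, h]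
  exact hV.measurableSet.inter (measurableSet_extChartAt_target x)

theorem chartRep_eq_zero {k : ℕ} {μ : DForm I M k} {x : M} {y : EuclideanSpace ℝ (Fin m)}
    (h : μ ((extChartAt I x).symm y) = 0) : chartRep μ x y = 0 := by
  rw [chartRep, h]
  rfl

theorem contDiffOn_form_apply {k : ℕ} {μ : DForm I M k} (hμ : IsSmoothForm μ) (x : M)
    (v : Fin k → EuclideanSpace ℝ (Fin m)) :
    ContDiffOn ℝ ∞ (fun y => chartRep μ x y v) (extChartAt I x).target := fun y hy =>
  contDiffWithinAt_form_apply (hμ x y hy) fun _ => contDiffWithinAt_const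

theorem aestronglyMeasurable_sign {o : DForm I M m} (ho : IsSmoothForm o) (i : M) :
    AEStronglyMeasurable (fun y => Real.sign (chartRep o i y (stdFrame m)))
      (volume.restrict (extChartAt I i).target) := by
  have h := (contDiffOn_form_apply ho i (stdFrame m)).continuousOn.aestronglyMeasurable
    (μ := volume) (measurableSet_extChartAt_target i)
  exact (measurable_real_sign.comp_aemeasurable h.aemeasurable).aestronglyMeasurable

/-- The image of `L` in the chart is compact and carries the support of `g`; the orientation sign is
only a bounded measurable factor. -/
theorem integrableOn_sign_mul {o : DForm I M m} (ho : IsSmoothForm o) (i : M)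
    {g : EuclideanSpace ℝ (Fin m) → ℝ} (hg : ContinuousOn g (extChartAt I i).target)
    {L : Set M} (hL : IsCompact L) (hLi : L ⊆ (extChartAt I i).source)
    (h0 : ∀ y ∈ (extChartAt I i).target, (extChartAt I i).symm y ∉ L → g y = 0) :
    IntegrableOn (fun y => Real.sign (chartRep o i y (stdFrame m)) * g y)
      (extChartAt I i).target := by
  have hL' : IsCompact (extChartAt I i '' L) :=
    hL.image_of_continuousOn ((continuousOn_extChartAt i).mono hLi)
  have hsub : extChartAt I i '' L ⊆ (extChartAt I i).target := by
    rintro _ ⟨x, hx, rfl⟩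
    exact (extChartAt I i).map_source (hLi hx)
  have h1 : IntegrableOn g (extChartAt I i).target := by
    refine ((hg.mono hsub).integrableOn_compact hL').of_forall_sdiff_eq_zero
      (measurableSet_extChartAt_target i) ?_
    rintro y ⟨hy, hyL⟩
    refine h0 y hy fun hmem => hyL ⟨_, hmem, (extChartAt I i).right_inv hy⟩
  exact Integrable.bdd_mul h1 (aestronglyMeasurable_sign ho i)
    (Filter.Eventually.of_forall fun y => by rw [Real.norm_eq_abs]; exact abs_real_sign_le _)

variable [IsManifold I ∞ M] [T2Space M] [SecondCountableTopology M]

/-- The integrand of the `i`-th summand in the definition of the integral. -/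
def chartIntegrand (o μ : DForm I M m) (i : M) (y : EuclideanSpace ℝ (Fin m)) : ℝ :=
  Real.sign (chartRep o i y (stdFrame m)) *
    (chartPartition I M i ((extChartAt I i).symm y) * chartRep μ i y (stdFrame m))

theorem tsupport_chartPartition_subset (i : M) :
    tsupport (chartPartition I M i) ⊆ (extChartAt I i).source := by
  rw [extChartAt_source]
  exact chartPartition_isSubordinate I M i

theorem integrableOn_chartIntegrand {o μ : DForm I M m} (ho : IsSmoothForm o)
    (hμ : IsSmoothForm μ) {K : Set M} (hK : IsCompact K) (h0 : ∀ x ∉ K, μ x = 0) (i : M) :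
    IntegrableOn (chartIntegrand o μ i) (extChartAt I i).target := by
  refine integrableOn_sign_mul ho i (L := K ∩ tsupport (chartPartition I M i)) ?_
    (hK.inter_right (isClosed_tsupport _))
    (Set.inter_subset_right.trans (tsupport_chartPartition_subset i)) ?_
  · exact (contDiffOn_comp_extChartAt_symm (chartPartition I M i).contMDiff i).continuousOn.mul
      (contDiffOn_form_apply hμ i _).continuousOn
  · intro y _ hyL
    by_cases h : (extChartAt I i).symm y ∈ K
    · have : chartPartition I M i ((extChartAt I i).symm y) = 0 :=
        image_eq_zero_of_notMem_tsupport fun h' => hyL ⟨h, h'⟩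
      rw [this, zero_mul]
    · rw [chartRep_eq_zero (h0 _ h)]
      exact mul_zero _

theorem finite_chartPartition {K : Set M} (hK : IsCompact K) :
    {i | (Function.support (chartPartition I M i) ∩ K).Nonempty}.Finite :=
  (chartPartition I M).locallyFinite.finite_nonempty_inter_compact hK

theorem sum_chartPartition {K : Set M} (hK : IsCompact K) {x : M} (hx : x ∈ K) :
    ∑ i ∈ (finite_chartPartition (I := I) hK).toFinset, chartPartition I M i x = 1 := by
  rw [← (chartPartition I M).sum_eq_one (Set.mem_univ x)]
  refine (finsum_eq_sum_of_support_subset _ fun i hi => ?_).symm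
  simp only [Set.Finite.coe_toFinset, Set.mem_ofPred_eq]
  exact ⟨x, hi, hx⟩

theorem integral_eq_sum (o : DForm I M m) {μ : DForm I M m} {K : Set M} (hK : IsCompact K)
    (h0 : ∀ x ∉ K, μ x = 0) :
    integral o μ = ∑ i ∈ (finite_chartPartition (I := I) hK).toFinset,
      ∫ y in (extChartAt I i).target, chartIntegrand o μ i y := by
  refine finsum_eq_sum_of_support_subset _ fun i hi => ?_
  simp only [Set.Finite.coe_toFinset, Set.mem_ofPred_eq]
  by_contra hne
  refine hi (integral_eq_zero_of_ae (Filter.Eventually.of_forall fun y => ?_))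
  by_cases h : (extChartAt I i).symm y ∈ K
  · have : chartPartition I M i ((extChartAt I i).symm y) = 0 := by
      by_contra h'
      exact hne ⟨_, h', h⟩
    simp only [this, zero_mul, mul_zero, Pi.zero_apply]
  · simp only [chartRep_eq_zero (h0 _ h)]
    change _ * (_ * (0 : ℝ)) = 0
    simp

/-- The common compact set `K` provides one finite set of charts that serves all summands. -/
theorem integral_sum_forms {o : DForm I M m} (ho : IsSmoothForm o) {ι : Type*} (s : Finset ι)
    {μ : ι → DForm I M m} (hμ : ∀ j ∈ s, IsSmoothForm (μ j)) {K : Set M} (hK : IsCompact K)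
    (h0 : ∀ j ∈ s, ∀ x ∉ K, μ j x = 0) :
    integral o (∑ j ∈ s, μ j) = ∑ j ∈ s, integral o (μ j) := by
  have h0' : ∀ x ∉ K, (∑ j ∈ s, μ j) x = 0 := fun x hx => by
    rw [Finset.sum_apply]
    exact Finset.sum_eq_zero fun j hj => h0 j hj x hx
  rw [integral_eq_sum o hK h0', Finset.sum_congr rfl fun j hj => integral_eq_sum o hK (h0 j hj),
    Finset.sum_comm]
  refine Finset.sum_congr rfl fun i _ => ?_
  rw [← integral_finsetSum s fun j hj => integrableOn_chartIntegrand ho (hμ j hj) hK (h0 j hj) i]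
  refine integral_congr_ae (Filter.Eventually.of_forall fun y => ?_)
  have h : chartRep (∑ j ∈ s, μ j) i y = ∑ j ∈ s, chartRep (μ j) i y :=
    map_sum (chartRepL (I := I) (k := m) i y) μ s
  simp only [chartIntegrand, h, ContinuousAlternatingMap.sum_apply, Finset.mul_sum]

theorem integral_neg_orientation (o μ : DForm I M m) : integral (-o) μ = -integral o μ := by
  rw [DHCob.integral, DHCob.integral, ← finsum_neg_distrib]
  refine finsum_congr fun i => ?_
  rw [← MeasureTheory.integral_neg]
  refine integral_congr_ae (Filter.Eventually.of_forall fun y => ?_)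
  have h : chartRep (-o) i y = -chartRep o i y := map_neg (chartRepL (I := I) (k := m) i y) o
  simp only [h, ContinuousAlternatingMap.neg_apply, Real.sign_neg, neg_mul]

/-- Change of variables: the integral of a form supported in the domain `U` of an injective
differentiable map `χ` to `ℝᵐ` such that on `U` the form is the pullback of `γ` and the
orientation is the pullback of the orientation given by `θ`. -/
theorem integral_eq_setIntegral_image {o μ : DForm I M m} (ho : IsSmoothForm o)
    (hμ : IsSmoothForm μ) {U K : Set M} (hU : IsOpen U) (hK : IsCompact K) (hKU : K ⊆ U)
    (h0 : ∀ x ∉ K, μ x = 0) {χ : M → EuclideanSpace ℝ (Fin m)} (hχ : Set.InjOn χ U)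
    (hd : ∀ x ∈ U, MDifferentiableAt I 𝓘(ℝ, EuclideanSpace ℝ (Fin m)) χ x)
    (hmeas : MeasurableSet (χ '' U))
    (γ θ : EuclideanSpace ℝ (Fin m) → EuclideanSpace ℝ (Fin m) [⋀^Fin m]→L[ℝ] ℝ)
    (hγ : ∀ x ∈ U, μ x = (γ (χ x)).compContinuousLinearMap
      (mfderiv I 𝓘(ℝ, EuclideanSpace ℝ (Fin m)) χ x))
    (hθ : ∀ x ∈ U, ∀ v, Real.sign (o x v) = Real.sign (((θ (χ x)).compContinuousLinearMap
      (mfderiv I 𝓘(ℝ, EuclideanSpace ℝ (Fin m)) χ x)) v))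
    (hγ0 : ∀ x ∈ U, x ∉ K → γ (χ x) = 0) :
    IntegrableOn (fun z => Real.sign (θ z (stdFrame m)) * γ z (stdFrame m)) (χ '' U) ∧
      integral o μ = ∫ z in χ '' U, Real.sign (θ z (stdFrame m)) * γ z (stdFrame m) := by
  rcases isEmpty_or_nonempty M with hM | hM
  · rw [DHCob.integral, finsum_of_isEmpty, Set.eq_empty_of_isEmpty U, Set.image_empty,
      setIntegral_empty]
    exact ⟨integrableOn_empty, rfl⟩
  -- The partition function `ρᵢ`, transported to `χ '' U` by the inverse of `χ` on `U`; the summand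
  -- of the chart at `i` becomes the integral of `h i`.
  let h : M → EuclideanSpace ℝ (Fin m) → ℝ := fun i z =>
    Real.sign (θ z (stdFrame m)) *
      (chartPartition I M i (Function.invFunOn χ U z) * γ z (stdFrame m))
  have hinv : ∀ x ∈ U, Function.invFunOn χ U (χ x) = x := fun x hx => hχ.leftInvOn_invFunOn hx
  have key : ∀ i, IntegrableOn (h i) (χ '' U) ∧
      ∫ y in (extChartAt I i).target, chartIntegrand o μ i y = ∫ z in χ '' U, h i z := by
    intro i
    set S := (extChartAt I i).target ∩ (extChartAt I i).symm ⁻¹' U with hS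
    have hSm : MeasurableSet S := measurableSet_preimage_extChartAt_symm i hU
    set g : EuclideanSpace ℝ (Fin m) → EuclideanSpace ℝ (Fin m) :=
      fun y => χ ((extChartAt I i).symm y) with hg
    let g' : EuclideanSpace ℝ (Fin m) → EuclideanSpace ℝ (Fin m) →L[ℝ] EuclideanSpace ℝ (Fin m) :=
      fun y => (mfderiv I 𝓘(ℝ, EuclideanSpace ℝ (Fin m)) χ ((extChartAt I i).symm y)).comp
        (mfderivWithin 𝓘(ℝ, EuclideanSpace ℝ (Fin m)) I (extChartAt I i).symm (Set.range I) y)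
    have hg' : ∀ y ∈ S, HasFDerivWithinAt g (g' y) S y := fun y hy =>
      (hasFDerivWithinAt_comp_extChartAt_symm hy.1 (hd _ hy.2)).mono
        (Set.inter_subset_left.trans (extChartAt_target_subset_range i))
    have hinj : Set.InjOn g S := fun y hy z hz hyz =>
      (extChartAt I i).symm.injOn hy.1 hz.1 (hχ hy.2 hz.2 hyz)
    have himg : g '' S ⊆ χ '' U := by
      rintro _ ⟨y, hy, rfl⟩
      exact ⟨_, hy.2, rfl⟩
    have hpt : ∀ y ∈ S, chartIntegrand o μ i y = |(g' y).det| • h i (g y) := by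
      intro y hy
      have h1 : chartRep μ i y (stdFrame m) = (g' y).det * γ (g y) (stdFrame m) := by
        rw [← form_comp_stdFrame]
        exact DFunLike.congr_fun (congrArg (fun α : EuclideanSpace ℝ (Fin m) [⋀^Fin m]→L[ℝ] ℝ =>
          α.compContinuousLinearMap (mfderivWithin 𝓘(ℝ, EuclideanSpace ℝ (Fin m)) I
            (extChartAt I i).symm (Set.range I) y)) (hγ _ hy.2)) (stdFrame m)
      have h2 : Real.sign (chartRep o i y (stdFrame m)) =
          Real.sign ((g' y).det * θ (g y) (stdFrame m)) := by
        rw [← form_comp_stdFrame]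
        exact hθ _ hy.2 _
      -- The form contributes the determinant and the orientation its sign; together they are the
      -- absolute value in the change of variables formula.
      rw [chartIntegrand, h1, h2, real_sign_mul, ← sign_mul_self]
      simp only [h, hg, hinv _ hy.2, smul_eq_mul]
      ring
    -- Chart points outside `U` do not matter because the form is supported in `K ⊆ U`.
    have hout : ∀ y ∈ (extChartAt I i).target \ S, chartIntegrand o μ i y = 0 := by
      rintro y ⟨hy, hyS⟩
      have : (extChartAt I i).symm y ∉ K := fun hK' => hyS ⟨hy, hKU hK'⟩
      rw [chartIntegrand, chartRep_eq_zero (h0 _ this)]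
      change _ * (_ * (0 : ℝ)) = 0
      simp
    -- Points of `U` outside the domain of the chart at `i` do not matter because `ρᵢ` vanishes
    -- there.
    have hout' : ∀ z ∈ χ '' U \ g '' S, h i z = 0 := by
      rintro _ ⟨⟨x, hx, rfl⟩, hxS⟩
      have : x ∉ (extChartAt I i).source := fun hxi =>
        hxS ⟨extChartAt I i x, ⟨(extChartAt I i).map_source hxi, by
          rw [Set.mem_preimage, (extChartAt I i).left_inv hxi]; exact hx⟩, by
          rw [hg]; simp only [(extChartAt I i).left_inv hxi]⟩
      have hρ : chartPartition I M i x = 0 :=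
        image_eq_zero_of_notMem_tsupport fun h' => this (tsupport_chartPartition_subset i h')
      simp [h, hinv x hx, hρ]
    have hint : IntegrableOn (h i) (g '' S) := by
      rw [integrableOn_image_iff_integrableOn_abs_det_fderiv_smul volume hSm hg' hinj]
      refine IntegrableOn.congr_fun ?_ hpt hSm
      exact (integrableOn_chartIntegrand ho hμ hK h0 i).mono_set Set.inter_subset_left
    refine ⟨hint.of_forall_sdiff_eq_zero hmeas hout', ?_⟩
    rw [setIntegral_eq_of_subset_of_forall_sdiff_eq_zero (measurableSet_extChartAt_target i)
      Set.inter_subset_left hout, setIntegral_congr_fun hSm hpt,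
      ← integral_image_eq_integral_abs_det_fderiv_smul volume hSm hg' hinj,
      setIntegral_eq_of_subset_of_forall_sdiff_eq_zero hmeas himg hout']
  -- The functions `ρᵢ` add up to `1` on `K`, and off `K` the form `γ` vanishes, so no partition of
  -- unity remains.
  have hsum : Set.EqOn (fun z => ∑ i ∈ (finite_chartPartition (I := I) hK).toFinset, h i z)
      (fun z => Real.sign (θ z (stdFrame m)) * γ z (stdFrame m)) (χ '' U) := by
    rintro _ ⟨x, hx, rfl⟩
    simp only [h, hinv x hx, ← Finset.mul_sum, ← Finset.sum_mul]
    by_cases hxK : x ∈ K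
    · rw [sum_chartPartition hK hxK, one_mul]
    · simp [hγ0 x hx hxK]
  refine ⟨IntegrableOn.congr_fun (integrable_finsetSum _ fun i _ => (key i).1) hsum hmeas, ?_⟩
  rw [integral_eq_sum o hK h0, Finset.sum_congr rfl fun i _ => (key i).2,
    ← integral_finsetSum _ fun i _ => (key i).1]
  exact setIntegral_congr_fun hmeas hsum

end Integral

end DHCob
end

noncomputable section

namespace DHCob

/-! ### Stokes' theorem on a half space and in a chart. -/

section HalfSpace

open MeasureTheory

variable {m : ℕ}

/-- The half space `{y₀ ≥ 0}`. -/
abbrev halfSpace (m : ℕ) : Set (EuclideanSpace ℝ (Fin (m + 1))) := {y | 0 ≤ y 0}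

/-- The inclusion of `ℝᵐ` as the boundary hyperplane `{y₀ = 0}`. -/
def bdryIncl (m : ℕ) : EuclideanSpace ℝ (Fin m) →L[ℝ] EuclideanSpace ℝ (Fin (m + 1)) :=
  LinearMap.toContinuousLinearMap
    { toFun := fun y => WithLp.toLp 2 (Fin.cons 0 y.ofLp)
      map_add' := fun x y => by
        ext a
        refine Fin.cases ?_ (fun b => ?_) a <;> simp
      map_smul' := fun c y => by
        ext a
        refine Fin.cases ?_ (fun b => ?_) a <;> simp }

/-- The projection `ℝᵐ⁺¹ → ℝᵐ` forgetting `y₀`. -/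
def bdryProj (m : ℕ) : EuclideanSpace ℝ (Fin (m + 1)) →L[ℝ] EuclideanSpace ℝ (Fin m) :=
  LinearMap.toContinuousLinearMap
    { toFun := fun y => WithLp.toLp 2 (fun a => y a.succ)
      map_add' := fun _ _ => rfl
      map_smul' := fun _ _ => rfl }

@[simp] theorem bdryIncl_zero_coord (y : EuclideanSpace ℝ (Fin m)) : bdryIncl m y 0 = 0 := rfl

@[simp] theorem bdryIncl_succ_coord (y : EuclideanSpace ℝ (Fin m)) (a : Fin m) :
    bdryIncl m y a.succ = y a := rfl

@[simp] theorem bdryProj_coord (y : EuclideanSpace ℝ (Fin (m + 1))) (a : Fin m) :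
    bdryProj m y a = y a.succ := rfl

theorem bdryProj_bdryIncl (y : EuclideanSpace ℝ (Fin m)) : bdryProj m (bdryIncl m y) = y := rfl

theorem bdryIncl_bdryProj {y : EuclideanSpace ℝ (Fin (m + 1))} (h : y 0 = 0) :
    bdryIncl m (bdryProj m y) = y := by
  ext a
  refine Fin.cases ?_ (fun b => ?_) a
  · rw [bdryIncl_zero_coord, h]
  · simp

theorem uniqueDiffOn_halfSpace : UniqueDiffOn ℝ (halfSpace m) := by
  have h := (𝓡∂ (m + 1)).uniqueDiffOn
  rwa [range_modelWithCornersEuclideanHalfSpace] at h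

theorem measurableSet_halfSpace : MeasurableSet (halfSpace m) :=
  (isClosed_le continuous_const (by fun_prop)).measurableSet

/-- The divergence theorem on a half space, for compactly supported functions. -/
theorem setIntegral_divergence_halfSpace
    (f : Fin (m + 1) → EuclideanSpace ℝ (Fin (m + 1)) → ℝ)
    (hf : ∀ a, ContDiffOn ℝ 1 (f a) (halfSpace m)) {C : Set (EuclideanSpace ℝ (Fin (m + 1)))}
    (hC : IsCompact C) (h0 : ∀ a, ∀ y ∈ halfSpace m, y ∉ C → f a y = 0) :
    ∫ y in halfSpace m, ∑ a, fderivWithin ℝ (f a) (halfSpace m) y (EuclideanSpace.single a 1) =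
      -∫ y, f 0 (bdryIncl m y) := by
  set D : EuclideanSpace ℝ (Fin (m + 1)) → ℝ := fun y =>
    ∑ a, fderivWithin ℝ (f a) (halfSpace m) y (EuclideanSpace.single a 1) with hD
  have hD0 : ∀ y ∈ halfSpace m, y ∉ C → D y = 0 := by
    intro y hy hyC
    refine Finset.sum_eq_zero fun a _ => ?_
    have hev : f a =ᶠ[nhdsWithin y (halfSpace m)] fun _ => 0 := by
      filter_upwards [self_mem_nhdsWithin,
        mem_nhdsWithin_of_mem_nhds (hC.isClosed.isOpen_compl.mem_nhds hyC)] with z hz hzC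
      exact h0 a z hz hzC
    rw [hev.fderivWithin_eq (h0 a y hy hyC)]
    simp
  have hDc : ContinuousOn D (halfSpace m) := continuousOn_finsetSum _ fun a _ =>
    ((hf a).continuousOn_fderivWithin uniqueDiffOn_halfSpace le_rfl).clm_apply continuousOn_const
  obtain ⟨R, hR0, hR⟩ : ∃ R : ℝ, 0 < R ∧ ∀ y ∈ C, ∀ a, |y a| < R := by
    obtain ⟨R, hR⟩ := hC.isBounded.exists_norm_le
    refine ⟨max R 0 + 1, by positivity, fun y hy a => ?_⟩
    have h1 := EuclideanSpace.norm_eq y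
    have h2 : |y a| ≤ ‖y‖ := by simpa using PiLp.norm_apply_le y a
    have h3 := hR y hy
    have h4 := le_max_left R 0
    linarith
  let T := (EuclideanSpace.equiv (Fin (m + 1)) ℝ).symm
  have hT : MeasurePreserving T := PiLp.volume_preserving_toLp _
  have hTe : MeasurableEmbedding T := T.toHomeomorph.measurableEmbedding
  -- The box `[0, R] × [-R, R]ᵐ`. Only its face in the hyperplane `y₀ = 0` meets the support, and as
  -- a lower face it enters with a minus sign.
  let lo : Fin (m + 1) → ℝ := Fin.cons 0 fun _ => -R
  let hi : Fin (m + 1) → ℝ := fun _ => R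
  have hle : lo ≤ hi := fun a => by
    refine Fin.cases ?_ (fun b => ?_) a
    · exact hR0.le
    · change -R ≤ R
      linarith
  have hbox : ∀ x ∈ Set.Icc lo hi, T x ∈ halfSpace m := fun x hx => hx.1 0
  have hdiv := integral_divergence_of_hasFDerivAt_off_countable' lo hi hle
    (fun a x => f a (T x))
    (fun a x => (fderivWithin ℝ (f a) (halfSpace m) (T x)).comp (T : (Fin (m + 1) → ℝ) →L[ℝ] _)) ∅
    Set.countable_empty
    (fun a => (hf a).continuousOn.comp T.continuous.continuousOn hbox)
    (by
      rintro x ⟨hx, -⟩ a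
      have hx0 : 0 < x 0 := (hx 0 trivial).1
      have hmem : halfSpace m ∈ nhds (T x) := by
        have : IsOpen {y : EuclideanSpace ℝ (Fin (m + 1)) | 0 < y 0} :=
          isOpen_lt continuous_const (by fun_prop)
        exact Filter.mem_of_superset (this.mem_nhds hx0)
          fun y (hy : 0 < y 0) => (le_of_lt hy : 0 ≤ y 0)
      have hd := (((hf a).differentiableOn one_ne_zero) (T x)
        (show 0 ≤ x 0 from hx0.le)).hasFDerivWithinAt.hasFDerivAt hmem
      exact hd.comp x T.hasFDerivAt)
    (by
      refine ContinuousOn.integrableOn_Icc ?_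
      exact hDc.comp T.continuous.continuousOn hbox)
  have hsingle : ∀ a : Fin (m + 1), T (Pi.single a 1) = EuclideanSpace.single a (1 : ℝ) :=
    fun a => rfl
  have hlhs : (∫ x in Set.Icc lo hi, ∑ a, ((fderivWithin ℝ (f a) (halfSpace m) (T x)).comp
      (T : (Fin (m + 1) → ℝ) →L[ℝ] _)) (Pi.single a 1)) = ∫ y in halfSpace m, D y := by
    have h1 : ∫ y in halfSpace m, D y = ∫ y in T '' Set.Icc lo hi, D y := by
      refine setIntegral_eq_of_subset_of_forall_sdiff_eq_zero measurableSet_halfSpace ?_ ?_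
      · rintro _ ⟨x, hx, rfl⟩
        exact hbox x hx
      · rintro y ⟨hy, hyb⟩
        refine hD0 y hy fun hyC => hyb ⟨y.ofLp, ⟨fun a => ?_, fun a => ?_⟩, rfl⟩
        · refine Fin.cases ?_ (fun b => ?_) a
          · exact hy
          · exact (abs_lt.1 (hR y hyC b.succ)).1.le
        · exact (abs_lt.1 (hR y hyC a)).2.le
    rw [h1, hT.setIntegral_image_emb hTe]
    rfl
  rw [hlhs] at hdiv
  rw [hdiv, Fin.sum_univ_succ]
  have hz : ∀ (a : Fin (m + 1)) (x : Fin (m + 1) → ℝ), T x ∈ halfSpace m → R ≤ |x a| →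
      ∀ c, f c (T x) = 0 := fun a x hx hxa c =>
    h0 c _ hx fun hmem => absurd (hR _ hmem a) (not_lt.2 hxa)
  have hup : ∀ (x : Fin m → ℝ), f 0 (T ((0 : Fin (m + 1)).insertNth (hi 0) x)) = 0 := by
    intro x
    refine hz 0 _ ?_ ?_ 0
    · change 0 ≤ (0 : Fin (m + 1)).insertNth (α := fun _ => ℝ) (hi 0) x 0
      simp only [Fin.insertNth_apply_same]
      exact hR0.le
    · simp only [Fin.insertNth_apply_same]
      exact le_abs_self R
  -- On a side face the coordinate `0` is still that of `x`, hence nonnegative, so the point lies in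
  -- the half space where vanishing is known.
  have hside : ∀ b : Fin m, ∀ c : ℝ, |c| = R → ∀ x ∈ Set.Icc (lo ∘ b.succ.succAbove)
      (hi ∘ b.succ.succAbove), f b.succ (T (b.succ.insertNth c x)) = 0 := by
    intro b c hc x hx
    refine hz b.succ _ ?_ ?_ _
    · cases m with
      | zero => exact b.elim0
      | succ n =>
        change 0 ≤ b.succ.insertNth (α := fun _ => ℝ) c x 0
        have h2 := hx.1 0
        have h3 : b.succ.succAbove 0 = 0 := Fin.succ_succAbove_zero b
        have h4 : b.succ.insertNth (α := fun _ => ℝ) c x 0 = x 0 := by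
          conv_lhs => rw [← h3]
          exact Fin.insertNth_apply_succAbove _ _ _ _
        rw [h4]
        simpa [h3, lo] using h2
    · simp only [Fin.insertNth_apply_same]
      exact hc.ge
  have hsum : ∑ b : Fin m, ((∫ x in Set.Icc (lo ∘ b.succ.succAbove) (hi ∘ b.succ.succAbove),
        f b.succ (T (b.succ.insertNth (hi b.succ) x))) -
      ∫ x in Set.Icc (lo ∘ b.succ.succAbove) (hi ∘ b.succ.succAbove),
        f b.succ (T (b.succ.insertNth (lo b.succ) x))) = 0 := by
    refine Finset.sum_eq_zero fun b _ => ?_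
    rw [setIntegral_eq_zero_of_forall_eq_zero (hside b _ (abs_of_pos hR0)),
      setIntegral_eq_zero_of_forall_eq_zero (hside b _ (by
        change |-R| = R
        rw [abs_neg, abs_of_pos hR0])), sub_zero]
  rw [hsum, add_zero]
  simp only [hup, MeasureTheory.integral_zero, zero_sub]
  congr 1
  let T' := (EuclideanSpace.equiv (Fin m) ℝ).symm
  have hT' : MeasurePreserving T' := PiLp.volume_preserving_toLp _
  rw [← hT'.integral_comp T'.toHomeomorph.measurableEmbedding (fun y => f 0 (bdryIncl m y)),
    ← setIntegral_univ (f := fun x => f 0 (bdryIncl m (T' x)))]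
  have hins : ∀ x : Fin m → ℝ, T ((0 : Fin (m + 1)).insertNth (lo 0) x) = bdryIncl m (T' x) := by
    intro x
    rw [Fin.insertNth_zero]
    rfl
  simp only [hins]
  symm
  refine setIntegral_eq_of_subset_of_forall_sdiff_eq_zero MeasurableSet.univ
    (Set.subset_univ _) ?_
  rintro x ⟨-, hx⟩
  refine h0 0 _ (show (0 : ℝ) ≤ 0 from le_rfl) fun hmem => hx ⟨fun b => ?_, fun b => ?_⟩
  · exact (abs_lt.1 (hR _ hmem b.succ)).1.le
  · exact (abs_lt.1 (hR _ hmem b.succ)).2.le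

end HalfSpace

section Nonvanishing

variable {m : ℕ} {H : Type*} [TopologicalSpace H]
  {I : ModelWithCorners ℝ (EuclideanSpace ℝ (Fin m)) H}
  {M : Type*} [TopologicalSpace M] [ChartedSpace H M] [IsManifold I ∞ M]

theorem IsOrientationForm.chartRep_ne_zero {o : DForm I M m} (ho : IsOrientationForm o) (i : M)
    {y : EuclideanSpace ℝ (Fin m)} (hy : y ∈ (extChartAt I i).target) :
    chartRep o i y (stdFrame m) ≠ 0 := by
  intro h
  have h1 := form_eq_zero_of_stdFrame _ h
  refine ho.ne_zero ((extChartAt I i).symm y) ?_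
  rw [eq_chartRep_comp_mfderiv o ((extChartAt I i).map_target hy), (extChartAt I i).right_inv hy,
    h1]
  rfl

/-- A continuous nowhere vanishing coefficient keeps its sign locally, so the discontinuous function
`Real.sign` acts as a constant when differentiating. -/
theorem IsOrientationForm.eventually_sign_eq {o : DForm I M m} (ho : IsOrientationForm o) (i : M)
    {y : EuclideanSpace ℝ (Fin m)} (hy : y ∈ (extChartAt I i).target) :
    ∀ᶠ z in nhdsWithin y (Set.range I), Real.sign (chartRep o i z (stdFrame m)) =
      Real.sign (chartRep o i y (stdFrame m)) := by
  have hc : ContinuousWithinAt (fun z => chartRep o i z (stdFrame m)) (Set.range I) y :=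
    (contDiffWithinAt_form_apply (w := fun _ => stdFrame m) (ho.smooth.contDiffWithinAt i hy)
      fun _ => contDiffWithinAt_const).continuousWithinAt
  rcases lt_or_gt_of_ne (ho.chartRep_ne_zero i hy) with h | h
  · filter_upwards [hc (Iio_mem_nhds h)] with z hz
    rw [Real.sign_of_neg h, Real.sign_of_neg hz]
  · filter_upwards [hc (Ioi_mem_nhds h)] with z hz
    rw [Real.sign_of_pos h, Real.sign_of_pos hz]

end Nonvanishing

section ChartStokes

open MeasureTheory

variable {m : ℕ} {W : Type*} [TopologicalSpace W] [ChartedSpace (EuclideanHalfSpace (m + 1)) W]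

theorem extChartAt_target_subset_halfSpace (i : W) :
    (extChartAt (𝓡∂ (m + 1)) i).target ⊆ halfSpace m := by
  have h := extChartAt_target_subset_range (I := 𝓡∂ (m + 1)) i
  rwa [range_modelWithCornersEuclideanHalfSpace] at h

theorem stdFrame_removeNth_zero :
    (0 : Fin (m + 1)).removeNth (stdFrame (m + 1)) = fun a => bdryIncl m (stdFrame m a) := by
  funext a
  ext c
  refine Fin.cases ?_ (fun b => ?_) c
  · simp [Fin.removeNth, stdFrame]
  · simp [Fin.removeNth, stdFrame]

variable [IsManifold (𝓡∂ (m + 1)) ∞ W]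

/-- Stokes' theorem for a form supported in the domain of a chart. -/
theorem setIntegral_extDerivWithin_chart {o : DForm (𝓡∂ (m + 1)) W (m + 1)}
    (ho : IsOrientationForm o) {ν : DForm (𝓡∂ (m + 1)) W m} (hν : IsSmoothForm ν) (i : W)
    {L : Set W} (hL : IsCompact L) (hLi : L ⊆ (extChartAt (𝓡∂ (m + 1)) i).source)
    (h0 : ∀ x ∉ L, ν x = 0) :
    ∫ y in (extChartAt (𝓡∂ (m + 1)) i).target, Real.sign (chartRep o i y (stdFrame (m + 1))) *
        extDerivWithin (chartRep ν i) (Set.range (𝓡∂ (m + 1))) y (stdFrame (m + 1)) =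
      -∫ y in bdryIncl m ⁻¹' (extChartAt (𝓡∂ (m + 1)) i).target,
        Real.sign (chartRep o i (bdryIncl m y) (stdFrame (m + 1))) *
          chartRep ν i (bdryIncl m y) (fun a => bdryIncl m (stdFrame m a)) := by
  classical
  have hrange : Set.range (𝓡∂ (m + 1)) = halfSpace m := range_modelWithCornersEuclideanHalfSpace _
  set t := (extChartAt (𝓡∂ (m + 1)) i).target with ht
  have htm : MeasurableSet t := measurableSet_extChartAt_target i
  let g : Fin (m + 1) → EuclideanSpace ℝ (Fin (m + 1)) → ℝ := fun a y =>
    chartRep ν i y (a.removeNth (stdFrame (m + 1)))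
  -- The vector field whose divergence is the coefficient of `dν` times the orientation sign,
  -- extended by zero. The extension is smooth on the half space because the support is compact
  -- inside the chart target.
  let f : Fin (m + 1) → EuclideanSpace ℝ (Fin (m + 1)) → ℝ := fun a => t.indicator fun y =>
    (-1) ^ a.val * Real.sign (chartRep o i y (stdFrame (m + 1))) * g a y
  let C := extChartAt (𝓡∂ (m + 1)) i '' L
  have hC : IsCompact C := hL.image_of_continuousOn ((continuousOn_extChartAt i).mono hLi)
  have hCt : C ⊆ t := by
    rintro _ ⟨x, hx, rfl⟩
    exact (extChartAt (𝓡∂ (m + 1)) i).map_source (hLi hx)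
  have hf0 : ∀ a y, y ∉ C → f a y = 0 := by
    intro a y hy
    by_cases hyt : y ∈ t
    · have : chartRep ν i y = 0 := chartRep_eq_zero (h0 _ fun hm =>
        hy ⟨_, hm, (extChartAt (𝓡∂ (m + 1)) i).right_inv hyt⟩)
      simp only [f, Set.indicator_of_mem hyt, g, this]
      exact mul_zero _
    · exact Set.indicator_of_notMem hyt _
  have hg : ∀ a, ∀ y ∈ t, ContDiffWithinAt ℝ ∞ (g a) (halfSpace m) y := fun a y hy =>
    hrange ▸ contDiffWithinAt_form_apply (hν.contDiffWithinAt i hy) fun _ => contDiffWithinAt_const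
  have hev : ∀ a, ∀ y ∈ t, f a =ᶠ[nhdsWithin y (halfSpace m)] fun z =>
      ((-1) ^ a.val * Real.sign (chartRep o i y (stdFrame (m + 1)))) * g a z := by
    intro a y hy
    have h1 := ho.eventually_sign_eq i hy
    have h2 := extChartAt_target_mem_nhdsWithin_of_mem (I := 𝓡∂ (m + 1)) hy
    rw [hrange] at h1 h2
    filter_upwards [h1, h2] with z hz hzt
    change t.indicator _ z = _
    rw [Set.indicator_of_mem (show z ∈ t from hzt), hz]
  have hev0 : ∀ a, ∀ y ∉ t, f a =ᶠ[nhdsWithin y (halfSpace m)] fun _ => 0 := by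
    intro a y hy
    filter_upwards [mem_nhdsWithin_of_mem_nhds
      (hC.isClosed.isOpen_compl.mem_nhds fun h => hy (hCt h))] with z hz
    exact hf0 a z hz
  have hf : ∀ a, ContDiffOn ℝ 1 (f a) (halfSpace m) := by
    intro a y hy
    by_cases hyt : y ∈ t
    · refine ContDiffWithinAt.congr_of_eventuallyEq_of_mem ?_ (hev a y hyt) hy
      exact contDiffWithinAt_const.mul ((hg a y hyt).of_le (by norm_cast))
    · exact contDiffWithinAt_const.congr_of_eventuallyEq_of_mem (hev0 a y hyt) hy
  have hdiv := setIntegral_divergence_halfSpace f hf hC fun a y _ => hf0 a y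
  rw [setIntegral_eq_of_subset_of_forall_sdiff_eq_zero measurableSet_halfSpace
    (extChartAt_target_subset_halfSpace i) fun y hy => Finset.sum_eq_zero fun a _ => by
      rw [(hev0 a y hy.2).fderivWithin_eq (Set.indicator_of_notMem hy.2 _), fderivWithin_fun_const]; rfl] at hdiv
  rw [← setIntegral_congr_fun htm (f := fun y => ∑ a, fderivWithin ℝ (f a) (halfSpace m) y
    (EuclideanSpace.single a 1)), hdiv, ← integral_indicator
      ((bdryIncl m).continuous.measurable htm)]
  · congr 1
    refine integral_congr_ae (Filter.Eventually.of_forall fun y => ?_)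
    by_cases hy : bdryIncl m y ∈ t
    · have hy' : y ∈ bdryIncl m ⁻¹' t := hy
      simp only [f, Set.indicator_of_mem hy, Set.indicator_of_mem hy', g, stdFrame_removeNth_zero]
      simp
    · have hy' : y ∉ bdryIncl m ⁻¹' t := hy
      simp only [f, Set.indicator_of_notMem hy, Set.indicator_of_notMem hy']
  · intro y hy
    have hyH := extChartAt_target_subset_halfSpace i hy
    have hu := uniqueDiffOn_halfSpace y hyH
    have hdν : DifferentiableWithinAt ℝ (chartRep ν i) (halfSpace m) y :=
      hrange ▸ hν.differentiableWithinAt i hy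
    simp only []
    rw [hrange, extDerivWithin_apply hdν hu, Finset.mul_sum]
    -- Near `y` the sign is constant, so the divergence is the alternating sum that computes the
    -- exterior derivative on the standard frame.
    refine Finset.sum_congr rfl fun a _ => ?_
    rw [(hev a y hy).fderivWithin_eq ((hev a y hy).self_of_nhdsWithin hyH),
      fderivWithin_const_mul hu ((hg a y hy).differentiableWithinAt (by simp))]
    simp only [smul_apply, smul_eq_mul, g, stdFrame]
    ring

end ChartStokes

end DHCob
end

noncomputable section

namespace DHCob

/-! ### Boundary integrals and Stokes' theorem on the manifold. -/

section ExtDSupport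

variable {m : ℕ} {H : Type*} [TopologicalSpace H]
  {I : ModelWithCorners ℝ (EuclideanSpace ℝ (Fin m)) H}
  {M : Type*} [TopologicalSpace M] [ChartedSpace H M] [IsManifold I ∞ M]

theorem IsSmoothForm.extD {k : ℕ} {α : DForm I M k} (hα : IsSmoothForm α) :
    IsSmoothForm (extD α) := by
  intro x₀ y hy
  have hrange := extChartAt_target_subset_range (I := I) x₀ hy
  have h := ((ContinuousAlternatingMap.alternatizeUncurryFinCLM (n := k) ℝ
    (EuclideanSpace ℝ (Fin m)) ℝ).contDiff (n := ∞)).comp_contDiffWithinAt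
      ((hα.contDiffWithinAt x₀ hy).fderivWithin_right (m := ∞) I.uniqueDiffOn (by simp) hrange)
  exact (h.mono (extChartAt_target_subset_range x₀)).congr (fun z hz => chartRep_extD hα hz)
    (chartRep_extD hα hy)

theorem extD_eq_zero_of_notMem {k : ℕ} {α : DForm I M k} {L : Set M} (hL : IsClosed L)
    (h0 : ∀ x ∉ L, α x = 0) {x : M} (hx : x ∉ L) : extD α x = 0 := by
  have hx' := extChartAt_to_inv (I := I) x
  have hc : ContinuousWithinAt (extChartAt I x).symm (Set.range I) (extChartAt I x x) :=
    ((continuousOn_extChartAt_symm x) _ (mem_extChartAt_target x)).mono_of_mem_nhdsWithin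
      (extChartAt_target_mem_nhdsWithin_of_mem (mem_extChartAt_target x))
  have hev : chartRep α x =ᶠ[nhdsWithin (extChartAt I x x) (Set.range I)] fun _ => 0 := by
    have hn : Lᶜ ∈ nhds ((extChartAt I x).symm (extChartAt I x x)) := by
      rw [hx']; exact hL.isOpen_compl.mem_nhds hx
    filter_upwards [hc hn] with z hz
    exact chartRep_eq_zero (h0 _ hz)
  rw [extD_eq, hev.extDerivWithin_eq (chartRep_eq_zero (by rw [hx']; exact h0 _ hx))]
  rw [extDerivWithin, fderivWithin_fun_const]
  exact map_zero (ContinuousAlternatingMap.alternatizeUncurryFinCLM (n := k) ℝ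
    (EuclideanSpace ℝ (Fin m)) ℝ)

end ExtDSupport

section BoundaryIntegral

open MeasureTheory

variable {m : ℕ} {W : Type*} [TopologicalSpace W] [ChartedSpace (EuclideanHalfSpace (m + 1)) W]
  [IsManifold (𝓡∂ (m + 1)) ∞ W]

/-- Being a boundary point can be tested in any chart of the atlas, and a point with positive
coordinate `0` would be interior to the chart target. -/
theorem coord_zero_of_isBoundaryPoint {p i : W} (hp : (𝓡∂ (m + 1)).IsBoundaryPoint p)
    (hpi : p ∈ (extChartAt (𝓡∂ (m + 1)) i).source) : extChartAt (𝓡∂ (m + 1)) i p 0 = 0 := by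
  rw [extChartAt_source] at hpi
  have h := ((𝓡∂ (m + 1)).isBoundaryPoint_iff_of_mem_atlas (n := ∞) (by simp)
    (chart_mem_atlas _ i) hpi).1 hp
  have hpt : extChartAt (𝓡∂ (m + 1)) i p ∈ (extChartAt (𝓡∂ (m + 1)) i).target :=
    (extChartAt (𝓡∂ (m + 1)) i).map_source (by rwa [extChartAt_source])
  have h0 : (0 : ℝ) ≤ extChartAt (𝓡∂ (m + 1)) i p 0 := extChartAt_target_subset_halfSpace i hpt
  refine le_antisymm (not_lt.1 fun hlt => ?_) h0
  refine h.2 ?_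
  change extChartAt (𝓡∂ (m + 1)) i p ∈ interior (extChartAt (𝓡∂ (m + 1)) i).target
  rw [extChartAt_target, interior_inter,
    ((chartAt _ i).open_target.preimage (𝓡∂ (m + 1)).continuous_symm).interior_eq,
    interior_range_modelWithCornersEuclideanHalfSpace]
  rw [extChartAt_target] at hpt
  exact ⟨hpt.1, hlt⟩

theorem isBoundaryPoint_of_coord_zero {i : W} {y : EuclideanSpace ℝ (Fin (m + 1))}
    (hy : y ∈ (extChartAt (𝓡∂ (m + 1)) i).target) (h0 : y 0 = 0) :
    (𝓡∂ (m + 1)).IsBoundaryPoint ((extChartAt (𝓡∂ (m + 1)) i).symm y) := by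
  have hs := (extChartAt (𝓡∂ (m + 1)) i).map_target hy
  rw [extChartAt_source] at hs
  refine ((𝓡∂ (m + 1)).isBoundaryPoint_iff_of_mem_atlas (n := ∞) (by simp)
    (chart_mem_atlas _ i) hs).2 ?_
  change extChartAt (𝓡∂ (m + 1)) i _ ∈ frontier (extChartAt (𝓡∂ (m + 1)) i).target
  rw [(extChartAt (𝓡∂ (m + 1)) i).right_inv hy]
  refine ⟨subset_closure hy, fun h => ?_⟩
  have h2 := interior_mono (extChartAt_target_subset_range (I := 𝓡∂ (m + 1)) i) h
  rw [interior_range_modelWithCornersEuclideanHalfSpace] at h2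
  exact absurd h0 (ne_of_gt h2)

/-- The coordinates in the boundary hyperplane of the points of `S` in the domain of a chart. -/
def bdryPart (i : W) (S : Set W) : Set (EuclideanSpace ℝ (Fin m)) :=
  {y | bdryIncl m y ∈ (extChartAt (𝓡∂ (m + 1)) i).target ∧
    (extChartAt (𝓡∂ (m + 1)) i).symm (bdryIncl m y) ∈ S}

theorem bdryPart_boundary (i : W) : bdryPart i ((𝓡∂ (m + 1)).boundary W) =
    bdryIncl m ⁻¹' (extChartAt (𝓡∂ (m + 1)) i).target :=
  Set.ext fun y => ⟨fun h => h.1, fun h =>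
    ⟨h, isBoundaryPoint_of_coord_zero h (bdryIncl_zero_coord y)⟩⟩

/-- The integrand on the boundary hyperplane, in the chart at `i`, associated to an `m`-form. -/
def bdryIntegrand (o : DForm (𝓡∂ (m + 1)) W (m + 1)) (ν : DForm (𝓡∂ (m + 1)) W m) (i : W)
    (y : EuclideanSpace ℝ (Fin m)) : ℝ :=
  Real.sign (chartRep o i (bdryIncl m y) (stdFrame (m + 1))) *
    chartRep ν i (bdryIncl m y) (fun a => bdryIncl m (stdFrame m a))

variable [T2Space W] [SecondCountableTopology W]

/-- The product of a form with the `i`-th function of the partition of unity. -/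
def localize {k : ℕ} (μ : DForm (𝓡∂ (m + 1)) W k) (i : W) : DForm (𝓡∂ (m + 1)) W k :=
  fun x => chartPartition (𝓡∂ (m + 1)) W i x • μ x

theorem IsSmoothForm.localize {k : ℕ} {μ : DForm (𝓡∂ (m + 1)) W k} (hμ : IsSmoothForm μ) (i : W) :
    IsSmoothForm (localize μ i) :=
  hμ.fun_smul (chartPartition (𝓡∂ (m + 1)) W i).contMDiff

theorem localize_eq_zero {k : ℕ} {μ : DForm (𝓡∂ (m + 1)) W k} {K : Set W}
    (h0 : ∀ x ∉ K, μ x = 0) (i : W) {x : W}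
    (hx : x ∉ K ∩ tsupport (chartPartition (𝓡∂ (m + 1)) W i)) : DHCob.localize μ i x = 0 := by
  by_cases h : x ∈ K
  · have : chartPartition (𝓡∂ (m + 1)) W i x = 0 :=
      image_eq_zero_of_notMem_tsupport fun h' => hx ⟨h, h'⟩
    rw [DHCob.localize, this, zero_smul]
  · rw [DHCob.localize, h0 x h, smul_zero]

theorem sum_localize {k : ℕ} {μ : DForm (𝓡∂ (m + 1)) W k} {K : Set W} (hK : IsCompact K)
    (h0 : ∀ x ∉ K, μ x = 0) :
    ∑ i ∈ (finite_chartPartition (I := 𝓡∂ (m + 1)) hK).toFinset, DHCob.localize μ i = μ := by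
  funext x
  rw [Finset.sum_apply]
  simp only [DHCob.localize, ← Finset.sum_smul]
  by_cases hx : x ∈ K
  · rw [sum_chartPartition hK hx, one_smul]
  · rw [h0 x hx, smul_zero]

/-- The part in `S` of the boundary integral of a form supported in a compact set `K`. -/
def bdryIntegral (o : DForm (𝓡∂ (m + 1)) W (m + 1)) (μ : DForm (𝓡∂ (m + 1)) W m) {K : Set W}
    (hK : IsCompact K) (S : Set W) : ℝ :=
  ∑ i ∈ (finite_chartPartition (I := 𝓡∂ (m + 1)) hK).toFinset,
    ∫ y in bdryPart i S, bdryIntegrand o (DHCob.localize μ i) i y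

/-- Stokes' theorem for a closed form. -/
theorem bdryIntegral_boundary {o : DForm (𝓡∂ (m + 1)) W (m + 1)} (ho : IsOrientationForm o)
    {μ : DForm (𝓡∂ (m + 1)) W m} (hμ : IsSmoothForm μ) (hd : extD μ = 0) {K : Set W}
    (hK : IsCompact K) (h0 : ∀ x ∉ K, μ x = 0) :
    bdryIntegral o μ hK ((𝓡∂ (m + 1)).boundary W) = 0 := by
  have hs := fun i => hμ.localize i
  have hL : ∀ i, IsCompact (K ∩ tsupport (chartPartition (𝓡∂ (m + 1)) W i)) := fun i =>
    hK.inter_right (isClosed_tsupport _)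
  have hLi : ∀ i, K ∩ tsupport (chartPartition (𝓡∂ (m + 1)) W i) ⊆
      (extChartAt (𝓡∂ (m + 1)) i).source := fun i =>
    Set.inter_subset_right.trans (tsupport_chartPartition_subset i)
  have hd0 : ∀ i, ∀ x ∉ K ∩ tsupport (chartPartition (𝓡∂ (m + 1)) W i),
      extD (DHCob.localize μ i) x = 0 := fun i x hx =>
    extD_eq_zero_of_notMem (hL i).isClosed (fun _ h => localize_eq_zero h0 i h) hx
  have key : ∀ i, ∫ y in bdryPart i ((𝓡∂ (m + 1)).boundary W),
      bdryIntegrand o (DHCob.localize μ i) i y = -integral o (extD (DHCob.localize μ i)) := by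
    intro i
    have hst := setIntegral_extDerivWithin_chart ho (hs i) i (hL i) (hLi i)
      fun _ h => localize_eq_zero h0 i h
    have himg : extChartAt (𝓡∂ (m + 1)) i '' (extChartAt (𝓡∂ (m + 1)) i).source =
        (extChartAt (𝓡∂ (m + 1)) i).target := (extChartAt (𝓡∂ (m + 1)) i).image_source_eq_target
    -- The definition of `integral` brings in the partition of unity once more. As the localized
    -- form lives in a single chart, the change of variables with that chart removes it.
    have hint := (integral_eq_setIntegral_image ho.smooth (hs i).extD
      (isOpen_extChartAt_source i) (hL i) (hLi i) (hd0 i) (extChartAt (𝓡∂ (m + 1)) i).injOn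
      (fun x hx => mdifferentiableAt_extChartAt (by rwa [extChartAt_source] at hx))
      (by rw [himg]; exact measurableSet_extChartAt_target i)
      (chartRep (extD (DHCob.localize μ i)) i) (chartRep o i)
      (fun x hx => eq_chartRep_comp_mfderiv _ hx)
      (fun x hx v => congrArg (fun f : EuclideanSpace ℝ (Fin (m + 1)) [⋀^Fin (m + 1)]→L[ℝ] ℝ =>
        Real.sign (f v)) (eq_chartRep_comp_mfderiv o hx))
      (fun x hx hxK => chartRep_eq_zero (by
        rw [(extChartAt (𝓡∂ (m + 1)) i).left_inv hx]; exact hd0 i x hxK))).2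
    rw [himg] at hint
    rw [hint, bdryPart_boundary, setIntegral_congr_fun (measurableSet_extChartAt_target i)
      (fun y hy => by rw [chartRep_extD (hs i) hy]), hst, neg_neg]
    rfl
  -- The localized forms add up to `μ`, so their exterior derivatives add up to `dμ = 0`.
  rw [bdryIntegral, Finset.sum_congr rfl fun i _ => key i, Finset.sum_neg_distrib,
    ← integral_sum_forms ho.smooth _ (fun i _ => (hs i).extD) hK
      (fun i _ x hx => hd0 i x fun h => hx h.1), ← extD_sum _ (fun i _ => hs i),
    sum_localize hK h0, hd, neg_eq_zero]
  have h := integral_sum_forms ho.smooth (∅ : Finset ℕ) (μ := fun _ => 0) (by simp) hK (by simp)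
  simpa using h

/-- Separates the contributions of the two ends of a cobordism; the hypotheses are those needed for
additivity of set integrals in every chart. -/
theorem bdryIntegral_union {o : DForm (𝓡∂ (m + 1)) W (m + 1)}
    {μ : DForm (𝓡∂ (m + 1)) W m} {K : Set W} (hK : IsCompact K) {S T : Set W}
    (hST : Disjoint S T) (hT : ∀ i : W, MeasurableSet (bdryPart (m := m) i T))
    (hSi : ∀ i, IntegrableOn (bdryIntegrand o (DHCob.localize μ i) i) (bdryPart i S))
    (hTi : ∀ i, IntegrableOn (bdryIntegrand o (DHCob.localize μ i) i) (bdryPart i T)) :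
    bdryIntegral o μ hK (S ∪ T) = bdryIntegral o μ hK S + bdryIntegral o μ hK T := by
  rw [bdryIntegral, bdryIntegral, bdryIntegral, ← Finset.sum_add_distrib]
  refine Finset.sum_congr rfl fun i _ => ?_
  rw [← setIntegral_union _ (hT i) (hSi i) (hTi i)]
  · congr 2
    ext y
    simp only [bdryPart, Set.mem_ofPred_eq, Set.mem_union]
    tauto
  · exact Set.disjoint_left.2 fun y hy hy' => Set.disjoint_left.1 hST hy.2 hy'.2

end BoundaryIntegral

end DHCob
end

noncomputable section

namespace DHCob

/-! ### Orientation signs and boundary coordinates. -/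

section Calculus

variable {m : ℕ}

/-- Top-degree forms make up a line, so the determinant of `v` is a factor common to all of them.
Hence comparing signs on one frame is enough. -/
theorem exists_form_apply_eq (v : Fin m → EuclideanSpace ℝ (Fin m)) :
    ∃ d : ℝ, ∀ f : EuclideanSpace ℝ (Fin m) [⋀^Fin m]→L[ℝ] ℝ, f v = d * f (stdFrame m) := by
  have he : ((EuclideanSpace.basisFun (Fin m) ℝ).toBasis : Fin m → _) = stdFrame m :=
    funext fun a => by simp [stdFrame]
  refine ⟨(EuclideanSpace.basisFun (Fin m) ℝ).toBasis.det v, fun f => ?_⟩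
  have h := DFunLike.congr_fun (AlternatingMap.eq_smul_basis_det
    (EuclideanSpace.basisFun (Fin m) ℝ).toBasis f.toAlternatingMap) v
  rw [AlternatingMap.smul_apply, he, smul_eq_mul, mul_comm] at h
  exact h

theorem sign_form_eq_of_pos_iff {f g : EuclideanSpace ℝ (Fin m) [⋀^Fin m]→L[ℝ] ℝ} (hf : f ≠ 0)
    (hg : g ≠ 0) (h : ∀ v, 0 < f v ↔ 0 < g v) (v : Fin m → EuclideanSpace ℝ (Fin m)) :
    Real.sign (f v) = Real.sign (g v) := by
  have hf' : f (stdFrame m) ≠ 0 := fun h0 => hf (form_eq_zero_of_stdFrame f h0)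
  have hg' : g (stdFrame m) ≠ 0 := fun h0 => hg (form_eq_zero_of_stdFrame g h0)
  have hs : Real.sign (f (stdFrame m)) = Real.sign (g (stdFrame m)) := by
    have h1 := h (stdFrame m)
    rcases lt_or_gt_of_ne hf' with hf1 | hf1 <;> rcases lt_or_gt_of_ne hg' with hg1 | hg1
    · rw [Real.sign_of_neg hf1, Real.sign_of_neg hg1]
    · exact absurd (h1.2 hg1) hf1.not_gt
    · exact absurd (h1.1 hf1) hg1.not_gt
    · rw [Real.sign_of_pos hf1, Real.sign_of_pos hg1]
  obtain ⟨d, hd⟩ := exists_form_apply_eq v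
  rw [hd f, hd g, real_sign_mul, real_sign_mul, hs]

theorem det_ne_zero_of_injective {T : EuclideanSpace ℝ (Fin m) →L[ℝ] EuclideanSpace ℝ (Fin m)}
    (hT : Function.Injective T) : T.det ≠ 0 := fun h =>
  (LinearMap.bot_lt_ker_of_det_eq_zero h).ne' (LinearMap.ker_eq_bot.2 hT)

/-- A local diffeomorphism of half spaces preserving a boundary point sends inward pointing vectors
to inward pointing vectors. -/
theorem coord_zero_pos_of_mapsTo_halfSpace
    {h : EuclideanSpace ℝ (Fin (m + 1)) → EuclideanSpace ℝ (Fin (m + 1))}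
    {A : EuclideanSpace ℝ (Fin (m + 1)) →L[ℝ] EuclideanSpace ℝ (Fin (m + 1))}
    {z : EuclideanSpace ℝ (Fin (m + 1))} (hz : z 0 = 0) (hh : (h z) 0 = 0)
    (hd : HasFDerivWithinAt h A (halfSpace m) z) (hmaps : ∀ y, h y ∈ halfSpace m)
    (hA : Function.Surjective A) : 0 < A (EuclideanSpace.single 0 1) 0 := by
  let π : EuclideanSpace ℝ (Fin (m + 1)) →L[ℝ] ℝ := EuclideanSpace.proj 0
  have hd' : HasFDerivWithinAt (fun y => h y 0) (π.comp A) (halfSpace m) z :=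
    π.hasFDerivAt.comp_hasFDerivWithinAt z hd
  -- The coordinate `0` of `h` is nonnegative and vanishes at `z`, so its derivative is nonnegative
  -- on vectors pointing into the half space.
  have hmin : IsLocalMinOn (fun y => h y 0) (halfSpace m) z :=
    Filter.Eventually.of_forall fun y => by
      change h z 0 ≤ h y 0
      rw [hh]
      exact hmaps y
  have hnn : ∀ v ∈ halfSpace m, 0 ≤ A v 0 := fun v hv =>
    hmin.hasFDerivWithinAt_nonneg hd' (mem_posTangentConeAt_of_segment_subset (by
      rw [segment_eq_image']
      rintro _ ⟨t, ht, rfl⟩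
      change 0 ≤ z 0 + t * (z 0 + v 0 - z 0)
      rw [hz]
      have hv' : 0 ≤ v 0 := hv
      have := mul_nonneg ht.1 hv'
      linarith))
  -- For vectors tangent to the hyperplane both `v` and `-v` are admissible, so the derivative
  -- vanishes on them.
  have hz0 : ∀ v : EuclideanSpace ℝ (Fin (m + 1)), v 0 = 0 → A v 0 = 0 := fun v hv => by
    have h1 := hnn v hv.ge
    have h2 := hnn (-v) (by change 0 ≤ -(v 0); rw [hv, neg_zero])
    rw [map_neg] at h2
    have h3 : (-(A v)) 0 = -(A v 0) := rfl
    linarith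
  -- If it vanished on the normal direction too, no vector could be mapped to the first basis
  -- vector, against surjectivity.
  refine lt_of_le_of_ne (hnn _ (by simp)) fun h0 => ?_
  obtain ⟨v, hv⟩ := hA (EuclideanSpace.single 0 1)
  have hdec : v = v 0 • EuclideanSpace.single 0 1 + (v - v 0 • EuclideanSpace.single 0 1) := by
    abel
  have h1 : A v 0 = v 0 * A (EuclideanSpace.single 0 1) 0 +
      A (v - v 0 • EuclideanSpace.single 0 1) 0 := by
    conv_lhs => rw [hdec, map_add, map_smul]
    rfl
  rw [← h0, hz0 (v - v 0 • EuclideanSpace.single 0 1) (by simp), hv] at h1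
  simp at h1

end Calculus

section BoundaryCoordinates

variable {m : ℕ}
  {W : Type*} [TopologicalSpace W] [ChartedSpace (EuclideanHalfSpace (m + 1)) W]
  {B : Type*} {j : B → W}

variable (m) in
/-- The local coordinates on `B` induced by the chart of `W` at `i`. -/
def bdryChart (j : B → W) (i : W) (b : B) : EuclideanSpace ℝ (Fin m) :=
  bdryProj m (extChartAt (𝓡∂ (m + 1)) i (j b))

variable [IsManifold (𝓡∂ (m + 1)) ∞ W]

theorem bdryIncl_bdryChart (hr : Set.range j ⊆ (𝓡∂ (m + 1)).boundary W) {i : W} {b : B}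
    (hb : j b ∈ (extChartAt (𝓡∂ (m + 1)) i).source) :
    bdryIncl m (bdryChart m j i b) = extChartAt (𝓡∂ (m + 1)) i (j b) :=
  bdryIncl_bdryProj (coord_zero_of_isBoundaryPoint (hr ⟨b, rfl⟩) hb)

theorem injOn_bdryChart (hj : Function.Injective j)
    (hr : Set.range j ⊆ (𝓡∂ (m + 1)).boundary W) (i : W) :
    Set.InjOn (bdryChart m j i) (j ⁻¹' (extChartAt (𝓡∂ (m + 1)) i).source) := by
  intro b hb c hc hbc
  have h := congrArg (bdryIncl m) hbc
  rw [bdryIncl_bdryChart hr hb, bdryIncl_bdryChart hr hc] at h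
  exact hj ((extChartAt (𝓡∂ (m + 1)) i).injOn hb hc h)

theorem image_bdryChart (hr : Set.range j ⊆ (𝓡∂ (m + 1)).boundary W) (i : W) :
    bdryChart m j i '' (j ⁻¹' (extChartAt (𝓡∂ (m + 1)) i).source) =
      bdryPart i (Set.range j) := by
  ext y
  constructor
  · rintro ⟨b, hb, rfl⟩
    refine ⟨?_, ?_⟩
    · rw [bdryIncl_bdryChart hr hb]
      exact (extChartAt (𝓡∂ (m + 1)) i).map_source hb
    · rw [bdryIncl_bdryChart hr hb, (extChartAt (𝓡∂ (m + 1)) i).left_inv hb]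
      exact ⟨b, rfl⟩
  · rintro ⟨hy, b, hb⟩
    refine ⟨b, ?_, ?_⟩
    · rw [Set.mem_preimage, hb]
      exact (extChartAt (𝓡∂ (m + 1)) i).map_target hy
    · rw [bdryChart, hb, (extChartAt (𝓡∂ (m + 1)) i).right_inv hy, bdryProj_bdryIncl]

end BoundaryCoordinates

section Pieces

open MeasureTheory

variable {m : ℕ}
  {W : Type*} [TopologicalSpace W] [ChartedSpace (EuclideanHalfSpace (m + 1)) W]
  {B : Type*} [TopologicalSpace B] [ChartedSpace (EuclideanSpace ℝ (Fin m)) B] {j : B → W}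

/-- In suitable charts an immersion is the inclusion of a factor. Projecting back and undoing the
chart of the source gives a local left inverse, whose derivative is a left inverse of the
derivative. -/
theorem mfderiv_injective_of_isSmoothEmbedding
    (hj : Manifold.IsSmoothEmbedding (𝓡 m) (𝓡∂ (m + 1)) ∞ j) (b : B) :
    Function.Injective (mfderiv (𝓡 m) (𝓡∂ (m + 1)) j b) := by
  have h := hj.isImmersion.isImmersionAt b
  have hcod : MDifferentiableAt (𝓡∂ (m + 1)) 𝓘(ℝ, EuclideanSpace ℝ (Fin (m + 1)))
      (h.codChart.extend (𝓡∂ (m + 1))) (j b) :=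
    (OpenPartialHomeomorph.contMDiffAt_extend h.codChart_mem_maximalAtlas
      h.mem_codChart_source).mdifferentiableAt (by simp)
  have hjd : MDifferentiableAt (𝓡 m) (𝓡∂ (m + 1)) j b :=
    (hj.isImmersion.contMDiff b).mdifferentiableAt (by simp)
  have hdom : MDifferentiableAt (𝓡 m) 𝓘(ℝ, EuclideanSpace ℝ (Fin m))
      (h.domChart.extend (𝓡 m)) b :=
    (OpenPartialHomeomorph.contMDiffAt_extend h.domChart_mem_maximalAtlas
      h.mem_domChart_source).mdifferentiableAt (by simp)
  let P : EuclideanSpace ℝ (Fin (m + 1)) →L[ℝ] EuclideanSpace ℝ (Fin m) :=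
    (ContinuousLinearMap.fst ℝ (EuclideanSpace ℝ (Fin m)) h.complement).comp
      (h.equiv.symm : EuclideanSpace ℝ (Fin (m + 1)) →L[ℝ]
        EuclideanSpace ℝ (Fin m) × h.complement)
  have hP : ∀ᶠ x in nhds b, h.domChart.extend (𝓡 m) x =
      P (h.codChart.extend (𝓡∂ (m + 1)) (j x)) := by
    filter_upwards [h.domChart.open_source.mem_nhds h.mem_domChart_source] with x hx
    have hxs : x ∈ (h.domChart.extend (𝓡 m)).source := by rwa [h.domChart.extend_source]
    have h1 := h.writtenInCharts ((h.domChart.extend (𝓡 m)).map_source hxs)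
    simp only [Function.comp_apply, (h.domChart.extend (𝓡 m)).left_inv hxs] at h1
    change _ = (h.equiv.symm _).1
    rw [h1, ContinuousLinearEquiv.symm_apply_apply]
  have hD1 : HasMFDerivAt (𝓡 m) 𝓘(ℝ, EuclideanSpace ℝ (Fin m)) (h.domChart.extend (𝓡 m)) b _ :=
    (P.hasMFDerivAt.comp b (hcod.hasMFDerivAt.comp b hjd.hasMFDerivAt)).congr_of_eventuallyEq hP
  have hD2 := hdom.hasMFDerivAt
  have hinv : MDifferentiableAt 𝓘(ℝ, EuclideanSpace ℝ (Fin m)) (𝓡 m)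
      (h.domChart.extend (𝓡 m)).symm (h.domChart.extend (𝓡 m) b) := by
    have := contMDiffOn_extend_symm h.domChart_mem_maximalAtlas
    have hopen : IsOpen ((𝓡 m) '' h.domChart.target) := by
      simpa using h.domChart.open_target
    refine (this.contMDiffAt (hopen.mem_nhds ?_)).mdifferentiableAt (by simp)
    exact ⟨_, h.domChart.map_source h.mem_domChart_source, rfl⟩
  have hid : HasMFDerivAt (𝓡 m) (𝓡 m) id b _ :=
    (hinv.hasMFDerivAt.comp b hD1).congr_of_eventuallyEq (by
      filter_upwards [h.domChart.open_source.mem_nhds h.mem_domChart_source] with x hx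
      have hxs : x ∈ (h.domChart.extend (𝓡 m)).source := by rwa [h.domChart.extend_source]
      exact ((h.domChart.extend (𝓡 m)).left_inv hxs).symm)
  have huniq := hasMFDerivAt_unique (hasMFDerivAt_id b) hid
  intro v w hvw
  exact (DFunLike.congr_fun huniq v).trans ((congrArg (fun u =>
    (show EuclideanSpace ℝ (Fin m) →L[ℝ] EuclideanSpace ℝ (Fin m) from
      mfderiv 𝓘(ℝ, EuclideanSpace ℝ (Fin m)) (𝓡 m) (h.domChart.extend (𝓡 m)).symm
        (h.domChart.extend (𝓡 m) b)) (P
      ((show EuclideanSpace ℝ (Fin (m + 1)) →L[ℝ] EuclideanSpace ℝ (Fin (m + 1)) from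
        mfderiv (𝓡∂ (m + 1)) 𝓘(ℝ, EuclideanSpace ℝ (Fin (m + 1)))
          (h.codChart.extend (𝓡∂ (m + 1))) (j b)) u))) hvw).trans
      (DFunLike.congr_fun huniq w).symm)

variable [IsManifold (𝓡∂ (m + 1)) ∞ W]

theorem mdifferentiableAt_chart_comp (hj : ContMDiff (𝓡 m) (𝓡∂ (m + 1)) ∞ j) {i : W} {b : B}
    (hb : j b ∈ (extChartAt (𝓡∂ (m + 1)) i).source) :
    MDifferentiableAt (𝓡 m) 𝓘(ℝ, EuclideanSpace ℝ (Fin (m + 1)))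
      (fun c => extChartAt (𝓡∂ (m + 1)) i (j c)) b := by
  have : IsManifold (𝓡∂ (m + 1)) 1 W := IsManifold.of_le (n := ∞) (by norm_cast)
  exact (mdifferentiableAt_extChartAt (by rwa [extChartAt_source] at hb)).comp b
    ((hj b).mdifferentiableAt (by simp))

theorem hasMFDerivAt_bdryChart (hj : ContMDiff (𝓡 m) (𝓡∂ (m + 1)) ∞ j) {i : W} {b : B}
    (hb : j b ∈ (extChartAt (𝓡∂ (m + 1)) i).source) :
    HasMFDerivAt (𝓡 m) 𝓘(ℝ, EuclideanSpace ℝ (Fin m)) (bdryChart m j i) b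
      ((bdryProj m).comp (show EuclideanSpace ℝ (Fin m) →L[ℝ] EuclideanSpace ℝ (Fin (m + 1)) from
        mfderiv (𝓡 m) 𝓘(ℝ, EuclideanSpace ℝ (Fin (m + 1)))
          (fun c => extChartAt (𝓡∂ (m + 1)) i (j c)) b)) :=
  (bdryProj m).hasMFDerivAt.comp b (mdifferentiableAt_chart_comp hj hb).hasMFDerivAt

/-- Near `b` the composite of the chart with `j` stays in the boundary hyperplane, so forgetting
coordinate `0` and restoring it changes nothing, even after differentiation. -/
theorem bdryIncl_mfderiv_bdryChart (hj : ContMDiff (𝓡 m) (𝓡∂ (m + 1)) ∞ j)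
    (hr : Set.range j ⊆ (𝓡∂ (m + 1)).boundary W) {i : W} {b : B}
    (hb : j b ∈ (extChartAt (𝓡∂ (m + 1)) i).source) (v : EuclideanSpace ℝ (Fin m)) :
    bdryIncl m ((show EuclideanSpace ℝ (Fin m) →L[ℝ] EuclideanSpace ℝ (Fin m) from
        mfderiv (𝓡 m) 𝓘(ℝ, EuclideanSpace ℝ (Fin m)) (bdryChart m j i) b) v) =
      (show EuclideanSpace ℝ (Fin (m + 1)) →L[ℝ] EuclideanSpace ℝ (Fin (m + 1)) from
        mfderiv (𝓡∂ (m + 1)) 𝓘(ℝ, EuclideanSpace ℝ (Fin (m + 1)))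
          (extChartAt (𝓡∂ (m + 1)) i) (j b))
        ((show EuclideanSpace ℝ (Fin m) →L[ℝ] EuclideanSpace ℝ (Fin (m + 1)) from
          mfderiv (𝓡 m) (𝓡∂ (m + 1)) j b) v) := by
  have : IsManifold (𝓡∂ (m + 1)) 1 W := IsManifold.of_le (n := ∞) (by norm_cast)
  have hφ : MDifferentiableAt (𝓡∂ (m + 1)) 𝓘(ℝ, EuclideanSpace ℝ (Fin (m + 1)))
      (extChartAt (𝓡∂ (m + 1)) i) (j b) :=
    mdifferentiableAt_extChartAt (by rwa [extChartAt_source] at hb)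
  have hj' : MDifferentiableAt (𝓡 m) (𝓡∂ (m + 1)) j b := (hj b).mdifferentiableAt (by simp)
  have h1 := hφ.hasMFDerivAt.comp b hj'.hasMFDerivAt
  have h2 := (bdryIncl m).hasMFDerivAt.comp b (hasMFDerivAt_bdryChart hj hb).mdifferentiableAt.hasMFDerivAt
  have hev : (fun c => extChartAt (𝓡∂ (m + 1)) i (j c)) =ᶠ[nhds b]
      fun c => bdryIncl m (bdryChart m j i c) := by
    filter_upwards [hj.continuous.continuousAt.preimage_mem_nhds
      ((isOpen_extChartAt_source i).mem_nhds hb)] with c hc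
    exact (bdryIncl_bdryChart hr hc).symm
  exact (DFunLike.congr_fun (hasMFDerivAt_unique h1 (h2.congr_of_eventuallyEq hev)) v).symm

theorem mfderiv_bdryChart_injective (hj : Manifold.IsSmoothEmbedding (𝓡 m) (𝓡∂ (m + 1)) ∞ j)
    (hr : Set.range j ⊆ (𝓡∂ (m + 1)).boundary W) {i : W} {b : B}
    (hb : j b ∈ (extChartAt (𝓡∂ (m + 1)) i).source) :
    Function.Injective (show EuclideanSpace ℝ (Fin m) →L[ℝ] EuclideanSpace ℝ (Fin m) from
        mfderiv (𝓡 m) 𝓘(ℝ, EuclideanSpace ℝ (Fin m)) (bdryChart m j i) b) := by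
  have : IsManifold (𝓡∂ (m + 1)) 1 W := IsManifold.of_le (n := ∞) (by norm_cast)
  intro v w hvw
  have h := congrArg (bdryIncl m) hvw
  rw [bdryIncl_mfderiv_bdryChart hj.isImmersion.contMDiff hr hb,
    bdryIncl_mfderiv_bdryChart hj.isImmersion.contMDiff hr hb] at h
  exact mfderiv_injective_of_isSmoothEmbedding hj b
    ((isInvertible_mfderiv_extChartAt hb).injective h)

variable [IsManifold (𝓡 m) ∞ B]

/-- An injective derivative between spaces of equal dimension is surjective, and a strictly
differentiable map with surjective derivative is locally open. -/
theorem map_nhds_bdryChart (hj : Manifold.IsSmoothEmbedding (𝓡 m) (𝓡∂ (m + 1)) ∞ j)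
    (hr : Set.range j ⊆ (𝓡∂ (m + 1)).boundary W) {i : W} {b : B}
    (hb : j b ∈ (extChartAt (𝓡∂ (m + 1)) i).source) :
    Filter.map (bdryChart m j i) (nhds b) = nhds (bdryChart m j i b) := by
  set e := extChartAt (𝓡 m) b
  have hbe : e.symm (e b) = b := extChartAt_to_inv b
  have hc : ContDiffAt ℝ ∞ (fun y => bdryChart m j i (e.symm y)) (e b) := by
    have h := contDiffWithinAt_chart_comp hj.isImmersion.contMDiff (y₀ := i)
      (mem_extChartAt_target (I := 𝓡 m) b) (by rw [hbe]; exact hb)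
    have h2 := (bdryProj m).contDiff.comp_contDiffWithinAt h
    rwa [ModelWithCorners.range_eq_univ, contDiffWithinAt_univ] at h2
  have hd := (hasFDerivWithinAt_comp_extChartAt_symm (f := bdryChart m j i)
    (mem_extChartAt_target (I := 𝓡 m) b) (by
      rw [hbe]
      exact (hasMFDerivAt_bdryChart hj.isImmersion.contMDiff hb).mdifferentiableAt)).hasFDerivAt
      (by rw [ModelWithCorners.range_eq_univ]; exact Filter.univ_mem)
  have hs := hc.hasStrictFDerivAt' hd (by simp)
  have : IsManifold (𝓡 m) 1 B := IsManifold.of_le (n := ∞) (by norm_cast)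
  have hinj : ∀ c, c = b → Function.Injective
      ((show EuclideanSpace ℝ (Fin m) →L[ℝ] EuclideanSpace ℝ (Fin m) from
        mfderiv (𝓡 m) 𝓘(ℝ, EuclideanSpace ℝ (Fin m)) (bdryChart m j i) c).comp
      (show EuclideanSpace ℝ (Fin m) →L[ℝ] EuclideanSpace ℝ (Fin m) from
        mfderivWithin 𝓘(ℝ, EuclideanSpace ℝ (Fin m)) (𝓡 m) e.symm (Set.range (𝓡 m)) (e b))) := by
    rintro c rfl
    exact (mfderiv_bdryChart_injective hj hr hb).comp
      (isInvertible_mfderivWithin_extChartAt_symm (mem_extChartAt_target c)).injective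
  have hsurj := LinearMap.range_eq_top.2
    (LinearMap.injective_iff_surjective.1 (hinj _ hbe))
  have hmap := hs.map_nhds_eq_of_surj hsurj
  rw [← map_extChartAt_nhds_of_boundaryless (I := 𝓡 m) b, Filter.map_map, hbe] at hmap
  rw [← hmap]
  refine Filter.map_congr ?_
  filter_upwards [extChartAt_source_mem_nhds (I := 𝓡 m) b] with c hc
  exact congrArg (bdryChart m j i) ((extChartAt (𝓡 m) b).left_inv hc).symm

end Pieces

end DHCob
end

noncomputable section

namespace DHCob

/-! ### Integrals over pieces of the boundary. -/

section PieceIntegral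

open MeasureTheory

variable {m : ℕ}
  {W : Type*} [TopologicalSpace W] [ChartedSpace (EuclideanHalfSpace (m + 1)) W]

/-- The form on the boundary hyperplane inducing the boundary orientation in a chart. -/
def bdryForm (o : DForm (𝓡∂ (m + 1)) W (m + 1)) (i : W) (y : EuclideanSpace ℝ (Fin m)) :
    EuclideanSpace ℝ (Fin m) [⋀^Fin m]→L[ℝ] ℝ :=
  -(((chartRep o i (bdryIncl m y)).curryLeft
    (EuclideanSpace.single 0 1)).compContinuousLinearMap (bdryIncl m))

theorem cons_bdryIncl_stdFrame : (Fin.cons (EuclideanSpace.single 0 1)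
    fun a => bdryIncl m (stdFrame m a) : Fin (m + 1) → EuclideanSpace ℝ (Fin (m + 1))) =
      stdFrame (m + 1) := by
  funext a
  refine Fin.cases rfl (fun b => ?_) a
  exact (congrFun stdFrame_removeNth_zero b).symm

theorem bdryForm_stdFrame (o : DForm (𝓡∂ (m + 1)) W (m + 1)) (i : W)
    (y : EuclideanSpace ℝ (Fin m)) :
    bdryForm o i y (stdFrame m) = -chartRep o i (bdryIncl m y) (stdFrame (m + 1)) := by
  rw [← cons_bdryIncl_stdFrame]
  rfl

variable [IsManifold (𝓡∂ (m + 1)) ∞ W] {B : Type*} {j : B → W}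

/-- Outward vectors are defined in the chart at `j b`, but computations take place in the chart at
`i`. The transition map preserves the half space and the boundary point, so minus the first basis
vector of the latter chart is outward in the former. -/
theorem exists_isOutward (hr : Set.range j ⊆ (𝓡∂ (m + 1)).boundary W) {i : W} {b : B}
    (hb : j b ∈ (extChartAt (𝓡∂ (m + 1)) i).source) :
    ∃ ν : EuclideanSpace ℝ (Fin (m + 1)), IsOutward (j b) ν ∧
      (show EuclideanSpace ℝ (Fin (m + 1)) →L[ℝ] EuclideanSpace ℝ (Fin (m + 1)) from
        mfderiv (𝓡∂ (m + 1)) 𝓘(ℝ, EuclideanSpace ℝ (Fin (m + 1)))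
          (extChartAt (𝓡∂ (m + 1)) i) (j b)) ν = -EuclideanSpace.single 0 1 := by
  have : IsManifold (𝓡∂ (m + 1)) 1 W := IsManifold.of_le (n := ∞) (by norm_cast)
  set p := j b with hp
  have hpb : (𝓡∂ (m + 1)).IsBoundaryPoint p := hr ⟨b, rfl⟩
  set z := extChartAt (𝓡∂ (m + 1)) i p with hz
  have hzt : z ∈ (extChartAt (𝓡∂ (m + 1)) i).target :=
    (extChartAt (𝓡∂ (m + 1)) i).map_source hb
  have hq : (extChartAt (𝓡∂ (m + 1)) i).symm z = p := (extChartAt (𝓡∂ (m + 1)) i).left_inv hb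
  let S : EuclideanSpace ℝ (Fin (m + 1)) →L[ℝ] EuclideanSpace ℝ (Fin (m + 1)) :=
    mfderivWithin 𝓘(ℝ, EuclideanSpace ℝ (Fin (m + 1))) (𝓡∂ (m + 1))
      (extChartAt (𝓡∂ (m + 1)) i).symm (Set.range (𝓡∂ (m + 1))) z
  let D : W → EuclideanSpace ℝ (Fin (m + 1)) →L[ℝ] EuclideanSpace ℝ (Fin (m + 1)) := fun q =>
    mfderiv (𝓡∂ (m + 1)) 𝓘(ℝ, EuclideanSpace ℝ (Fin (m + 1)))
      (extChartAt (𝓡∂ (m + 1)) p) q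
  have hd : HasFDerivWithinAt (fun y => extChartAt (𝓡∂ (m + 1)) p
      ((extChartAt (𝓡∂ (m + 1)) i).symm y)) ((D p).comp S) (Set.range (𝓡∂ (m + 1))) z := by
    have h := hasFDerivWithinAt_comp_extChartAt_symm (f := extChartAt (𝓡∂ (m + 1)) p) hzt
      (by rw [hq]; exact mdifferentiableAt_extChartAt (mem_chart_source _ p))
    have h' : HasFDerivWithinAt (fun y => extChartAt (𝓡∂ (m + 1)) p
      ((extChartAt (𝓡∂ (m + 1)) i).symm y)) ((D ((extChartAt (𝓡∂ (m + 1)) i).symm z)).comp S)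
        (Set.range (𝓡∂ (m + 1))) z := h
    rwa [hq] at h'
  rw [range_modelWithCornersEuclideanHalfSpace] at hd
  have hpos := coord_zero_pos_of_mapsTo_halfSpace (coord_zero_of_isBoundaryPoint hpb hb)
    (by rw [hq]; exact coord_zero_of_isBoundaryPoint hpb (mem_extChartAt_source p)) hd
    (fun y => by
      have h : extChartAt (𝓡∂ (m + 1)) p ((extChartAt (𝓡∂ (m + 1)) i).symm y) ∈
        Set.range (𝓡∂ (m + 1)) := Set.mem_range_self _
      rwa [range_modelWithCornersEuclideanHalfSpace] at h)
    ((isInvertible_mfderiv_extChartAt (mem_extChartAt_source p)).surjective.comp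
      (isInvertible_mfderivWithin_extChartAt_symm hzt).surjective)
  refine ⟨S (-EuclideanSpace.single 0 1), ?_, ?_⟩
  · change D p (S (-EuclideanSpace.single 0 1)) 0 < 0
    rw [map_neg, map_neg]
    exact neg_lt_zero.2 hpos
  · exact DFunLike.congr_fun
      (mfderiv_extChartAt_comp_mfderivWithin_extChartAt_symm' hb) (-EuclideanSpace.single 0 1)

variable [TopologicalSpace B] [ChartedSpace (EuclideanSpace ℝ (Fin m)) B]

theorem form_eq_bdryForm {o : DForm (𝓡∂ (m + 1)) W (m + 1)}
    (hj : ContMDiff (𝓡 m) (𝓡∂ (m + 1)) ∞ j) (hr : Set.range j ⊆ (𝓡∂ (m + 1)).boundary W)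
    {i : W} {b : B} (hb : j b ∈ (extChartAt (𝓡∂ (m + 1)) i).source)
    {ν : EuclideanSpace ℝ (Fin (m + 1))}
    (hν : (show EuclideanSpace ℝ (Fin (m + 1)) →L[ℝ] EuclideanSpace ℝ (Fin (m + 1)) from
        mfderiv (𝓡∂ (m + 1)) 𝓘(ℝ, EuclideanSpace ℝ (Fin (m + 1)))
          (extChartAt (𝓡∂ (m + 1)) i) (j b)) ν = -EuclideanSpace.single 0 1)
    (v : Fin m → EuclideanSpace ℝ (Fin m)) :
    o (j b) (Fin.cons ν fun a => mfderiv (𝓡 m) (𝓡∂ (m + 1)) j b (v a)) =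
      bdryForm o i (bdryChart m j i b) (fun a =>
        (show EuclideanSpace ℝ (Fin m) →L[ℝ] EuclideanSpace ℝ (Fin m) from
        mfderiv (𝓡 m) 𝓘(ℝ, EuclideanSpace ℝ (Fin m)) (bdryChart m j i) b) (v a)) := by
  rw [eq_chartRep_comp_mfderiv o hb, ← bdryIncl_bdryChart hr hb]
  have h : bdryForm o i (bdryChart m j i b) (fun a =>
        (show EuclideanSpace ℝ (Fin m) →L[ℝ] EuclideanSpace ℝ (Fin m) from
        mfderiv (𝓡 m) 𝓘(ℝ, EuclideanSpace ℝ (Fin m)) (bdryChart m j i) b) (v a)) =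
      (chartRep o i (bdryIncl m (bdryChart m j i b))).curryLeft (-EuclideanSpace.single 0 1)
        (fun a => bdryIncl m ((show EuclideanSpace ℝ (Fin m) →L[ℝ] EuclideanSpace ℝ (Fin m) from
        mfderiv (𝓡 m) 𝓘(ℝ, EuclideanSpace ℝ (Fin m)) (bdryChart m j i) b) (v a))) := by
    rw [map_neg]
    rfl
  rw [h]
  simp only [bdryIncl_mfderiv_bdryChart hj hr hb]
  change chartRep o i (bdryIncl m (bdryChart m j i b)) _ =
    chartRep o i (bdryIncl m (bdryChart m j i b)) _
  congr 1
  funext a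
  exact Fin.cases hν (fun _ => rfl) a

/-- The boundary orientation is tested on the outward vector that the chart at `i` sends to minus
the first basis vector; then positivity of frames agrees, and with it the signs on all frames. -/
theorem sign_eq_sign_bdryForm {o : DForm (𝓡∂ (m + 1)) W (m + 1)} {oB : DForm (𝓡 m) B m}
    (ho : IsOrientationForm o) (hoB : IsOrientationForm oB)
    (hj : Manifold.IsSmoothEmbedding (𝓡 m) (𝓡∂ (m + 1)) ∞ j)
    (hr : Set.range j ⊆ (𝓡∂ (m + 1)).boundary W) (hor : PreservesBoundaryOrientation oB o j)
    {i : W} {b : B} (hb : j b ∈ (extChartAt (𝓡∂ (m + 1)) i).source)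
    (v : Fin m → EuclideanSpace ℝ (Fin m)) :
    Real.sign (oB b v) = Real.sign (((bdryForm o i (bdryChart m j i b)).compContinuousLinearMap
      (show EuclideanSpace ℝ (Fin m) →L[ℝ] EuclideanSpace ℝ (Fin m) from
        mfderiv (𝓡 m) 𝓘(ℝ, EuclideanSpace ℝ (Fin m)) (bdryChart m j i) b)) v) := by
  refine sign_form_eq_of_pos_iff (f := oB b) (hoB.ne_zero b) (fun h0 => ?_) (fun w => ?_) v
  · have h1 := DFunLike.congr_fun h0 (stdFrame m)
    have h2 := (form_comp_stdFrame (bdryForm o i (bdryChart m j i b)) _).symm.trans h1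
    rw [bdryForm_stdFrame] at h2
    refine (mul_ne_zero (det_ne_zero_of_injective (mfderiv_bdryChart_injective hj hr hb))
      (neg_ne_zero.2 (ho.chartRep_ne_zero i ?_))) h2
    rw [bdryIncl_bdryChart hr hb]
    exact (extChartAt (𝓡∂ (m + 1)) i).map_source hb
  · obtain ⟨ν, hν, hν'⟩ := exists_isOutward hr hb
    have h := hor b ν hν w
    rw [form_eq_bdryForm hj.isImmersion.contMDiff hr hb hν'] at h
    exact h

variable [IsManifold (𝓡 m) ∞ B]

theorem isOpen_image_bdryChart (hj : Manifold.IsSmoothEmbedding (𝓡 m) (𝓡∂ (m + 1)) ∞ j)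
    (hr : Set.range j ⊆ (𝓡∂ (m + 1)).boundary W) (i : W) :
    IsOpen (bdryChart m j i '' (j ⁻¹' (extChartAt (𝓡∂ (m + 1)) i).source)) := by
  rw [isOpen_iff_mem_nhds]
  rintro _ ⟨b, hb, rfl⟩
  rw [← map_nhds_bdryChart hj hr hb]
  exact Filter.image_mem_map (((isOpen_extChartAt_source i).preimage
    hj.isEmbedding.continuous).mem_nhds hb)

/-- The image of an `m`-dimensional piece of the boundary is open in the boundary. -/
theorem exists_isOpen_inter_boundary_eq_range
    (hj : Manifold.IsSmoothEmbedding (𝓡 m) (𝓡∂ (m + 1)) ∞ j)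
    (hr : Set.range j ⊆ (𝓡∂ (m + 1)).boundary W) :
    ∃ N : Set W, IsOpen N ∧ N ∩ (𝓡∂ (m + 1)).boundary W = Set.range j := by
  let N : W → Set W := fun i => (extChartAt (𝓡∂ (m + 1)) i).source ∩
    (fun w => bdryProj m (extChartAt (𝓡∂ (m + 1)) i w)) ⁻¹'
      (bdryChart m j i '' (j ⁻¹' (extChartAt (𝓡∂ (m + 1)) i).source))
  refine ⟨⋃ i, N i, isOpen_iUnion fun i => ?_, Set.Subset.antisymm ?_ ?_⟩
  · exact ((bdryProj m).continuous.comp_continuousOn (continuousOn_extChartAt i)).isOpen_inter_preimage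
      (isOpen_extChartAt_source i) (isOpen_image_bdryChart hj hr i)
  · rintro w ⟨hw, hwb⟩
    obtain ⟨i, hi, b, hb, hbw⟩ := Set.mem_iUnion.1 hw
    have h := congrArg (bdryIncl m) hbw
    rw [bdryIncl_bdryChart hr hb, bdryIncl_bdryProj (coord_zero_of_isBoundaryPoint hwb hi)] at h
    exact ⟨b, (extChartAt (𝓡∂ (m + 1)) i).injOn hb hi h⟩
  · rintro _ ⟨b, rfl⟩
    exact ⟨Set.mem_iUnion.2 ⟨j b, mem_extChartAt_source _, b, mem_extChartAt_source _, rfl⟩,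
      hr ⟨b, rfl⟩⟩

theorem measurableSet_bdryPart_range (hj : Manifold.IsSmoothEmbedding (𝓡 m) (𝓡∂ (m + 1)) ∞ j)
    (hr : Set.range j ⊆ (𝓡∂ (m + 1)).boundary W) (i : W) :
    MeasurableSet (bdryPart (m := m) i (Set.range j)) := by
  rw [← image_bdryChart hr i]
  exact (isOpen_image_bdryChart hj hr i).measurableSet

variable [T2Space B] [SecondCountableTopology B]

/-- The change of variables through the boundary coordinates. The outward vector points in the
negative coordinate direction, so the orientation form `bdryForm` carries a minus sign, which
becomes the one here. -/
theorem integral_pullback_chart {o : DForm (𝓡∂ (m + 1)) W (m + 1)} {oB : DForm (𝓡 m) B m}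
    (ho : IsOrientationForm o) (hoB : IsOrientationForm oB)
    (hj : Manifold.IsSmoothEmbedding (𝓡 m) (𝓡∂ (m + 1)) ∞ j) (hcl : IsClosed (Set.range j))
    (hr : Set.range j ⊆ (𝓡∂ (m + 1)).boundary W) (hor : PreservesBoundaryOrientation oB o j)
    {ν : DForm (𝓡∂ (m + 1)) W m} (hν : IsSmoothForm ν) (i : W)
    {L : Set W} (hL : IsCompact L) (hLi : L ⊆ (extChartAt (𝓡∂ (m + 1)) i).source)
    (h0 : ∀ x ∉ L, ν x = 0) :
    IntegrableOn (bdryIntegrand o ν i) (bdryPart i (Set.range j)) ∧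
      integral oB (pullback j ν) = -∫ y in bdryPart i (Set.range j), bdryIntegrand o ν i y := by
  have hjc : Topology.IsClosedEmbedding j := ⟨hj.isEmbedding, hcl⟩
  have h := integral_eq_setIntegral_image hoB.smooth (hν.pullback hj.isImmersion.contMDiff)
    ((isOpen_extChartAt_source i).preimage hj.isEmbedding.continuous)
    (hjc.isCompact_preimage hL) (Set.preimage_mono hLi)
    (fun x hx => by
      have : ν (j x) = 0 := h0 _ hx
      rw [DHCob.pullback, this]
      rfl)
    (injOn_bdryChart hj.isEmbedding.injective hr i)
    (fun x hx => (hasMFDerivAt_bdryChart hj.isImmersion.contMDiff hx).mdifferentiableAt)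
    (isOpen_image_bdryChart hj hr i).measurableSet
    (fun y => (chartRep ν i (bdryIncl m y)).compContinuousLinearMap (bdryIncl m))
    (bdryForm o i)
    (fun x hx => by
      rw [DHCob.pullback, eq_chartRep_comp_mfderiv ν hx, ← bdryIncl_bdryChart hr hx]
      ext v
      exact congrArg (chartRep ν i (bdryIncl m (bdryChart m j i x))) (funext fun a =>
        (bdryIncl_mfderiv_bdryChart hj.isImmersion.contMDiff hr hx (v a)).symm))
    (fun x hx v => sign_eq_sign_bdryForm ho hoB hj hr hor hx v)
    (fun x hx hxL => by
      rw [bdryIncl_bdryChart hr hx, chartRep_eq_zero (by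
        rw [(extChartAt (𝓡∂ (m + 1)) i).left_inv hx]; exact h0 _ hxL)]
      rfl)
  have heq : ∀ y, Real.sign (bdryForm o i y (stdFrame m)) *
      ((chartRep ν i (bdryIncl m y)).compContinuousLinearMap (bdryIncl m)) (stdFrame m) =
        -bdryIntegrand o ν i y := by
    intro y
    rw [bdryForm_stdFrame, Real.sign_neg, neg_mul]
    rfl
  simp only [heq, image_bdryChart hr i] at h
  refine ⟨by simpa using h.1.neg, ?_⟩
  rw [h.2, MeasureTheory.integral_neg]

variable [T2Space W] [SecondCountableTopology W]

/-- The integral over a piece of the boundary of the pullback of a compactly supported form. -/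
theorem integral_pullback_eq_neg_bdryIntegral {o : DForm (𝓡∂ (m + 1)) W (m + 1)}
    {oB : DForm (𝓡 m) B m} (ho : IsOrientationForm o) (hoB : IsOrientationForm oB)
    (hj : Manifold.IsSmoothEmbedding (𝓡 m) (𝓡∂ (m + 1)) ∞ j) (hcl : IsClosed (Set.range j))
    (hr : Set.range j ⊆ (𝓡∂ (m + 1)).boundary W) (hor : PreservesBoundaryOrientation oB o j)
    {μ : DForm (𝓡∂ (m + 1)) W m} (hμ : IsSmoothForm μ) {K : Set W} (hK : IsCompact K)
    (h0 : ∀ x ∉ K, μ x = 0) :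
    (∀ i, IntegrableOn (bdryIntegrand o (localize μ i) i) (bdryPart i (Set.range j))) ∧
      integral oB (pullback j μ) = -bdryIntegral o μ hK (Set.range j) := by
  have hjc : Topology.IsClosedEmbedding j := ⟨hj.isEmbedding, hcl⟩
  have h := fun i => integral_pullback_chart ho hoB hj hcl hr hor (hμ.localize i) i
    (hK.inter_right (isClosed_tsupport (chartPartition (𝓡∂ (m + 1)) W i)))
    (Set.inter_subset_right.trans (tsupport_chartPartition_subset i))
    (fun _ hx => localize_eq_zero h0 i hx)
  refine ⟨fun i => (h i).1, ?_⟩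
  -- The partition of unity of `W` is pulled back too; that of `B` plays no role.
  have hsum : (pullback j μ : DForm (𝓡 m) B m) =
      ∑ i ∈ (finite_chartPartition (I := 𝓡∂ (m + 1)) hK).toFinset, pullback j (localize μ i) := by
    conv_lhs => rw [← sum_localize hK h0]
    funext x
    ext v
    rw [Finset.sum_apply, DHCob.pullback, Finset.sum_apply]
    simp [DHCob.pullback]
  rw [hsum, integral_sum_forms hoB.smooth _
    (fun i _ => (hμ.localize i).pullback hj.isImmersion.contMDiff)
    (hjc.isCompact_preimage hK) (fun i _ x hx => by
      have : localize μ i (j x) = 0 := localize_eq_zero h0 i fun hm => hx hm.1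
      rw [DHCob.pullback, this]
      rfl), Finset.sum_congr rfl fun i _ => (h i).2, Finset.sum_neg_distrib]
  rfl

end PieceIntegral

end DHCob
end

noncomputable section

namespace DHCob

/-! ### Pullbacks and supports of the integrands, and the untwisted case. -/

section PullbackMixed

variable {r : ℕ} {m : ℕ} {H : Type*} [TopologicalSpace H]
  {I : ModelWithCorners ℝ (EuclideanSpace ℝ (Fin m)) H}
  {M : Type*} [TopologicalSpace M] [ChartedSpace H M]
  {m' : ℕ} {H' : Type*} [TopologicalSpace H']
  {I' : ModelWithCorners ℝ (EuclideanSpace ℝ (Fin m')) H'}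
  {N : Type*} [TopologicalSpace N] [ChartedSpace H' N]

theorem pullback_smul {k : ℕ} (f : N → M) (c : ℝ) (α : DForm I M k) :
    (pullback f (c • α) : DForm I' N k) = c • pullback f α := rfl

theorem pullback_sum {k : ℕ} (f : N → M) {ι : Type*} (s : Finset ι) (α : ι → DForm I M k) :
    (pullback f (∑ i ∈ s, α i) : DForm I' N k) = ∑ i ∈ s, pullback f (α i) := by
  let L : DForm I M k →ₗ[ℝ] DForm I' N k :=
    ⟨⟨fun α => pullback f α, fun _ _ => rfl⟩, fun _ _ => rfl⟩
  exact map_sum L α s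

theorem pullback_mixedWedge (f : N → M) (α β : MixedForm I M) (k : ℕ) :
    (pullback f (mixedWedge α β k) : DForm I' N k) =
      mixedWedge (fun k => pullback f (α k)) (fun k => pullback f (β k)) k :=
  funext fun x => congrFun (mcomp_mw (E := EuclideanSpace ℝ (Fin m'))
    (F := EuclideanSpace ℝ (Fin m)) (fun k => α k (f x)) (fun k => β k (f x))
    (mfderiv I' I f x)) k

theorem pullback_mixedOne (f : N → M) (k : ℕ) :
    (pullback f ((mixedOne : MixedForm I M) k) : DForm I' N k) = mixedOne k := by
  cases k <;> rfl

theorem pullback_ofTwoForm (f : N → M) (ωM : DForm I M 2) (k : ℕ) :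
    (pullback f (ofTwoForm ωM k) : DForm I' N k) = ofTwoForm (pullback f ωM) k := by
  match k with
  | 0 => rfl
  | 1 => rfl
  | 2 => rfl
  | k + 3 => rfl

theorem pullback_powForm (f : N → M) (ωM : DForm I M 2) (n k : ℕ) :
    (pullback f (powForm ωM n k) : DForm I' N k) = powForm (pullback f ωM) n k := by
  induction n generalizing k with
  | zero => exact pullback_mixedOne f k
  | succ n ih =>
    rw [powForm, pullback_mixedWedge, powForm]
    congr 1
    · exact funext fun k => pullback_ofTwoForm f ωM k
    · exact funext ih

theorem pullback_expForm (f : N → M) (ωM : DForm I M 2) (k : ℕ) :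
    (pullback f (expForm ωM k) : DForm I' N k) = expForm (pullback f ωM) k := by
  rw [expForm, pullback_sum, expForm]
  exact Finset.sum_congr rfl fun j _ => by rw [pullback_smul, pullback_powForm]

theorem pullback_twistedPairing (b : Module.Basis (Fin r) ℝ (LieAlg r)) {f : N → M}
    {η : EquivForm I M r} {η' : EquivForm I' N r} (h : η.PullsBackTo f η') (Φ : M → LieDual r)
    (φ : LieDual r → ℝ) (k : ℕ) :
    (pullback f (twistedPairing b η Φ φ k) : DForm I' N k) =
      twistedPairing b η' (Φ ∘ f) φ k := by
  -- Pulling back can make coefficients vanish but cannot create new ones, so both sums run over the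
  -- index set of `η`.
  have hs : η'.support ⊆ η.support := by
    intro a ha
    rw [Finsupp.mem_support_iff] at ha ⊢
    intro h0
    refine ha (funext fun k => ?_)
    rw [← h a k, h0]
    rfl
  rw [twistedPairing, twistedPairing, Finsupp.sum_of_support_subset _ hs, Finsupp.sum,
    Finset.sum_apply, Finset.sum_apply, pullback_sum]
  · refine Finset.sum_congr rfl fun a _ => ?_
    rw [← funext (h a)]
    rfl
  · intro a _
    funext k x
    exact smul_zero _

end PullbackMixed

section Support

variable {r : ℕ} (b : Module.Basis (Fin r) ℝ (LieAlg r))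

/-- Together with properness this keeps the integrand compactly supported for every multi-index at
once. -/
theorem tsupport_monomialDeriv_subset (a : Fin r →₀ ℕ) (φ : LieDual r → ℝ) :
    tsupport (monomialDeriv b a φ) ⊆ tsupport φ := by
  have h1 : ∀ i n (χ : LieDual r → ℝ), tsupport ((coordDeriv b i)^[n] χ) ⊆ tsupport χ := by
    intro i n
    induction n with
    | zero => exact fun _ => subset_rfl
    | succ n ih => exact fun χ => (ih _).trans (tsupport_fderiv_apply_subset ℝ _)
  rw [monomialDeriv_eq]
  induction List.finRange r with
  | nil => exact subset_rfl
  | cons i l ih => exact (h1 i _ _).trans ih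

theorem twistedPairing_eq_zero {m : ℕ} {H : Type*} [TopologicalSpace H]
    {I : ModelWithCorners ℝ (EuclideanSpace ℝ (Fin m)) H}
    {M : Type*} [TopologicalSpace M] [ChartedSpace H M] (η : EquivForm I M r) {Φ : M → LieDual r}
    {φ : LieDual r → ℝ} {x : M} (hx : Φ x ∉ tsupport φ) (k : ℕ) :
    twistedPairing b η Φ φ k x = 0 := by
  rw [twistedPairing, Finsupp.sum, Finset.sum_apply, Finset.sum_apply]
  refine Finset.sum_eq_zero fun a _ => ?_
  rw [image_eq_zero_of_notMem_tsupport fun h => hx (tsupport_monomialDeriv_subset b a φ h),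
    zero_smul]

theorem mixedWedge_twistedPairing_eq_zero {m : ℕ} {H : Type*} [TopologicalSpace H]
    {I : ModelWithCorners ℝ (EuclideanSpace ℝ (Fin m)) H}
    {M : Type*} [TopologicalSpace M] [ChartedSpace H M] (α : MixedForm I M) (η : EquivForm I M r)
    {Φ : M → LieDual r} {φ : LieDual r → ℝ} {x : M} (hx : Φ x ∉ tsupport φ) (k : ℕ) :
    mixedWedge α (twistedPairing b η Φ φ) k x = 0 := by
  have h : (fun k => twistedPairing b η Φ φ k x) = 0 :=
    funext fun k => twistedPairing_eq_zero b η hx k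
  exact congrFun ((congrArg (mw (E := EuclideanSpace ℝ (Fin m)) fun k => α k x) h).trans
    (mw_zero_right (E := EuclideanSpace ℝ (Fin m)) _)) k

end Support

section Untwisted

variable {r : ℕ} {m : ℕ} {H : Type*} [TopologicalSpace H]
  {I : ModelWithCorners ℝ (EuclideanSpace ℝ (Fin m)) H}
  {M : Type*} [TopologicalSpace M] [ChartedSpace H M]

variable (I M r) in
/-- The equivariant form `1`. -/
def EquivForm.one : EquivForm I M r := Finsupp.single 0 mixedOne

theorem EquivForm.eval_one (b : Module.Basis (Fin r) ℝ (LieAlg r)) (X : LieAlg r) :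
    (EquivForm.one r I M).eval b X = mixedOne := by
  rw [EquivForm.eval, EquivForm.one, Finsupp.sum_single_index]
  · simp
  · exact smul_zero _

theorem EquivForm.one_pullsBackTo {m' : ℕ} {H' : Type*} [TopologicalSpace H']
    {I' : ModelWithCorners ℝ (EuclideanSpace ℝ (Fin m')) H'}
    {N : Type*} [TopologicalSpace N] [ChartedSpace H' N] (f : N → M) :
    (EquivForm.one r I M).PullsBackTo f (EquivForm.one r I' N) := by
  intro a k
  rw [EquivForm.one, EquivForm.one, Finsupp.single_apply, Finsupp.single_apply]
  split_ifs
  · exact pullback_mixedOne f k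
  · rfl

theorem extD_mixedOne [IsManifold I ∞ M] (k : ℕ) : extD ((mixedOne : MixedForm I M) k) = 0 := by
  cases k with
  | succ k => exact extD_zero
  | zero =>
    funext x
    have h : chartRep ((mixedOne : MixedForm I M) 0) x = fun _ => mone 0 :=
      funext fun y => congrFun (chartRepM_mixedOne x y) 0
    rw [extD_eq, h, extDerivWithin, fderivWithin_fun_const]
    exact map_zero (ContinuousAlternatingMap.alternatizeUncurryFinCLM (n := 0) ℝ
      (EuclideanSpace ℝ (Fin m)) ℝ)

theorem isClosedEquivForm_one [IsManifold I ∞ M] (G : Type*) [TopologicalSpace G]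
    [ChartedSpace (EuclideanSpace ℝ (Fin r)) G] [Group G] [MulAction G M]
    (b : Module.Basis (Fin r) ℝ (LieAlg r)) : IsClosedEquivForm G b (EquivForm.one r I M) where
  smooth a k := by
    rw [EquivForm.one, Finsupp.single_apply]
    split_ifs
    · exact isSmoothMixed_mixedOne k
    · exact isSmoothForm_zero
  invariant g X k := by
    rw [EquivForm.eval_one, EquivForm.eval_one, pullback_mixedOne]
  closed X k := by
    rw [EquivForm.eval_one, extD_mixedOne]
    rfl
  closed_zero X := by
    rw [EquivForm.eval_one]
    rfl

/-- Only the `n`-th power of a two-form has degree `2 * n`. -/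
theorem expForm_two_mul [IsManifold I ∞ M] (ωM : DForm I M 2) (n : ℕ) :
    expForm ωM (2 * n) = ((n.factorial : ℝ)⁻¹) • powForm ωM n (2 * n) := by
  rw [expForm]
  refine Finset.sum_eq_single n (fun j _ hj => ?_) fun h => ?_
  · have : powForm ωM j (2 * n) = 0 := by
      funext x
      have h := congrFun (chartRepM_self (powForm ωM j) x) (2 * n)
      rw [chartRepM_powForm, mpow_eq_zero (chartRepM_ofTwoForm_eq_zero ωM x _) j _ (by omega)] at h
      exact h.symm
    rw [this, smul_zero]
  · simp only [Finset.mem_range] at h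
    omega

/-- For `η = 1` no derivative falls on `φ`, and the top-degree part of `e^ω` is `ωⁿ / n!`. The
evenness of `m` makes the division `m / 2` exact. -/
theorem DH_eq_twistedDH [IsManifold I ∞ M] [T2Space M] [SecondCountableTopology M]
    (b : Module.Basis (Fin r) ℝ (LieAlg r)) (hm : Even m) (o : DForm I M m)
    (ωM : DForm I M 2) (Φ : M → LieDual r) :
    DH o ωM Φ = twistedDH b o ωM Φ (EquivForm.one r I M) := by
  funext φ
  rw [DH, twistedDH]
  congr 1
  funext x
  have h1 : (fun k => twistedPairing b (EquivForm.one r I M) Φ φ k x) =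
      φ (Φ x) • (mone : MAlt (EuclideanSpace ℝ (Fin m))) := by
    have h2 : twistedPairing b (EquivForm.one r I M) Φ φ =
        fun k x => φ (Φ x) • (mixedOne : MixedForm I M) k x := by
      rw [twistedPairing, EquivForm.one, Finsupp.sum_single_index]
      · have : monomialDeriv b 0 φ = φ := by
          rw [monomialDeriv_eq]
          induction List.finRange r with
          | nil => rfl
          | cons i l ih => exact ih
        rw [this]
      · funext k x
        exact smul_zero _
    rw [h2]
    funext k
    cases k <;> rfl
  have h3 : mixedWedge (expForm ωM) (twistedPairing b (EquivForm.one r I M) Φ φ) m x =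
      φ (Φ x) • expForm ωM m x := by
    exact (congrFun (congrArg (mw (E := EuclideanSpace ℝ (Fin m)) fun k => expForm ωM k x) h1)
      m).trans ((congrFun (mw_smul_right (E := EuclideanSpace ℝ (Fin m)) (φ (Φ x)) _ _) m).trans
        (congrArg (fun f => φ (Φ x) • f)
          (congrFun (mw_mone (E := EuclideanSpace ℝ (Fin m)) fun k => expForm ωM k x) m)))
  have h5 : expForm ωM m = (((m / 2).factorial : ℝ)⁻¹) • powForm ωM (m / 2) m := by
    obtain ⟨n, rfl⟩ := hm.exists_two_nsmul
    have h6 := expForm_two_mul ωM n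
    simp only [smul_eq_mul] at ωM ⊢
    rw [Nat.mul_div_cancel_left n two_pos]
    exact h6
  rw [h3, h5, mul_smul]
  rfl

end Untwisted

theorem IsOrientationForm.neg {m : ℕ} {H : Type*} [TopologicalSpace H]
    {I : ModelWithCorners ℝ (EuclideanSpace ℝ (Fin m)) H}
    {M : Type*} [TopologicalSpace M] [ChartedSpace H M] {o : DForm I M m}
    (h : IsOrientationForm o) : IsOrientationForm (-o) where
  smooth := by
    have := h.smooth.const_smul (-1)
    rwa [show (-1 : ℝ) • o = -o from neg_one_smul ℝ o] at this
  ne_zero x := neg_ne_zero.2 (h.ne_zero x)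

section BoundaryDH

variable {r m : ℕ}
  {W : Type*} [TopologicalSpace W] [ChartedSpace (EuclideanHalfSpace (m + 1)) W]

theorem twistedDH_pullback {B : Type*} [TopologicalSpace B]
    [ChartedSpace (EuclideanSpace ℝ (Fin m)) B]
    [IsManifold (𝓡 m) ∞ B] [T2Space B] [SecondCountableTopology B]
    {b : Module.Basis (Fin r) ℝ (LieAlg r)} (oB : DForm (𝓡 m) B m)
    (ωW : DForm (𝓡∂ (m + 1)) W 2) (Φ : W → LieDual r) {η : EquivForm (𝓡∂ (m + 1)) W r}
    {η' : EquivForm (𝓡 m) B r} {j : B → W} (h : η.PullsBackTo j η')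
    (φ : 𝓓((⊤ : Opens (LieDual r)), ℝ)) :
    twistedDH b oB (pullback j ωW) (Φ ∘ j) η' φ =
      integral oB (pullback j (mixedWedge (expForm ωW) (twistedPairing b η Φ φ) m)) := by
  rw [twistedDH, pullback_mixedWedge]
  congr 3
  · exact funext fun k => (pullback_expForm j ωW k).symm
  · exact funext fun k => (pullback_twistedPairing b h Φ φ k).symm

variable [IsManifold (𝓡∂ (m + 1)) ∞ W]

/-- The form `e^ω ∧ D_{η,Φ}(φ)` in degree `m` on an `(m + 1)`-dimensional proper Hamiltonian
manifold is smooth, closed and compactly supported. -/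
theorem twisted_properties {G : Type*} [TopologicalSpace G]
    [ChartedSpace (EuclideanSpace ℝ (Fin r)) G] [Group G] [MulAction G W]
    {b : Module.Basis (Fin r) ℝ (LieAlg r)}
    {o : DForm (𝓡∂ (m + 1)) W (m + 1)} {ωW : DForm (𝓡∂ (m + 1)) W 2} {Φ : W → LieDual r}
    (hW : IsHamiltonian G o ωW Φ) (hΦ : IsProperMap Φ) {η : EquivForm (𝓡∂ (m + 1)) W r}
    (hη : IsClosedEquivForm G b η) (φ : 𝓓((⊤ : Opens (LieDual r)), ℝ)) :
    IsSmoothForm (mixedWedge (expForm ωW) (twistedPairing b η Φ φ) m) ∧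
      extD (mixedWedge (expForm ωW) (twistedPairing b η Φ φ) m) = 0 ∧
      IsCompact (Φ ⁻¹' tsupport φ) ∧
      ∀ x ∉ Φ ⁻¹' tsupport φ, mixedWedge (expForm ωW) (twistedPairing b η Φ φ) m x = 0 := by
  have hφ : ContDiff ℝ ∞ φ := φ.contDiff
  exact ⟨(isSmoothMixed_expForm hW.smooth).mixedWedge
      (isSmoothMixed_twistedPairing b hη.smooth hW.smooth_moment hφ) m,
    extD_twisted_eq_zero hW hη hφ, hΦ.isCompact_preimage φ.hasCompactSupport,
    fun x hx => mixedWedge_twistedPairing_eq_zero b _ η hx m⟩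

/-- If a piece of the boundary is open in the boundary, its complement is closed. -/
theorem isClosed_of_disjoint_range {M₀ : Type*} [TopologicalSpace M₀]
    [ChartedSpace (EuclideanSpace ℝ (Fin m)) M₀] [IsManifold (𝓡 m) ∞ M₀] {i₀ : M₀ → W} {T : Set W}
    (h₀ : Manifold.IsSmoothEmbedding (𝓡 m) (𝓡∂ (m + 1)) ∞ i₀)
    (hd : Disjoint (Set.range i₀) T)
    (hr : Set.range i₀ ∪ T = (𝓡∂ (m + 1)).boundary W) : IsClosed T := by
  obtain ⟨N, hN, hNr⟩ := exists_isOpen_inter_boundary_eq_range h₀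
    (Set.subset_union_left.trans hr.subset)
  have hcl : IsClosed ((𝓡∂ (m + 1)).boundary W) :=
    (𝓡∂ (m + 1)).isClosed_boundary (n := ∞) (by simp)
  -- Both factors are closed: the boundary in `W`, and the complement of the open set `N`.
  have : T = (𝓡∂ (m + 1)).boundary W ∩ Nᶜ := by
    rw [← Set.sdiff_eq, ← Set.sdiff_inter_self_eq_sdiff, hNr, ← hr,
      Set.union_sdiff_left, hd.symm.sdiff_eq_left]
  rw [this]
  exact hcl.inter hN.isClosed_compl

variable [T2Space W] [SecondCountableTopology W]

/-- The twisted Duistermaat–Heckman distribution of an oriented boundary vanishes. -/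
theorem twistedDH_boundary_eq_zero {B : Type*} [TopologicalSpace B]
    [ChartedSpace (EuclideanSpace ℝ (Fin m)) B]
    [IsManifold (𝓡 m) ∞ B] [T2Space B] [SecondCountableTopology B]
    {G : Type*} [TopologicalSpace G]
    [ChartedSpace (EuclideanSpace ℝ (Fin r)) G] [Group G] [MulAction G W]
    {b : Module.Basis (Fin r) ℝ (LieAlg r)}
    {o : DForm (𝓡∂ (m + 1)) W (m + 1)} {ωW : DForm (𝓡∂ (m + 1)) W 2} {Φ : W → LieDual r}
    (hW : IsHamiltonian G o ωW Φ) (hΦ : IsProperMap Φ) {η : EquivForm (𝓡∂ (m + 1)) W r}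
    (hη : IsClosedEquivForm G b η) {oB : DForm (𝓡 m) B m} (hoB : IsOrientationForm oB)
    {j : B → W} (hj : IsOrientedBoundary oB o j) {η' : EquivForm (𝓡 m) B r}
    (h : η.PullsBackTo j η') :
    twistedDH b oB (pullback j ωW) (Φ ∘ j) η' = 0 := by
  funext φ
  obtain ⟨hμ, hd, hK, h0⟩ := twisted_properties hW hΦ hη φ
  have hcl : IsClosed (Set.range j) := by
    rw [hj.range_eq]
    exact (𝓡∂ (m + 1)).isClosed_boundary (n := ∞) (by simp)
  rw [twistedDH_pullback oB ωW Φ h, (integral_pullback_eq_neg_bdryIntegral hW.orientation hoB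
    hj.embedding hcl hj.range_eq.subset hj.orientation hμ hK h0).2, hj.range_eq,
    bdryIntegral_boundary hW.orientation hμ hd hK h0, neg_zero]
  rfl

end BoundaryDH

end DHCob
end

noncomputable section

namespace DHCob

/-! ### Cobordism invariance. -/

section Cobordism

variable {r m : ℕ} {G : Type*} [TopologicalSpace G] [ChartedSpace (EuclideanSpace ℝ (Fin r)) G]
  [Group G]
  {W : Type*} [TopologicalSpace W] [ChartedSpace (EuclideanHalfSpace (m + 1)) W]
  [IsManifold (𝓡∂ (m + 1)) ∞ W] [T2Space W] [SecondCountableTopology W] [MulAction G W]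
  {M₀ : Type*} [TopologicalSpace M₀] [ChartedSpace (EuclideanSpace ℝ (Fin m)) M₀]
  [IsManifold (𝓡 m) ∞ M₀] [T2Space M₀] [SecondCountableTopology M₀] [MulAction G M₀]
  {M₁ : Type*} [TopologicalSpace M₁] [ChartedSpace (EuclideanSpace ℝ (Fin m)) M₁]
  [IsManifold (𝓡 m) ∞ M₁] [T2Space M₁] [SecondCountableTopology M₁] [MulAction G M₁]

/-- Cobordism invariance of the twisted Duistermaat–Heckman distribution. -/
theorem IsProperHamiltonianCobordism.twistedDH_eq {b : Module.Basis (Fin r) ℝ (LieAlg r)}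
    {o₀ : DForm (𝓡 m) M₀ m} {ω₀ : DForm (𝓡 m) M₀ 2} {Φ₀ : M₀ → LieDual r}
    {η₀ : EquivForm (𝓡 m) M₀ r}
    {o₁ : DForm (𝓡 m) M₁ m} {ω₁ : DForm (𝓡 m) M₁ 2} {Φ₁ : M₁ → LieDual r}
    {η₁ : EquivForm (𝓡 m) M₁ r}
    {o : DForm (𝓡∂ (m + 1)) W (m + 1)} {ωW : DForm (𝓡∂ (m + 1)) W 2} {Φ : W → LieDual r}
    {η : EquivForm (𝓡∂ (m + 1)) W r} {i₀ : M₀ → W} {i₁ : M₁ → W}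
    (h₀ : IsHamiltonian G o₀ ω₀ Φ₀) (h₁ : IsHamiltonian G o₁ ω₁ Φ₁)
    (h : IsProperHamiltonianCobordism G o₀ ω₀ Φ₀ o₁ ω₁ Φ₁ o ωW Φ i₀ i₁)
    (hη : IsClosedEquivForm G b η) (hη₀ : η.PullsBackTo i₀ η₀) (hη₁ : η.PullsBackTo i₁ η₁) :
    IsProperMap Φ₀ ∧ IsProperMap Φ₁ ∧
      twistedDH b o₀ ω₀ Φ₀ η₀ = twistedDH b o₁ ω₁ Φ₁ η₁ := by
  -- Each end is open in the boundary, so the other one is closed in `W`. This makes the embeddings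
  -- proper and the pulled back forms compactly supported.
  have hc₁ : IsClosed (Set.range i₁) :=
    isClosed_of_disjoint_range h.embedding₀ h.disjoint h.range_eq
  have hc₀ : IsClosed (Set.range i₀) :=
    isClosed_of_disjoint_range h.embedding₁ h.disjoint.symm
      ((Set.union_comm _ _).trans h.range_eq)
  have hr₀ := Set.subset_union_left.trans h.range_eq.subset
  have hr₁ := Set.subset_union_right.trans h.range_eq.subset
  refine ⟨?_, ?_, ?_⟩
  · rw [← h.moment₀]
    exact h.proper.comp
      (Topology.IsClosedEmbedding.mk h.embedding₀.isEmbedding hc₀).isProperMap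
  · rw [← h.moment₁]
    exact h.proper.comp
      (Topology.IsClosedEmbedding.mk h.embedding₁.isEmbedding hc₁).isProperMap
  · funext φ
    obtain ⟨hμ, hd, hK, hz⟩ := twisted_properties h.hamiltonian h.proper hη φ
    have ho := h.hamiltonian.orientation
    obtain ⟨hi₀, he₀⟩ := integral_pullback_eq_neg_bdryIntegral ho h₀.orientation.neg
      h.embedding₀ hc₀ hr₀ h.orientation₀ hμ hK hz
    obtain ⟨hi₁, he₁⟩ := integral_pullback_eq_neg_bdryIntegral ho h₁.orientation
      h.embedding₁ hc₁ hr₁ h.orientation₁ hμ hK hz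
    have hs := bdryIntegral_boundary ho hμ hd hK hz
    rw [← h.range_eq, bdryIntegral_union hK h.disjoint
      (measurableSet_bdryPart_range h.embedding₁ hr₁) hi₀ hi₁] at hs
    rw [integral_neg_orientation] at he₀
    rw [← h.form₀, ← h.form₁, ← h.moment₀, ← h.moment₁, twistedDH_pullback o₀ ωW Φ hη₀,
      twistedDH_pullback o₁ ωW Φ hη₁]
    -- The boundary parts `b₀`, `b₁` satisfy `b₀ + b₁ = 0`. The integral over `M₁` is `-b₁`, and the
    -- one over `M₀` is `b₀` because of the reversed orientation.
    linarith

end Cobordism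

theorem pullback_comp {m : ℕ} {H : Type*} [TopologicalSpace H]
    {I : ModelWithCorners ℝ (EuclideanSpace ℝ (Fin m)) H}
    {M : Type*} [TopologicalSpace M] [ChartedSpace H M]
    {m' : ℕ} {H' : Type*} [TopologicalSpace H']
    {I' : ModelWithCorners ℝ (EuclideanSpace ℝ (Fin m')) H'}
    {N : Type*} [TopologicalSpace N] [ChartedSpace H' N]
    {m'' : ℕ} {H'' : Type*} [TopologicalSpace H'']
    {I'' : ModelWithCorners ℝ (EuclideanSpace ℝ (Fin m'')) H''}
    {P : Type*} [TopologicalSpace P] [ChartedSpace H'' P] {k : ℕ} {f : N → M} {h : P → N}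
    (hf : MDifferentiable I' I f) (hh : MDifferentiable I'' I' h) (α : DForm I M k) :
    (pullback (f ∘ h) α : DForm I'' P k) = pullback h (pullback f α : DForm I' N k) := by
  funext x
  rw [pullback, mfderiv_comp x (hf (h x)) (hh x)]
  rfl

/-! ### The Hamiltonian structure induced on the boundary. -/

section HamiltonianBoundary

variable {r : ℕ} {G : Type*} [TopologicalSpace G] [ChartedSpace (EuclideanSpace ℝ (Fin r)) G]
  [Group G]
  {m : ℕ} {H : Type*} [TopologicalSpace H]
  {I : ModelWithCorners ℝ (EuclideanSpace ℝ (Fin m)) H}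
  {M : Type*} [TopologicalSpace M] [ChartedSpace H M] [MulAction G M]
  {m' : ℕ} {H' : Type*} [TopologicalSpace H']
  {I' : ModelWithCorners ℝ (EuclideanSpace ℝ (Fin m')) H'}
  {N : Type*} [TopologicalSpace N] [ChartedSpace H' N] [MulAction G N]
  [ContMDiffSMul (𝓡 r) I' ∞ G N]

/-- The fundamental vector fields are related by an equivariant map. -/
theorem mfderiv_fundVF {f : N → M} (hf : ContMDiff I' I ∞ f)
    (he : ∀ (g : G) (x : N), f (g • x) = g • f x) (X : LieAlg r) (x : N) :
    mfderiv I' I f x (fundVF (I := I') G X x) = fundVF (I := I) G X (f x) := by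
  have ho : MDifferentiableAt (𝓡 r) I' (fun g : G => g • x) 1 :=
    ((contMDiff_id.smul contMDiff_const : ContMDiff (𝓡 r) I' ∞ fun g : G => g • x)
      |>.mdifferentiable (by simp)) 1
  have hf' : MDifferentiableAt I' I f ((1 : G) • x) := hf.mdifferentiable (by simp) _
  have hc := mfderiv_comp (1 : G) hf' ho
  -- Equivariance says that `f` maps orbit maps to orbit maps; the claim is the derivative of this
  -- identity at `1`.
  have hfun : f ∘ (fun g : G => g • x) = fun g : G => g • f x := funext fun g => he g x
  rw [hfun] at hc
  have h1 := congrArg (fun z => show EuclideanSpace ℝ (Fin m') →L[ℝ] EuclideanSpace ℝ (Fin m)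
    from mfderiv I' I f z) (one_smul G x)
  have h2 := congrArg (fun L : EuclideanSpace ℝ (Fin r) →L[ℝ] EuclideanSpace ℝ (Fin m) => L X) hc
  exact ((DFunLike.congr_fun h1 (show EuclideanSpace ℝ (Fin m') from
    fundVF (I := I') G X x)).symm.trans h2.symm)

/-- The pullback of a Hamiltonian structure by an equivariant smooth map. -/
theorem IsHamiltonian.pullback [IsManifold I ∞ M] [IsManifold I' ∞ N]
    [ContMDiffSMul (𝓡 r) I ∞ G M] {o : DForm I M m} {ωM : DForm I M 2}
    {Φ : M → LieDual r} (h : IsHamiltonian G o ωM Φ) {oN : DForm I' N m'}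
    (ho : IsOrientationForm oN) {f : N → M} (hf : ContMDiff I' I ∞ f)
    (he : ∀ (g : G) (x : N), f (g • x) = g • f x) :
    IsHamiltonian G oN (pullback f ωM) (Φ ∘ f) where
  orientation := ho
  smooth := h.smooth.pullback hf
  closed := by
    rw [extD_pullback h.smooth hf, h.closed]
    rfl
  invariant g := by
    have hN : MDifferentiable I' I' fun x : N => g • x :=
      (ContMDiffSMul.contMDiff_const_smul (I := 𝓡 r) (n := ∞) g).mdifferentiable (by simp)
    have hM : MDifferentiable I I fun x : M => g • x :=
      (ContMDiffSMul.contMDiff_const_smul (I := 𝓡 r) (n := ∞) g).mdifferentiable (by simp)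
    have hfd : MDifferentiable I' I f := hf.mdifferentiable (by simp)
    have hc : f ∘ (fun x : N => g • x) = (fun x : M => g • x) ∘ f := funext fun x => he g x
    rw [← pullback_comp hfd hN, hc, pullback_comp hM hfd, h.invariant g]
  smooth_moment := h.smooth_moment.comp hf
  equivariant g x X := by
    rw [Function.comp_apply, he, h.equivariant]
    rfl
  hamilton X x v := by
    have hΦ : MDifferentiableAt I 𝓘(ℝ, ℝ) (fun y => Φ y X) (f x) :=
      (((ContinuousLinearMap.apply ℝ ℝ X).contDiff.contMDiff (n := ∞)).comp
        h.smooth_moment).mdifferentiable (by simp) (f x)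
    have hfd : MDifferentiableAt I' I f x := hf.mdifferentiable (by simp) x
    have hc := mfderiv_comp x hΦ hfd
    have h1 : mfderiv I' 𝓘(ℝ, ℝ) (fun y => (Φ ∘ f) y X) x v =
        mfderiv I 𝓘(ℝ, ℝ) (fun y => Φ y X) (f x) (mfderiv I' I f x v) :=
      congrArg (fun L : EuclideanSpace ℝ (Fin m') →L[ℝ] ℝ => L v) hc
    rw [h1, h.hamilton X (f x)]
    change ωM (f x) _ = ωM (f x) _
    congr 1
    funext a
    refine Fin.cases ?_ (fun _ => rfl) a
    exact (mfderiv_fundVF hf he X x).symm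

end HamiltonianBoundary

end DHCob
end
theorem mainTheorem6 {r m : ℕ}
    {G : Type*} [TopologicalSpace G] [ChartedSpace (EuclideanSpace ℝ (Fin r)) G]
    [Group G] [LieGroup (𝓡 r) ∞ G] [CompactSpace G] [T2Space G]
    -- an `(m + 1)`-dimensional `G`-manifold `W` with boundary
    {W : Type*} [TopologicalSpace W] [ChartedSpace (EuclideanHalfSpace (m + 1)) W]
    [IsManifold (𝓡∂ (m + 1)) ∞ W] [T2Space W] [SecondCountableTopology W]
    [MulAction G W] [ContMDiffSMul (𝓡 r) (𝓡∂ (m + 1)) ∞ G W]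
    -- `m`-dimensional `G`-manifolds `B`, `M₀`, `M₁`
    {B : Type*} [TopologicalSpace B] [ChartedSpace (EuclideanSpace ℝ (Fin m)) B]
    [IsManifold (𝓡 m) ∞ B] [T2Space B] [SecondCountableTopology B]
    [MulAction G B] [ContMDiffSMul (𝓡 r) (𝓡 m) ∞ G B]
    {M₀ : Type*} [TopologicalSpace M₀] [ChartedSpace (EuclideanSpace ℝ (Fin m)) M₀]
    [IsManifold (𝓡 m) ∞ M₀] [T2Space M₀] [SecondCountableTopology M₀]
    [MulAction G M₀] [ContMDiffSMul (𝓡 r) (𝓡 m) ∞ G M₀]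
    {M₁ : Type*} [TopologicalSpace M₁] [ChartedSpace (EuclideanSpace ℝ (Fin m)) M₁]
    [IsManifold (𝓡 m) ∞ M₁] [T2Space M₁] [SecondCountableTopology M₁]
    [MulAction G M₁] [ContMDiffSMul (𝓡 r) (𝓡 m) ∞ G M₁] :
    -- the boundary `B` of a proper Hamiltonian `G`-manifold `W` of odd dimension `m + 1`
    (∀ (o : DForm (𝓡∂ (m + 1)) W (m + 1)) (ωW : DForm (𝓡∂ (m + 1)) W 2) (Φ : W → LieDual r)
        (oB : DForm (𝓡 m) B m) (j : B → W),
      Even m → IsHamiltonian G o ωW Φ → IsProperMap Φ →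
      IsOrientationForm oB → IsOrientedBoundary oB o j → (∀ (g : G) (x : B), j (g • x) = g • j x) →
        IsHamiltonian G oB (pullback j ωW) (Φ ∘ j) ∧ IsProperMap (Φ ∘ j) ∧
        DH oB (pullback j ωW) (Φ ∘ j) = 0) ∧
    -- proper Hamiltonian cobordism between even-dimensional Hamiltonian `G`-manifolds
    (∀ (o₀ : DForm (𝓡 m) M₀ m) (ω₀ : DForm (𝓡 m) M₀ 2) (Φ₀ : M₀ → LieDual r)
        (o₁ : DForm (𝓡 m) M₁ m) (ω₁ : DForm (𝓡 m) M₁ 2) (Φ₁ : M₁ → LieDual r)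
        (o : DForm (𝓡∂ (m + 1)) W (m + 1)) (ωW : DForm (𝓡∂ (m + 1)) W 2) (Φ : W → LieDual r)
        (i₀ : M₀ → W) (i₁ : M₁ → W),
      Even m → IsHamiltonian G o₀ ω₀ Φ₀ → IsHamiltonian G o₁ ω₁ Φ₁ →
      IsProperHamiltonianCobordism G o₀ ω₀ Φ₀ o₁ ω₁ Φ₁ o ωW Φ i₀ i₁ →
        IsProperMap Φ₀ ∧ IsProperMap Φ₁ ∧ DH o₀ ω₀ Φ₀ = DH o₁ ω₁ Φ₁) ∧
    -- twisted version, in any dimension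
    (∀ (b : Module.Basis (Fin r) ℝ (LieAlg r))
        (o₀ : DForm (𝓡 m) M₀ m) (ω₀ : DForm (𝓡 m) M₀ 2) (Φ₀ : M₀ → LieDual r)
        (η₀ : EquivForm (𝓡 m) M₀ r)
        (o₁ : DForm (𝓡 m) M₁ m) (ω₁ : DForm (𝓡 m) M₁ 2) (Φ₁ : M₁ → LieDual r)
        (η₁ : EquivForm (𝓡 m) M₁ r)
        (o : DForm (𝓡∂ (m + 1)) W (m + 1)) (ωW : DForm (𝓡∂ (m + 1)) W 2) (Φ : W → LieDual r)
        (η : EquivForm (𝓡∂ (m + 1)) W r)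
        (i₀ : M₀ → W) (i₁ : M₁ → W),
      IsHamiltonian G o₀ ω₀ Φ₀ → IsClosedEquivForm G b η₀ →
      IsHamiltonian G o₁ ω₁ Φ₁ → IsClosedEquivForm G b η₁ →
      IsProperHamiltonianCobordism G o₀ ω₀ Φ₀ o₁ ω₁ Φ₁ o ωW Φ i₀ i₁ →
      IsClosedEquivForm G b η → η.PullsBackTo i₀ η₀ → η.PullsBackTo i₁ η₁ →
        IsProperMap Φ₀ ∧ IsProperMap Φ₁ ∧
        twistedDH b o₀ ω₀ Φ₀ η₀ = twistedDH b o₁ ω₁ Φ₁ η₁) := by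
  refine ⟨?_, ?_, ?_⟩
  · intro o ωW Φ oB j hm hW hΦ hoB hj he
    have hcl : IsClosed (Set.range j) := by
      rw [hj.range_eq]
      exact (𝓡∂ (m + 1)).isClosed_boundary (n := ∞) (by simp)
    refine ⟨hW.pullback hoB hj.embedding.isImmersion.contMDiff he, hΦ.comp
      (Topology.IsClosedEmbedding.mk hj.embedding.isEmbedding hcl).isProperMap, ?_⟩
    -- The untwisted distribution involves no basis of `𝔤`, so any basis may be used.
    rw [DH_eq_twistedDH (EuclideanSpace.basisFun (Fin r) ℝ).toBasis hm]
    exact twistedDH_boundary_eq_zero hW hΦ (isClosedEquivForm_one G _) hoB hj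
      (EquivForm.one_pullsBackTo j)
  · intro o₀ ω₀ Φ₀ o₁ ω₁ Φ₁ o ωW Φ i₀ i₁ hm h₀ h₁ h
    rw [DH_eq_twistedDH (EuclideanSpace.basisFun (Fin r) ℝ).toBasis hm,
      DH_eq_twistedDH (EuclideanSpace.basisFun (Fin r) ℝ).toBasis hm]
    exact h.twistedDH_eq h₀ h₁ (isClosedEquivForm_one G _) (EquivForm.one_pullsBackTo i₀)
      (EquivForm.one_pullsBackTo i₁)
  · intro b o₀ ω₀ Φ₀ η₀ o₁ ω₁ Φ₁ η₁ o ωW Φ η i₀ i₁ h₀ _ h₁ _ h hη hη₀ hη₁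
    exact h.twistedDH_eq h₀ h₁ hη hη₀ hη₁
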